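/- Let $F$ be an archimedean local field ($F\cong\mathbb R$ or $\mathbb C$), let $E$ be a quadratic étale $F$-algebra with nontrivial involution $\iota$ fixing $F$, let $(V,\langle\,,\rangle)$ be a finite-dimensional $E$-vector space with a nondegenerate $\iota$-hermitian form (linear in the first variable), and let $e\in V$ be such that $Ee$ is a free rank one $E$-module on which the form is nondegenerate. Put $V_H=(Ee)^\perp$, $G=\mathrm{Aut}(V/E,\langle\,,\rangle)$ and $H=\mathrm{Aut}(V_H/E,\langle\,,\rangle)$, regarded as the subgroup of $G$ fixing $e$ (groups are identified with their $F$-points). Let $Z$ and $Z_H$ be the centers of $G$ and $H$, and let $\bar G=G/Z$, so that $H\hookrightarrow\bar G$. Fix a Haar measure $\mathrm{vol}$ on $Z_H$. Let $\mathfrak g$ be the Lie algebra of $G$, viewed as a real Lie algebra, and let $\mathfrak g^\wedge=\mathrm{Hom}_{\mathbb R}(\mathfrak g,i\mathbb R)$, on which $G$ and $\bar G$ act by the coadjoint action. An element $\tau\in\mathfrak g^\wedge$ is called stable if its $H$-stabilizer is finite and its orbit $H\tau$ is Zariski closed; $\mathfrak g^\wedge_{\mathrm{stab}}$ denotes the set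 of stable elements. For a vector space $W$ over an archimedean local field $K$, a $K$-norm on $W$ is a continuous function $|\cdot|_K:W\to\mathbb R_{\ge0}$ that vanishes only at $0$ and satisfies $|tw|_K=|t|^{[K:\mathbb R]}|w|_K$ for $t\in K$, $w\in W$. Fix an $\mathbb R$-norm $|\cdot|$ on $\mathfrak g^\wedge$, and for $\xi\in\mathfrak g^\wedge$ and $S\subseteq\mathfrak g^\wedge$ put $\mathrm{dist}_F(\xi,S)=\inf_{\eta\in S}|\xi-\eta|^{[F:\mathbb R]}$. Fix an $F$-norm $|\cdot|_F$ on $V$, and for $g\in\bar G$, lifted to $G$, put $$\tilde d_H(g)=\left|\frac{ge}{\langle ge,e\rangle}-\frac{e}{\langle e,e\rangle}\right|_F\in[0,\infty],\qquad d_H(g)=\min\bigl(1,\tilde d_H(g)+\tilde d_H(g^{-1})\bigr),$$ where $\tilde d_H(g)=\infty$ if $\langle ge,e\rangle\notin E^\times$. Then for every compact subset $\Omega\subseteq\mathfrak g^\wedge_{\mathrm{stab}}$ there exist a neighborhood $\mathcal Z$ of the identity in $Z_H$, a neighborhood $\mathcal U$ of the identity in $\bar G$, and constants $r_0>0$ and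 $C>0$ such that, for all $\tau\in\Omega$, all $g\in\mathcal U$ and all $r$ with $0<r<r_0$, $$\mathrm{vol}\{z\in\mathcal Z:\ \mathrm{dist}_F(gz\tau,H\tau)\le r\}\ \le\ C\,\frac{r}{d_H(g)},$$ where the right-hand side is read as $+\infty$ when $d_H(g)=0$. -/

import Mathlib

open MeasureTheory Topology
open scoped ENNReal

/-- `IsFNorm F N`: the function `N` is an `F`-norm on the `F`-vector space `W`, where `F` is an
archimedean local field with normalized absolute value `|t|_F = |t| ^ [F : ℝ]`: it is continuous,
nonnegative, vanishes only at `0`, and satisfies `N (t • w) = |t|_F * N w`. -/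
structure IsFNorm (F : Type*) {W : Type*} [RCLike F] [AddCommGroup W] [Module F W]
    [TopologicalSpace W] (N : W → ℝ) : Prop where
  continuous : Continuous N
  nonneg : ∀ w, 0 ≤ N w
  eq_zero : ∀ w, N w = 0 → w = 0
  smul : ∀ (t : F) (w : W), N (t • w) = ‖t‖ ^ Module.finrank ℝ F * N w

/-- A subset of a real vector space is Zariski closed if it is the common zero locus of a set of
polynomial functions, i.e. of polynomials in linear functionals. -/
def IsZariskiClosed {W : Type*} [AddCommGroup W] [Module ℝ W] (S : Set W) : Prop :=
  ∃ P : Set (MvPolynomial (Module.Dual ℝ W) ℝ),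
    S = {w | ∀ p ∈ P, MvPolynomial.eval (fun ℓ : Module.Dual ℝ W => ℓ w) p = 0}

/-- The data from which a unitary GGP pair over the archimedean local field `F` arises: the
nontrivial involution `ι` of the quadratic étale `F`-algebra `E`, a nondegenerate `ι`-hermitian form
on `V`, and a vector `e` that spans a free `E`-module of rank one on which the form is
nondegenerate. -/
structure UnitaryGGP (F E V : Type*) [RCLike F] [CommRing E] [Algebra F E]
    [AddCommGroup V] [Module E V] where
  /-- the involution of `E` over `F` -/
  ι : E ≃ₐ[F] E
  ι_ne_one : ι ≠ 1
  /-- the hermitian form, linear in the first variable -/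
  form : V →ₗ[E] V →ₛₗ[(ι : E →+* E)] E
  form_hermitian : ∀ v w, form w v = ι (form v w)
  form_nondegenerate : form.Nondegenerate
  /-- the distinguished vector -/
  e : V
  e_free : ∀ a : E, a • e = 0 → a = 0
  e_nondegenerate : ∀ a : E, (∀ b : E, form (a • e) (b • e) = 0) → a • e = 0

namespace UnitaryGGP

section

variable {F E V : Type*} [RCLike F] [CommRing E] [Algebra F E]
  [NormedAddCommGroup V] [NormedSpace F V] [NormedSpace ℝ V] [IsScalarTower ℝ F V]
  [Module E V] [IsScalarTower F E V]

/-- The unitary group `G = Aut(V/E, ⟨ ⟩)`, with the topology coming from `End_F(V)`. -/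
def G (D : UnitaryGGP F E V) : Subgroup (V →L[F] V)ˣ where
  carrier := {g | (∀ (a : E) (v : V), g.val (a • v) = a • g.val v) ∧
    ∀ v w : V, D.form (g.val v) (g.val w) = D.form v w}
  one_mem' := ⟨fun _ _ => rfl, fun _ _ => rfl⟩
  mul_mem' {g h} hg hh := by
    refine ⟨fun a v => ?_, fun v w => ?_⟩
    · simp [hg.1, hh.1]
    · simp [hg.2, hh.2]
  inv_mem' {g} hg := by
    have h1 : ∀ v, g.val (g⁻¹.val v) = v := fun v => by
      rw [← mul_apply_eq_comp, Units.mul_inv]; rfl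
    have h2 : ∀ v, g⁻¹.val (g.val v) = v := fun v => by
      rw [← mul_apply_eq_comp, Units.inv_mul]; rfl
    refine ⟨fun a v => ?_, fun v w => ?_⟩
    · conv_lhs => rw [← h1 v, ← hg.1, h2]
    · rw [← hg.2, h1, h1]

/-- The subgroup `H = Aut(V_H/E, ⟨ ⟩)` of `G`, where `V_H` is the orthogonal complement of `e`:
an automorphism of `V_H` is extended to `V = V_H ⊕ E e` by fixing `e`, and the automorphisms of `V`
so obtained are exactly those that fix `e`. -/
def H (D : UnitaryGGP F E V) : Subgroup D.G where
  carrier := {g | g.val.val D.e = D.e}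
  one_mem' := rfl
  mul_mem' {g h} hg hh := by
    change g.val.val (h.val.val D.e) = D.e
    rw [show h.val.val D.e = D.e from hh]; exact hg
  inv_mem' {g} hg := by
    change (g.val⁻¹).val D.e = D.e
    conv_lhs => rw [← show g.val.val D.e = D.e from hg]
    rw [← mul_apply_eq_comp, Units.inv_mul]; rfl

/-- The center of `H`. -/
abbrev ZH (D : UnitaryGGP F E V) : Type _ := Subgroup.center D.H

/-- The adjoint group `G / Z`, where `Z` is the center of `G`. -/
abbrev Gbar (D : UnitaryGGP F E V) : Type _ := D.G ⧸ Subgroup.center D.G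

/-- The Lie algebra of `G`, as a real Lie algebra: the `E`-linear endomorphisms of `V` that are
skew-adjoint for the hermitian form. -/
def lie (D : UnitaryGGP F E V) : Submodule ℝ (V →L[F] V) where
  carrier := {x | (∀ (a : E) (v : V), x (a • v) = a • x v) ∧
    ∀ v w : V, D.form (x v) w + D.form v (x w) = 0}
  zero_mem' := by simp
  add_mem' {x y} hx hy := by
    refine ⟨fun a v => by simp [hx.1, hy.1], fun v w => ?_⟩
    have h1 := hx.2 v w
    have h2 := hy.2 v w
    simp only [add_apply, map_add, LinearMap.add_apply]
    linear_combination h1 + h2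
  smul_mem' t x hx := by
    have key : ∀ v : V, t • v = (algebraMap F E (t : F)) • v := fun v => by
      rw [algebraMap_smul, ← RCLike.real_smul_eq_coe_smul (K := F)]
    have hι : D.ι (algebraMap F E (t : F)) = algebraMap F E (t : F) := D.ι.commutes _
    refine ⟨fun a v => ?_, fun v w => ?_⟩
    · simp only [smul_apply, hx.1, key, smul_smul, mul_comm]
    · have h := hx.2 v w
      simp only [smul_apply, key, map_smul, LinearMap.smul_apply,
        LinearMap.map_smulₛₗ, smul_eq_mul]
      have h3 : ((D.ι : E →+* E) (algebraMap F E (t : F))) = algebraMap F E (t : F) := hι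
      rw [h3]
      linear_combination (algebraMap F E (t : F)) * h

/-- The adjoint action of `G` on its Lie algebra: `Ad(g) x = g x g⁻¹`. -/
def Ad (D : UnitaryGGP F E V) (g : D.G) : D.lie →L[ℝ] D.lie where
  toFun x := ⟨g.val.val * x.val * (g⁻¹).val.val, by
    have hg := g.2
    have hg' := (g⁻¹).2
    have h1 : ∀ v, g.val.val ((g⁻¹).val.val v) = v := fun v => by
      change (g.val.val * (g.val⁻¹).val) v = v
      rw [Units.mul_inv]; rfl
    refine ⟨fun a v => ?_, fun v w => ?_⟩
    · simp only [mul_apply_eq_comp, hg.1, hg'.1, x.2.1]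
    · simp only [mul_apply_eq_comp]
      have h := x.2.2 ((g⁻¹).val.val v) ((g⁻¹).val.val w)
      rw [← hg.2, h1, ← hg.2 _ (x.val _), h1] at h
      exact h⟩
  map_add' x y := by
    apply Subtype.ext
    change _ * (x.val + y.val) * _ = _ * x.val * _ + _ * y.val * _
    rw [mul_add, add_mul]
  map_smul' t x := by
    apply Subtype.ext
    change g.val.val * (t • x.val) * _ = t • (_ * x.val * _)
    ext v
    simp only [mul_apply_eq_comp, smul_apply]
    rw [RCLike.real_smul_eq_coe_smul (K := F), RCLike.real_smul_eq_coe_smul (K := F), map_smul]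
  cont := by
    apply Continuous.subtype_mk
    fun_prop

/-- The imaginary dual `i 𝔤^* = Hom(𝔤, iℝ)` of the (real) Lie algebra of `G`. -/
abbrev dual (D : UnitaryGGP F E V) : Type _ := D.lie →L[ℝ] LinearMap.ker Complex.reLm

theorem Ad_one (D : UnitaryGGP F E V) (x : D.lie) : D.Ad 1 x = x := by
  apply Subtype.ext
  change (1 : V →L[F] V) * x.val * ((1 : D.G)⁻¹).val.val = x.val
  rw [inv_one]
  change (1 : V →L[F] V) * x.val * 1 = x.val
  simp

theorem Ad_mul (D : UnitaryGGP F E V) (g h : D.G) (x : D.lie) :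
    D.Ad (g * h) x = D.Ad g (D.Ad h x) := by
  apply Subtype.ext
  change g.val.val * h.val.val * x.val * ((g * h)⁻¹).val.val
    = g.val.val * (h.val.val * x.val * (h⁻¹).val.val) * (g⁻¹).val.val
  rw [mul_inv_rev]
  change g.val.val * h.val.val * x.val * ((h⁻¹).val.val * (g⁻¹).val.val) = _
  simp only [mul_assoc]

/-- The coadjoint action of `G`: `(g • ξ) x = ξ (Ad(g)⁻¹ x)`. -/
noncomputable instance instMulActionG (D : UnitaryGGP F E V) : MulAction D.G D.dual where
  smul g ξ := ξ.comp (D.Ad g⁻¹)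
  one_smul ξ := by
    refine ContinuousLinearMap.ext fun x => ?_
    change ξ (D.Ad (1 : D.G)⁻¹ x) = ξ x
    rw [inv_one, Ad_one]
  mul_smul g h ξ := by
    refine ContinuousLinearMap.ext fun x => ?_
    change ξ (D.Ad (g * h)⁻¹ x) = ξ (D.Ad h⁻¹ (D.Ad g⁻¹ x))
    rw [mul_inv_rev, Ad_mul]

end

section

variable {F E V : Type*} [RCLike F] [CommRing E] [Algebra F E] [AddCommGroup V] [Module E V]

theorem isUnit_form_e [FiniteDimensional F E] (D : UnitaryGGP F E V) :
    IsUnit (D.form D.e D.e) := by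
  have : IsArtinianRing E := IsArtinianRing.of_finite F E
  apply IsArtinianRing.isUnit_of_mem_nonZeroDivisors
  rw [mem_nonZeroDivisors_iff_right]
  intro a ha
  apply D.e_free
  apply D.e_nondegenerate
  intro b
  have h : D.form (a • D.e) D.e = 0 := by simpa using ha
  rw [LinearMap.map_smulₛₗ, h, smul_zero]

end

section

variable {F E V : Type*} [RCLike F] [CommRing E] [Algebra F E]
  [NormedAddCommGroup V] [NormedSpace F V] [Module E V]

theorem inv_apply_self (D : UnitaryGGP F E V) (g : D.G) (v : V) :
    (g⁻¹).val.val (g.val.val v) = v := by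
  change ((g.val⁻¹).val * g.val.val) v = v
  rw [Units.inv_mul]; rfl

theorem apply_inv_self (D : UnitaryGGP F E V) (g : D.G) (v : V) :
    g.val.val ((g⁻¹).val.val v) = v := by
  change (g.val.val * (g.val⁻¹).val) v = v
  rw [Units.mul_inv]; rfl

variable [IsScalarTower F E V]

/-- A central element of `G` has every vector `w` with `⟨w, w⟩ ∈ Eˣ` as an eigenvector, because it
commutes with the reflection in `w`. -/
theorem exists_smul_of_mem_center [FiniteDimensional F V] (D : UnitaryGGP F E V) {g : D.G}
    (hg : g ∈ Subgroup.center D.G) {w : V} (hw : IsUnit (D.form w w)) :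
    ∃ c : E, g.val.val w = c • w := by
  obtain ⟨u, hu⟩ := hw
  have hιu : D.ι (↑u⁻¹ : E) = ↑u⁻¹ := by
    have h1 : D.ι (u : E) = u := by rw [hu]; exact (D.form_hermitian w w).symm
    have h2 : D.ι (u : E) * D.ι (↑u⁻¹ : E) = 1 := by rw [← map_mul]; simp
    rw [h1] at h2
    calc D.ι (↑u⁻¹ : E) = ↑u⁻¹ * (u * D.ι (↑u⁻¹ : E)) := by rw [← mul_assoc]; simp
      _ = ↑u⁻¹ := by rw [h2, mul_one]
  let s : V →L[F] V := LinearMap.toContinuousLinearMap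
    { toFun := fun x => x - (2 * D.form x w * ↑u⁻¹) • w
      map_add' := fun x y => by
        simp only [map_add, LinearMap.add_apply, mul_add, add_mul, add_smul]; abel
      map_smul' := fun t x => by
        rw [← algebraMap_smul E t x]
        simp only [map_smul, LinearMap.smul_apply, smul_eq_mul, RingHom.id_apply]
        rw [← algebraMap_smul E t (x - _), smul_sub, smul_smul]
        ring_nf }
  have hs : ∀ x, s x = x - (2 * D.form x w * ↑u⁻¹) • w := fun x => rfl
  have hsw : s w = -w := by
    rw [hs, ← hu, mul_assoc, Units.mul_inv, mul_one, two_smul]; abel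
  have hss : s * s = 1 := by
    ext x
    change s (s x) = x
    rw [hs (s x), hs x, map_sub, LinearMap.sub_apply, map_smul, LinearMap.smul_apply, ← hu,
      smul_eq_mul, mul_assoc _ (↑u⁻¹ : E), Units.inv_mul, sub_sub, ← add_smul]
    ring_nf
    simp
  let su : (V →L[F] V)ˣ := ⟨s, s, hss, hss⟩
  have hsG : su ∈ D.G := by
    refine ⟨fun a v => ?_, fun x y => ?_⟩
    · change s (a • v) = a • s v
      rw [hs, hs, smul_sub, smul_smul, map_smul, LinearMap.smul_apply, smul_eq_mul]
      ring_nf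
    · change D.form (s x) (s y) = D.form x y
      have h3 : D.form w y = D.ι (D.form y w) := D.form_hermitian y w
      have h4 : ∀ a : E, (D.ι : E →+* E) a = D.ι a := fun _ => rfl
      rw [hs, hs]
      simp only [map_sub, LinearMap.sub_apply, map_smul, LinearMap.smul_apply,
        LinearMap.map_smulₛₗ, smul_eq_mul, h4, map_mul, hιu, ← hu, h3, map_ofNat]
      have h5 : (u : E) * ↑u⁻¹ = 1 := by simp
      linear_combination (4 * (D.form x w) * (D.ι (D.form y w)) * (↑u⁻¹ : E)) * h5
  have hcomm := Subgroup.mem_center_iff.1 hg ⟨su, hsG⟩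
  have h6 : s (g.val.val w) = g.val.val (s w) :=
    congrArg (fun k : D.G => k.val.val w) hcomm
  rw [hsw, map_neg, hs] at h6
  refine ⟨D.form (g.val.val w) w * ↑u⁻¹, ?_⟩
  have h7 : (2 : F) • g.val.val w = (2 : F) • ((D.form (g.val.val w) w * ↑u⁻¹) • w) := by
    rw [two_smul, two_smul, ← two_smul E ((_ * _) • w), smul_smul, ← mul_assoc]
    rw [sub_eq_iff_eq_add] at h6
    nth_rewrite 1 [h6]
    abel
  exact smul_right_injective V (two_ne_zero (α := F)) h7

/-- The center of `G` consists of scalars. -/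
theorem exists_scalar_of_mem_center [FiniteDimensional F E] [FiniteDimensional F V]
    (D : UnitaryGGP F E V) {g : D.G} (hg : g ∈ Subgroup.center D.G) :
    ∃ c : E, ∀ v, g.val.val v = c • v := by
  have hlin := g.2.1
  have hpres := g.2.2
  obtain ⟨u, hu⟩ := D.isUnit_form_e
  obtain ⟨c, hc⟩ := D.exists_smul_of_mem_center hg D.isUnit_form_e
  have hcunit : IsUnit (D.ι c) := by
    have h := hpres D.e D.e
    have h' : c * (D.ι c * (u : E)) = u := by
      rw [hc, LinearMap.map_smulₛₗ, map_smul, LinearMap.smul_apply, ← hu, smul_eq_mul,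
        smul_eq_mul] at h
      rw [← mul_assoc, mul_comm c, mul_assoc]
      exact h
    refine IsUnit.of_mul_eq_one c ?_
    calc D.ι c * c = c * (D.ι c * (u : E)) * ↑u⁻¹ := by
          rw [mul_assoc, mul_assoc, Units.mul_inv, mul_one, mul_comm]
      _ = 1 := by rw [h']; simp
  have hperp : ∀ v, D.form v D.e = 0 → g.val.val v = c • v := by
    intro v hv
    have hv' : D.form D.e v = 0 := by rw [D.form_hermitian v D.e, hv, map_zero]
    have hgv : D.form (g.val.val v) D.e = 0 := by
      have h := hpres v D.e
      rw [hc, LinearMap.map_smulₛₗ, hv] at h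
      exact (IsUnit.mul_right_eq_zero hcunit).1 h
    have hex : ∃ t : F, t ≠ 0 ∧ IsUnit (D.form (D.e + t • v) (D.e + t • v)) := by
      have hfin : (spectrum F (D.form v v * ↑u⁻¹)).Finite := by
        have h1 := Module.End.finite_spectrum (Algebra.lmul F E (D.form v v * ↑u⁻¹))
        refine h1.subset fun r hr hr' => hr ?_
        rw [spectrum.mem_resolventSet_iff, ← AlgHom.commutes (Algebra.lmul F E) r,
          ← map_sub] at hr'
        obtain ⟨y, hy⟩ := ((Module.End.isUnit_iff _).1 hr').2 1
        exact IsUnit.of_mul_eq_one y hy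
      have hinj : Function.Injective fun n : ℕ => -(((n : F) + 1) ^ 2)⁻¹ := by
        intro a b hab
        simp only [neg_inj, inv_inj] at hab
        have h2 : (a + 1) ^ 2 = (b + 1) ^ 2 := by exact_mod_cast hab
        have h3 := Nat.pow_left_injective (n := 2) (by norm_num) h2
        simpa using h3
      obtain ⟨n, hn⟩ := (hfin.preimage hinj.injOn).exists_notMem
      have hne : ((n : F) + 1) ≠ 0 := by exact_mod_cast Nat.succ_ne_zero n
      refine ⟨(n : F) + 1, hne, ?_⟩
      have hn' : IsUnit (algebraMap F E (-(((n : F) + 1) ^ 2)⁻¹) - D.form v v * ↑u⁻¹) := by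
        by_contra hcon
        exact hn hcon
      set t : F := (n : F) + 1
      have h4 : D.form (D.e + t • v) (D.e + t • v)
          = u * algebraMap F E (-(t ^ 2)) *
            (algebraMap F E (-(t ^ 2)⁻¹) - D.form v v * ↑u⁻¹) := by
        have h5 : (D.ι : E →+* E) (algebraMap F E t) = algebraMap F E t := D.ι.commutes t
        rw [← algebraMap_smul E t v]
        simp only [map_add, LinearMap.add_apply, map_smul, LinearMap.smul_apply,
          LinearMap.map_smulₛₗ, h5, hv, hv', ← hu, smul_eq_mul]
        have h6 : algebraMap F E (-(t ^ 2)) * algebraMap F E (-(t ^ 2)⁻¹) = 1 := by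
          rw [← map_mul, neg_mul_neg, mul_inv_cancel₀ (pow_ne_zero 2 hne), map_one]
        have h7 : (u : E) * ↑u⁻¹ = 1 := by simp
        have h8 : algebraMap F E (-(t ^ 2)) = -(algebraMap F E t) ^ 2 := by simp
        rw [h8] at h6 ⊢
        linear_combination (-(u : E)) * h6 - (algebraMap F E t) ^ 2 * (D.form v v) * h7
      rw [h4]
      refine (u.isUnit.mul ?_).mul hn'
      exact (isUnit_iff_ne_zero.2 (neg_ne_zero.2 (pow_ne_zero 2 hne))).map (algebraMap F E)
    obtain ⟨t, ht, hunit⟩ := hex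
    obtain ⟨d, hd⟩ := D.exists_smul_of_mem_center hg hunit
    rw [map_add, map_smul, hc] at hd
    have hdc : c = d := by
      have h := congrArg (fun x => D.form x D.e) hd
      rw [← algebraMap_smul E t v, ← algebraMap_smul E t (g.val.val v)] at h
      simp only [map_add, LinearMap.add_apply, map_smul, LinearMap.smul_apply, hv, hgv,
        ← hu, smul_eq_mul, mul_zero, add_zero] at h
      exact u.isUnit.mul_right_cancel h
    rw [← hdc, smul_add, add_right_inj, ← algebraMap_smul E t v, smul_smul, mul_comm, ← smul_smul,
      algebraMap_smul] at hd
    exact smul_right_injective V ht hd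
  refine ⟨c, fun v => ?_⟩
  have hdec : v = (v - (D.form v D.e * ↑u⁻¹) • D.e) + (D.form v D.e * ↑u⁻¹) • D.e := by abel
  have h0 : D.form (v - (D.form v D.e * ↑u⁻¹) • D.e) D.e = 0 := by
    simp [← hu]
  rw [hdec, map_add, hperp _ h0, hlin, hc, smul_add, smul_smul, smul_smul, mul_comm c]

theorem exists_unit_of_mem_center [FiniteDimensional F E] [FiniteDimensional F V]
    (D : UnitaryGGP F E V) {g : D.G} (hg : g ∈ Subgroup.center D.G) :
    ∃ c : Eˣ, ∀ v, g.val.val v = (c : E) • v := by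
  obtain ⟨c, hc⟩ := D.exists_scalar_of_mem_center hg
  obtain ⟨d, hd⟩ := D.exists_scalar_of_mem_center (inv_mem hg)
  have h : c * d = 1 := by
    have h1 := D.apply_inv_self g D.e
    rw [hd, hc, smul_smul] at h1
    have h2 := D.e_free (c * d - 1) (by rw [sub_smul, h1, one_smul, sub_self])
    exact sub_eq_zero.1 h2
  exact ⟨⟨c, d, h, by rw [mul_comm, h]⟩, hc⟩

open Classical in
/-- The function `d̃_H(g) = |g e / ⟨g e, e⟩ - e / ⟨e, e⟩|_F`, with value `∞` if `⟨g e, e⟩` is not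
invertible in `E`. Here `N` is the chosen `F`-norm `|.|_F` on `V`. -/
noncomputable def dTilde (D : UnitaryGGP F E V) (N : V → ℝ) (g : D.G) : ℝ≥0∞ :=
  if IsUnit (D.form (g.val.val D.e) D.e) then
    ENNReal.ofReal (N (Ring.inverse (D.form (g.val.val D.e) D.e) • g.val.val D.e
      - Ring.inverse (D.form D.e D.e) • D.e))
  else ⊤

/-- The function `min (1, d̃_H(g) + d̃_H(g⁻¹))` of `g ∈ G`. -/
noncomputable def dHLift (D : UnitaryGGP F E V) (N : V → ℝ) (g : D.G) : ℝ≥0∞ :=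
  min 1 (D.dTilde N g + D.dTilde N g⁻¹)

theorem dTilde_mul_center [FiniteDimensional F E] [FiniteDimensional F V]
    (D : UnitaryGGP F E V) (N : V → ℝ) (g : D.G) {z : D.G} (hz : z ∈ Subgroup.center D.G) :
    D.dTilde N (g * z) = D.dTilde N g := by
  obtain ⟨c, hc⟩ := D.exists_unit_of_mem_center hz
  have h : (g * z).val.val D.e = (c : E) • g.val.val D.e := by
    change g.val.val (z.val.val D.e) = _
    rw [hc, g.2.1]
  have h2 : D.form ((c : E) • g.val.val D.e) D.e = c * D.form (g.val.val D.e) D.e := by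
    rw [map_smul, LinearMap.smul_apply, smul_eq_mul]
  have h3 : Ring.inverse ((c : E) * D.form (g.val.val D.e) D.e)
      = Ring.inverse (D.form (g.val.val D.e) D.e) * (↑c⁻¹ : E) := by
    rw [Ring.mul_inverse_rev, Ring.inverse_unit]
  unfold dTilde
  have h4 : IsUnit ((c : E) * D.form (g.val.val D.e) D.e) ↔ IsUnit (D.form (g.val.val D.e) D.e) :=
    Units.isUnit_units_mul c _
  rw [h, h2, h3, smul_smul, mul_assoc, Units.inv_mul, mul_one]
  by_cases h5 : IsUnit (D.form (g.val.val D.e) D.e)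
  · rw [if_pos (h4.2 h5), if_pos h5]
  · rw [if_neg (mt h4.1 h5), if_neg h5]

/-- The function `d_H : G / Z → [0, 1]`. -/
noncomputable def dH [FiniteDimensional F E] [FiniteDimensional F V]
    (D : UnitaryGGP F E V) (N : V → ℝ) : D.Gbar → ℝ≥0∞ :=
  Quotient.lift (D.dHLift N) (by
    intro a b hab
    have hz : a⁻¹ * b ∈ Subgroup.center D.G := QuotientGroup.leftRel_apply.1 hab
    have h1 : b = a * (a⁻¹ * b) := by group
    have h2 : b⁻¹ = a⁻¹ * (a⁻¹ * b)⁻¹ := by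
      rw [← Subgroup.mem_center_iff.1 (inv_mem hz) a⁻¹ |>.symm]
      group
    unfold dHLift
    have h3 : D.dTilde N b = D.dTilde N a := by
      conv_lhs => rw [h1]
      exact D.dTilde_mul_center N a hz
    rw [h2, D.dTilde_mul_center N a⁻¹ (inv_mem hz), h3])

variable [NormedSpace ℝ V] [IsScalarTower ℝ F V]

theorem center_smul [FiniteDimensional F E] [FiniteDimensional F V]
    (D : UnitaryGGP F E V) {z : D.G} (hz : z ∈ Subgroup.center D.G) (ξ : D.dual) :
    z • ξ = ξ := by
  refine ContinuousLinearMap.ext fun x => ?_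
  change ξ (D.Ad z⁻¹ x) = ξ x
  congr 1
  apply Subtype.ext
  ext v
  change (z⁻¹).val.val (x.val ((z⁻¹)⁻¹.val.val v)) = x.val v
  obtain ⟨c, hc⟩ := D.exists_scalar_of_mem_center hz
  rw [inv_inv, hc, x.2.1, ← hc, D.inv_apply_self]

/-- The coadjoint action of `G / Z`, induced by that of `G`. -/
noncomputable instance instMulActionGbar [FiniteDimensional F E] [FiniteDimensional F V]
    (D : UnitaryGGP F E V) : MulAction D.Gbar D.dual :=
  MulAction.compHom D.dual
    (QuotientGroup.lift (Subgroup.center D.G) (MulAction.toPermHom D.G D.dual)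
      (fun _ hz => Equiv.ext fun ξ => D.center_smul hz ξ))

theorem mk_smul [FiniteDimensional F E] [FiniteDimensional F V]
    (D : UnitaryGGP F E V) (g : D.G) (ξ : D.dual) : (g : D.Gbar) • ξ = g • ξ := rfl

/-- The stable elements of the imaginary dual: those with finite `H`-stabilizer and Zariski closed
`H`-orbit. -/
def stable (D : UnitaryGGP F E V) : Set D.dual :=
  {τ | (MulAction.stabilizer D.H τ : Set D.H).Finite ∧ IsZariskiClosed (MulAction.orbit D.H τ)}

/-- The distance `dist_F(ξ, S) = inf_{η ∈ S} |ξ - η| ^ [F : ℝ]`, where `M` is the chosen norm `|.|`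
on the imaginary dual. -/
noncomputable def distF (D : UnitaryGGP F E V) (M : D.dual → ℝ) (ξ : D.dual) (S : Set D.dual) : ℝ :=
  ⨅ η : S, M (ξ - η) ^ Module.finrank ℝ F

/-- The inclusion of the center of `H` in `G / Z`. -/
def zHToGbar (D : UnitaryGGP F E V) (z : D.ZH) : D.Gbar := ((z : D.H) : D.G)

end

end UnitaryGGP

/-!
The bound compares moments. For `τ` in the imaginary dual, let `T` be the corresponding
skew-adjoint operator on `V` (`UnitaryGGP.traceEquiv`, from the trace form). The numbers
`⟨T ^ k e, e⟩` are constant on the `H`-orbit of `T`, because `H` fixes `e`, and they are Lipschitz on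
bounded sets. Hence, if `g z T` is at distance at most `ρ` from the orbit of `T`, then
`⟨T ^ k y, y⟩ - ⟨T ^ k e, e⟩ = O (ρ)` for `y = (g z)⁻¹ e`.

Write `g⁻¹ e = w₀ + c e` with `w₀ ∈ V_H`, and let `z` act on `V_H` by the norm one scalar `t`. The
difference above equals `σ + t a + (-1) ^ k ι (t a)`, with `a = ⟨T ^ k e, ι(c) w₀⟩` and with `σ`
independent of `t` and quadratic in `w₀` (`UnitaryGGP.moment_expansion`,
`UnitaryGGP.exists_const_le`). Two facts make this useful.

* If `τ` is stable, then no nonzero vector is orthogonal to all the `T ^ k e`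
  (`UnitaryGGP.cyclic_of_stable`). Otherwise `T` preserves a nonzero `E`-submodule `W` of `V_H`. If
  the form is nondegenerate on `W`, then the norm one scalars on `W` lie in the stabilizer of `τ`. If
  not, the radical of `W` is isotropic and defines a one parameter subgroup of `H` under which `T`
  degenerates to an element with infinite stabilizer; as the orbit is closed, this limit is conjugate
  to `T`. By compactness, for `τ ∈ Ω` some `a` with `k` bounded is of size at least a constant
  times `‖w₀‖` (`UnitaryGGP.exists_moment_bound`).
* In a Cayley parametrization `t = (1 + s δ) / (1 - s δ)` near `s = 0`, the real part (`k` even) or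
  the `δ`-part (`k` odd) of `t a + (-1) ^ k ι (t a)` either varies at least linearly in `s`, with slope
  comparable to `a`, or is bounded below by a multiple of `a` (`two_point_estimate`).

For `w₀` small, `σ` is negligible, so the parameters of two elements of the set in question are at
distance `O (ρ / ‖w₀‖)` (`UnitaryGGP.exists_center_dist_le`). A packing argument gives the measure
`O (R ^ [F : ℝ])` of a ball of radius `R` in `Z_H` (`UnitaryGGP.measure_cayBall_le`), and
`d_H (g) = O (‖w₀‖ ^ [F : ℝ])` (`UnitaryGGP.exists_dH_le`). With `ρ ^ [F : ℝ] = r` this is the claim.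
-/

set_option linter.unusedSectionVars false

/-! ### Coordinates on the quadratic algebra -/

/-- Coordinates on a quadratic `F`-algebra `E` adapted to an involution `ι`: a generator `δ` with
`ι δ = -δ` and `δ ^ 2 = disc ∈ Fˣ`, and the coordinates `re` and `im` of an element with respect to
the basis `1, δ`. -/
structure ConjCoords {F E : Type*} [Field F] [CommRing E] [Algebra F E] (ι : E ≃ₐ[F] E) where
  /-- the anti-invariant generator -/
  δ : E
  /-- the square of `δ` -/
  disc : F
  /-- the coordinate along `1` -/
  re : E →ₗ[F] F
  /-- the coordinate along `δ` -/
  im : E →ₗ[F] F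
  disc_ne_zero : disc ≠ 0
  conj_δ : ι δ = -δ
  δ_mul_δ : δ * δ = algebraMap F E disc
  re_add_im : ∀ a, algebraMap F E (re a) + algebraMap F E (im a) * δ = a
  re_mk : ∀ x y, re (algebraMap F E x + algebraMap F E y * δ) = x
  im_mk : ∀ x y, im (algebraMap F E x + algebraMap F E y * δ) = y

namespace ConjCoords

variable {F E : Type*} [Field F] [CommRing E] [Algebra F E] {ι : E ≃ₐ[F] E} (κ : ConjCoords ι)

theorem ext {a b : E} (hre : κ.re a = κ.re b) (him : κ.im a = κ.im b) : a = b := by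
  rw [← κ.re_add_im a, ← κ.re_add_im b, hre, him]

@[simp] theorem re_algebraMap (x : F) : κ.re (algebraMap F E x) = x := by
  simpa using κ.re_mk x 0

@[simp] theorem im_algebraMap (x : F) : κ.im (algebraMap F E x) = 0 := by
  simpa using κ.im_mk x 0

@[simp] theorem re_one : κ.re 1 = 1 := by simpa using κ.re_algebraMap 1

@[simp] theorem im_one : κ.im 1 = 0 := by simpa using κ.im_algebraMap 1

@[simp] theorem re_δ : κ.re κ.δ = 0 := by simpa using κ.re_mk 0 1

@[simp] theorem im_δ : κ.im κ.δ = 1 := by simpa using κ.im_mk 0 1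

theorem mul_eq (a b : E) : a * b =
    algebraMap F E (κ.re a * κ.re b + κ.disc * (κ.im a * κ.im b))
      + algebraMap F E (κ.re a * κ.im b + κ.im a * κ.re b) * κ.δ := by
  conv_lhs => rw [← κ.re_add_im a, ← κ.re_add_im b]
  simp only [map_add, map_mul]
  linear_combination (algebraMap F E (κ.im a) * algebraMap F E (κ.im b)) * κ.δ_mul_δ

theorem re_mul (a b : E) : κ.re (a * b) = κ.re a * κ.re b + κ.disc * (κ.im a * κ.im b) := by
  rw [κ.mul_eq a b, κ.re_mk]

theorem im_mul (a b : E) : κ.im (a * b) = κ.re a * κ.im b + κ.im a * κ.re b := by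
  rw [κ.mul_eq a b, κ.im_mk]

theorem conj_eq (a : E) :
    ι a = algebraMap F E (κ.re a) + algebraMap F E (-κ.im a) * κ.δ := by
  conv_lhs => rw [← κ.re_add_im a]
  simp [κ.conj_δ]

@[simp] theorem re_conj (a : E) : κ.re (ι a) = κ.re a := by rw [κ.conj_eq, κ.re_mk]

@[simp] theorem im_conj (a : E) : κ.im (ι a) = -κ.im a := by rw [κ.conj_eq, κ.im_mk]

include κ in
theorem nontrivial : Nontrivial E := ⟨1, 0, fun h => by simpa using congrArg κ.re h⟩

include κ in
theorem conj_conj (a : E) : ι (ι a) = a := κ.ext (by simp) (by simp)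

theorem smul_eq {V : Type*} [AddCommGroup V] [Module F V] [Module E V] [IsScalarTower F E V]
    (a : E) (v : V) : a • v = κ.re a • v + κ.im a • (κ.δ • v) := by
  conv_lhs => rw [← κ.re_add_im a]
  rw [add_smul, mul_smul, algebraMap_smul, algebraMap_smul]

theorem isUnit_δ : IsUnit κ.δ := by
  refine IsUnit.of_mul_eq_one (algebraMap F E κ.disc⁻¹ * κ.δ) ?_
  rw [mul_left_comm, κ.δ_mul_δ, ← map_mul, inv_mul_cancel₀ κ.disc_ne_zero, map_one]

/-! ### The Cayley parametrization of the norm one elements -/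

/-- The norm one element `(1 + s δ) / (1 - s δ)`. It is meaningful when `disc * s ^ 2 ≠ 1`. -/
def cayley (s : F) : E :=
  algebraMap F E ((1 + κ.disc * s ^ 2) / (1 - κ.disc * s ^ 2))
    + algebraMap F E (2 * s / (1 - κ.disc * s ^ 2)) * κ.δ

theorem re_cayley (s : F) :
    κ.re (κ.cayley s) = (1 + κ.disc * s ^ 2) / (1 - κ.disc * s ^ 2) := κ.re_mk _ _

theorem im_cayley (s : F) : κ.im (κ.cayley s) = 2 * s / (1 - κ.disc * s ^ 2) := κ.im_mk _ _

theorem conj_cayley (s : F) : ι (κ.cayley s) = κ.cayley (-s) := by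
  apply κ.ext
  · simp [re_cayley]
  · simp [im_cayley, neg_div]

theorem cayley_mul_cayley_neg {s : F} (hs : 1 - κ.disc * s ^ 2 ≠ 0) :
    κ.cayley s * κ.cayley (-s) = 1 := by
  apply κ.ext
  · simp only [re_mul, re_cayley, im_cayley, re_one, neg_sq]
    field_simp
    ring
  · simp only [im_mul, re_cayley, im_cayley, im_one, neg_sq]
    field_simp
    ring

theorem cayley_mul_conj {s : F} (hs : 1 - κ.disc * s ^ 2 ≠ 0) :
    κ.cayley s * ι (κ.cayley s) = 1 := by
  rw [κ.conj_cayley, κ.cayley_mul_cayley_neg hs]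

/-- The addition formula of the hyperbolic tangent. -/
theorem cayley_mul_cayley_neg_eq {s s' : F} (hs : 1 - κ.disc * s ^ 2 ≠ 0)
    (hs' : 1 - κ.disc * s' ^ 2 ≠ 0) (hss : 1 - κ.disc * (s * s') ≠ 0) :
    κ.cayley s * κ.cayley (-s') = κ.cayley ((s - s') / (1 - κ.disc * (s * s'))) := by
  obtain ⟨w, hw⟩ : ∃ w, w = 1 - κ.disc * (s * s') := ⟨_, rfl⟩
  rw [← hw] at hss ⊢
  have h : 1 - κ.disc * ((s - s') / w) ^ 2
      = (1 - κ.disc * s ^ 2) * (1 - κ.disc * s' ^ 2) / w ^ 2 := by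
    field_simp
    rw [hw]
    ring
  apply κ.ext
  · simp only [re_mul, re_cayley, im_cayley, neg_sq, h]
    field_simp
    rw [hw]
    ring
  · simp only [im_mul, re_cayley, im_cayley, neg_sq, h]
    field_simp
    rw [hw]
    ring

/-- Every norm one element `t` with `1 + re t ≠ 0` is a value of the Cayley parametrization. -/
theorem eq_cayley [NeZero (2 : F)] {t : E} (ht : t * ι t = 1) (hre : 1 + κ.re t ≠ 0) :
    t = κ.cayley (κ.im t / (1 + κ.re t)) ∧
      1 - κ.disc * (κ.im t / (1 + κ.re t)) ^ 2 = 2 / (1 + κ.re t) := by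
  have hn : κ.re t ^ 2 - κ.disc * κ.im t ^ 2 = 1 := by
    have := congrArg κ.re ht
    simp only [re_mul, re_conj, im_conj, re_one] at this
    linear_combination this
  have h2 : (2 : F) ≠ 0 := NeZero.ne _
  have h1 : 1 - κ.disc * (κ.im t / (1 + κ.re t)) ^ 2 = 2 / (1 + κ.re t) := by
    field_simp
    linear_combination hn
  refine ⟨κ.ext ?_ ?_, h1⟩
  · rw [re_cayley, h1]
    field_simp
    linear_combination (1 : F) * hn
  · rw [im_cayley, h1]
    field_simp

theorem cayley_smul_injective {V : Type*} [NeZero (2 : F)] [AddCommGroup V] [Module F V]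
    [Module E V] [IsScalarTower F E V] {v : V} (hv : v ≠ 0) {s s' : F}
    (hs : 1 - κ.disc * s ^ 2 ≠ 0) (hs' : 1 - κ.disc * s' ^ 2 ≠ 0)
    (h : κ.cayley s • v = κ.cayley s' • v) : s = s' := by
  -- multiplying out the denominators leaves `2 (s - s') δ v = 0`
  have key : ∀ {r : F}, 1 - κ.disc * r ^ 2 ≠ 0 →
      κ.cayley r * (1 - algebraMap F E r * κ.δ) = 1 + algebraMap F E r * κ.δ := by
    intro r hr
    apply κ.ext
    · simp only [re_mul, re_cayley, im_cayley, map_sub, map_add, re_one, im_one,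
        re_algebraMap, im_algebraMap, im_mul, re_δ, im_δ]
      field_simp
      ring
    · simp only [re_mul, re_cayley, im_cayley, map_sub, map_add, re_one, im_one,
        re_algebraMap, im_algebraMap, im_mul, re_δ, im_δ]
      field_simp
      ring
  have h1 : ((1 + algebraMap F E s * κ.δ) * (1 - algebraMap F E s' * κ.δ)
      - (1 + algebraMap F E s' * κ.δ) * (1 - algebraMap F E s * κ.δ)) • v = 0 := by
    have e1 : ((1 + algebraMap F E s * κ.δ) * (1 - algebraMap F E s' * κ.δ)
        - (1 + algebraMap F E s' * κ.δ) * (1 - algebraMap F E s * κ.δ))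
        = ((1 - algebraMap F E s * κ.δ) * (1 - algebraMap F E s' * κ.δ))
          * (κ.cayley s - κ.cayley s') := by
      rw [← key hs, ← key hs']
      ring
    rw [e1, mul_smul, sub_smul, h, sub_self, smul_zero]
  have h2 : ((1 + algebraMap F E s * κ.δ) * (1 - algebraMap F E s' * κ.δ)
      - (1 + algebraMap F E s' * κ.δ) * (1 - algebraMap F E s * κ.δ))
      = κ.δ * algebraMap F E (2 * (s - s')) := by
    simp only [map_mul, map_sub, map_ofNat]
    ring
  rw [h2, mul_smul, κ.isUnit_δ.smul_eq_zero, algebraMap_smul] at h1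
  by_contra hne
  exact (smul_ne_zero (mul_ne_zero (NeZero.ne _) (sub_ne_zero.2 hne)) hv) h1

end ConjCoords

namespace UnitaryGGP

section

variable {F E V : Type*} [RCLike F] [CommRing E] [Algebra F E] [AddCommGroup V] [Module E V]

theorem conj_conj [FiniteDimensional F E] (D : UnitaryGGP F E V) (a : E) : D.ι (D.ι a) = a := by
  have h1 : ∀ x : E, D.form (x • D.e) D.e = x * D.form D.e D.e := fun x => by simp
  have h2 := D.form_hermitian (a • D.e) D.e
  have h3 := D.form_hermitian D.e (a • D.e)
  have h4 := D.form_hermitian D.e D.e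
  rw [h1] at h2 h3
  rw [h2, map_mul, map_mul, ← h4, ← h4] at h3
  exact (D.isUnit_form_e.mul_right_cancel h3).symm

theorem exists_conjCoords [Algebra.IsQuadraticExtension F E] [Algebra.Etale F E]
    (D : UnitaryGGP F E V) : Nonempty (ConjCoords D.ι) := by
  have : IsReduced E := Algebra.FormallyUnramified.isReduced_of_field F E
  obtain ⟨a, ha⟩ : ∃ a, D.ι a ≠ a := by
    by_contra! h
    exact D.ι_ne_one (AlgEquiv.ext h)
  have : Nontrivial E := ⟨⟨_, _, ha⟩⟩
  set δ := a - D.ι a with hδ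
  have hδ0 : δ ≠ 0 := sub_ne_zero.2 ha.symm
  have hιδ : D.ι δ = -δ := by rw [hδ, map_sub, D.conj_conj, neg_sub]
  have hcan : ∀ x y : F, algebraMap F E x + algebraMap F E y * δ = 0 → x = 0 ∧ y = 0 := by
    intro x y h
    have h' := congrArg D.ι h
    simp only [map_add, map_mul, AlgEquiv.commutes, hιδ, map_zero] at h'
    have hx : algebraMap F E (2 * x) = 0 := by
      rw [map_mul, map_ofNat]; linear_combination h + h'
    have hx0 : x = 0 := by
      have := (FaithfulSMul.algebraMap_injective F E) (hx.trans (map_zero _).symm)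
      simpa using this
    refine ⟨hx0, ?_⟩
    rw [hx0, map_zero, zero_add, ← Algebra.smul_def] at h
    exact (smul_eq_zero.1 h).resolve_right hδ0
  have hli : LinearIndependent F ![(1 : E), δ] := by
    rw [LinearIndependent.pair_iff]
    intro x y h
    apply hcan
    rw [← h, Algebra.smul_def, Algebra.smul_def, mul_one]
  have hrank : Module.finrank F E = 2 := Algebra.IsQuadraticExtension.finrank_eq_two F E
  let b : Module.Basis (Fin 2) F E := basisOfLinearIndependentOfCardEqFinrank hli (by simp [hrank])
  have hb0 : b 0 = 1 := by simp [b]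
  have hb1 : b 1 = δ := by simp [b]
  have hsum : ∀ a, algebraMap F E (b.coord 0 a) + algebraMap F E (b.coord 1 a) * δ = a := by
    intro a
    have := b.sum_repr a
    rw [Fin.sum_univ_two, hb0, hb1, Algebra.smul_def, Algebra.smul_def, mul_one] at this
    exact this
  have hmk : ∀ x y, b.coord 0 (algebraMap F E x + algebraMap F E y * δ) = x ∧
      b.coord 1 (algebraMap F E x + algebraMap F E y * δ) = y := by
    intro x y
    have h := hsum (algebraMap F E x + algebraMap F E y * δ)
    have h2 := hcan (b.coord 0 (algebraMap F E x + algebraMap F E y * δ) - x)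
      (b.coord 1 (algebraMap F E x + algebraMap F E y * δ) - y)
      (by rw [map_sub, map_sub]; linear_combination h)
    exact ⟨sub_eq_zero.1 h2.1, sub_eq_zero.1 h2.2⟩
  have hsq : δ * δ = algebraMap F E (b.coord 0 (δ * δ)) := by
    have h := hsum (δ * δ)
    have h' := congrArg D.ι h
    simp only [map_add, map_mul, AlgEquiv.commutes, hιδ] at h'
    have h1 := hcan 0 (2 * b.coord 1 (δ * δ)) (by
      rw [map_zero, map_mul, map_ofNat]; linear_combination h - h')
    have h2 : b.coord 1 (δ * δ) = 0 := by simpa using h1.2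
    rw [h2, map_zero, zero_mul, add_zero] at h
    exact h.symm
  refine ⟨⟨δ, b.coord 0 (δ * δ), b.coord 0, b.coord 1, ?_, hιδ, hsq, hsum,
    fun x y => (hmk x y).1, fun x y => (hmk x y).2⟩⟩
  intro h
  rw [h, map_zero] at hsq
  exact hδ0 (IsReduced.eq_zero δ ⟨2, by rw [sq, hsq]⟩)

end

end UnitaryGGP

namespace UnitaryGGP

/-! ### Linear algebra of the hermitian form -/

section

variable {F E V : Type*} [RCLike F] [CommRing E] [Algebra F E] [AddCommGroup V] [Module F V]
  [Module E V] [IsScalarTower F E V]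

theorem form_conj (D : UnitaryGGP F E V) (v w : V) : D.ι (D.form v w) = D.form w v :=
  (D.form_hermitian v w).symm

theorem form_smul_right (D : UnitaryGGP F E V) (a : E) (v w : V) :
    D.form v (a • w) = D.ι a * D.form v w :=
  LinearMap.map_smulₛₗ _ _ _

theorem form_smul_left (D : UnitaryGGP F E V) (a : E) (v w : V) :
    D.form (a • v) w = a * D.form v w := by simp

theorem form_smul_left' (D : UnitaryGGP F E V) (a : F) (v w : V) :
    D.form (a • v) w = algebraMap F E a * D.form v w := by
  rw [← algebraMap_smul E, form_smul_left]

theorem form_smul_right' (D : UnitaryGGP F E V) (a : F) (v w : V) :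
    D.form v (a • w) = algebraMap F E a * D.form v w := by
  rw [← algebraMap_smul E, form_smul_right, AlgEquiv.commutes]

theorem eq_zero_of_form_right (D : UnitaryGGP F E V) {v : V} (h : ∀ w, D.form v w = 0) : v = 0 :=
  D.form_nondegenerate.1 v h

theorem eq_of_form_right (D : UnitaryGGP F E V) {v v' : V}
    (h : ∀ w, D.form v w = D.form v' w) : v = v' :=
  sub_eq_zero.1 (D.eq_zero_of_form_right fun w => by
    rw [map_sub, LinearMap.sub_apply, h, sub_self])

/-- The symmetric `F`-bilinear form `re ⟨v, w⟩`. -/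
def reForm (D : UnitaryGGP F E V) (κ : ConjCoords D.ι) : LinearMap.BilinForm F V :=
  LinearMap.mk₂ F (fun v w => κ.re (D.form v w)) (fun v v' w => by simp)
    (fun a v w => by rw [form_smul_left', ← Algebra.smul_def, map_smul])
    (fun v w w' => by simp)
    (fun a v w => by rw [form_smul_right', ← Algebra.smul_def, map_smul])

/-- The alternating `F`-bilinear form `im ⟨v, w⟩`. -/
def imForm (D : UnitaryGGP F E V) (κ : ConjCoords D.ι) : LinearMap.BilinForm F V :=
  LinearMap.mk₂ F (fun v w => κ.im (D.form v w)) (fun v v' w => by simp)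
    (fun a v w => by rw [form_smul_left', ← Algebra.smul_def, map_smul])
    (fun v w w' => by simp)
    (fun a v w => by rw [form_smul_right', ← Algebra.smul_def, map_smul])

variable (D : UnitaryGGP F E V) (κ : ConjCoords D.ι)

@[simp] theorem reForm_apply (v w : V) : D.reForm κ v w = κ.re (D.form v w) := rfl

theorem reForm_comm (v w : V) : κ.re (D.form v w) = κ.re (D.form w v) := by
  rw [← D.form_conj w v, κ.re_conj]

theorem re_form_smul_δ (v w : V) :
    κ.re (D.form v (κ.δ • w)) = -(κ.disc * κ.im (D.form v w)) := by
  rw [form_smul_right, κ.conj_δ, neg_mul, map_neg, κ.re_mul]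
  simp

/-- An element of `E` of the form `⟨v, w⟩` is detected by the real parts of the `⟨v, a w⟩`. -/
theorem form_eq_of_re {v v' w w' : V} (h : κ.re (D.form v w) = κ.re (D.form v' w'))
    (hδ : κ.re (D.form v (κ.δ • w)) = κ.re (D.form v' (κ.δ • w'))) :
    D.form v w = D.form v' w' := by
  refine κ.ext h ?_
  rw [re_form_smul_δ, re_form_smul_δ, neg_inj] at hδ
  exact mul_left_cancel₀ κ.disc_ne_zero hδ

theorem eq_zero_of_re_form {v : V} (h : ∀ w, κ.re (D.form v w) = 0) : v = 0 := by
  refine D.eq_zero_of_form_right fun w => ?_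
  have := D.form_eq_of_re κ (v := v) (w := w) (v' := 0) (w' := 0) (by simp [h])
    (by rw [h, smul_zero]; simp)
  simpa using this

theorem reForm_nondegenerate : (D.reForm κ).Nondegenerate := by
  refine ⟨fun v h => D.eq_zero_of_re_form κ h, fun v h => D.eq_zero_of_re_form κ fun w => ?_⟩
  rw [reForm_comm]
  exact h w

theorem form_self (v : V) : D.form v v = algebraMap F E (κ.re (D.form v v)) := by
  refine κ.ext (by simp) ?_
  have h := congrArg κ.im (D.form_conj v v)
  rw [κ.im_conj] at h
  rw [κ.im_algebraMap]
  exact self_eq_neg.1 h.symm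

include κ in
theorem isUnit_form_self_iff [Nontrivial E] (v : V) :
    IsUnit (D.form v v) ↔ D.form v v ≠ 0 := by
  refine ⟨fun h => h.ne_zero, fun h => ?_⟩
  rw [D.form_self κ] at h ⊢
  exact (isUnit_iff_ne_zero.2 fun h0 => h (by rw [h0, map_zero])).map (algebraMap F E)

include κ in
/-- Adjoints of `E`-linear endomorphisms exist. -/
theorem exists_adjoint [FiniteDimensional F V] (A : V →ₗ[E] V) :
    ∃ A' : V →ₗ[E] V, ∀ v w, D.form (A v) w = D.form v (A' w) := by
  let A₀ := (D.reForm κ).leftAdjointOfNondegenerate (D.reForm_nondegenerate κ)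
    (A.restrictScalars F)
  have hre : ∀ x y, κ.re (D.form (A₀ x) y) = κ.re (D.form x (A y)) :=
    LinearMap.BilinForm.isAdjointPairLeftAdjointOfNondegenerate (D.reForm κ)
      (D.reForm_nondegenerate κ) (A.restrictScalars F)
  have hform : ∀ x y, D.form (A₀ x) y = D.form x (A y) := fun x y =>
    D.form_eq_of_re κ (hre x y) (by rw [hre, map_smul])
  refine ⟨{ toFun := A₀, map_add' := map_add A₀, map_smul' := fun a x => ?_ }, fun v w => ?_⟩
  · refine D.eq_of_form_right fun y => ?_
    rw [hform, form_smul_left, RingHom.id_apply, form_smul_left, hform]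
  · rw [← D.form_conj, ← hform, D.form_conj]
    rfl

/-- The orthogonal projection to the line spanned by `w`, when `⟨w, w⟩` is invertible. -/
noncomputable def lineProj (w : V) : V →ₗ[E] V where
  toFun v := (D.form v w * Ring.inverse (D.form w w)) • w
  map_add' v v' := by rw [map_add, LinearMap.add_apply, add_mul, add_smul]
  map_smul' a v := by rw [form_smul_left, mul_assoc, mul_smul, RingHom.id_apply]

theorem lineProj_apply (w v : V) :
    D.lineProj w v = (D.form v w * Ring.inverse (D.form w w)) • w := rfl

theorem lineProj_self {w : V} (hw : IsUnit (D.form w w)) : D.lineProj w w = w := by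
  rw [lineProj_apply, Ring.mul_inverse_cancel _ hw, one_smul]

theorem lineProj_of_form_eq_zero {w v : V} (h : D.form v w = 0) : D.lineProj w v = 0 := by
  rw [lineProj_apply, h, zero_mul, zero_smul]

theorem lineProj_lineProj {w : V} (hw : IsUnit (D.form w w)) (v : V) :
    D.lineProj w (D.lineProj w v) = D.lineProj w v := by
  conv_lhs => rw [lineProj_apply D w v]
  rw [map_smul, lineProj_self D hw, lineProj_apply]

theorem form_lineProj {w : V} (hw : IsUnit (D.form w w)) (v v' : V) :
    D.form (D.lineProj w v) v' = D.form v (D.lineProj w v') := by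
  obtain ⟨u, hu⟩ := hw
  have h1 : D.ι (↑u⁻¹ : E) = ↑u⁻¹ := by
    have h1 : D.ι (u : E) = u := by rw [hu]; exact D.form_conj w w
    have h2 : D.ι (u : E) * D.ι (↑u⁻¹ : E) = 1 := by rw [← map_mul]; simp
    rw [h1] at h2
    exact Units.eq_inv_of_mul_eq_one_right (by rw [mul_comm, h2])
  rw [lineProj_apply, lineProj_apply, form_smul_left, form_smul_right, ← hu, Ring.inverse_unit,
    map_mul, D.form_conj, h1]
  ring

/-- The `E`-linear map that multiplies by `t` on the image of the idempotent `q` and is the identity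
on its kernel. -/
def scaleOn (q : V →ₗ[E] V) (t : E) : V →ₗ[E] V := LinearMap.id + (t - 1) • q

theorem scaleOn_apply (q : V →ₗ[E] V) (t : E) (v : V) :
    scaleOn q t v = v + (t - 1) • q v := rfl

theorem scaleOn_of_eq {q : V →ₗ[E] V} {t : E} {v : V} (h : q v = v) :
    scaleOn q t v = t • v := by
  rw [scaleOn_apply, h, sub_smul, one_smul, add_sub_cancel]

theorem scaleOn_of_eq_zero {q : V →ₗ[E] V} {t : E} {v : V} (h : q v = 0) :
    scaleOn q t v = v := by
  rw [scaleOn_apply, h, smul_zero, add_zero]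

theorem scaleOn_scaleOn {q : V →ₗ[E] V} (hq : ∀ v, q (q v) = q v) (t t' : E) (v : V) :
    scaleOn q t (scaleOn q t' v) = scaleOn q (t * t') v := by
  simp only [scaleOn_apply, map_add, map_smul, hq]
  module

theorem form_scaleOn {q : V →ₗ[E] V} (hq : ∀ v, q (q v) = q v)
    (hsa : ∀ v w, D.form (q v) w = D.form v (q w)) {t : E} (ht : t * D.ι t = 1) (v w : V) :
    D.form (scaleOn q t v) (scaleOn q t w) = D.form v w := by
  have h : D.form (q v) (q w) = D.form (q v) w := by rw [← hsa, hq]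
  simp only [scaleOn_apply, map_add, LinearMap.add_apply, form_smul_left, form_smul_right, h,
    ← hsa v w, map_sub, map_one]
  linear_combination D.form (q v) w * ht

/-- The orthogonal projection to `V_H`. -/
noncomputable def perpProj : V →ₗ[E] V := LinearMap.id - D.lineProj D.e

theorem perpProj_apply (v : V) : D.perpProj v = v - D.lineProj D.e v := rfl

theorem perpProj_of_form_eq_zero {v : V} (h : D.form v D.e = 0) : D.perpProj v = v := by
  rw [perpProj_apply, D.lineProj_of_form_eq_zero h, sub_zero]

section

variable [FiniteDimensional F E]

theorem perpProj_e : D.perpProj D.e = 0 := by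
  rw [perpProj_apply, D.lineProj_self D.isUnit_form_e, sub_self]

theorem form_perpProj_e (v : V) : D.form (D.perpProj v) D.e = 0 := by
  rw [perpProj_apply, map_sub, LinearMap.sub_apply, D.form_lineProj D.isUnit_form_e,
    D.lineProj_self D.isUnit_form_e, sub_self]

theorem perpProj_perpProj (v : V) : D.perpProj (D.perpProj v) = D.perpProj v :=
  D.perpProj_of_form_eq_zero (D.form_perpProj_e v)

theorem form_perpProj (v w : V) : D.form (D.perpProj v) w = D.form v (D.perpProj w) := by
  simp only [perpProj_apply, map_sub, LinearMap.sub_apply, D.form_lineProj D.isUnit_form_e]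

include κ in
/-- If `V_H` contains no vector `v` with `⟨v, v⟩ ∈ Eˣ`, then it is zero: polarize. -/
theorem perpProj_eq_zero (h : ∀ v, D.form v D.e = 0 → ¬ IsUnit (D.form v v)) (v : V) :
    D.perpProj v = 0 := by
  have := κ.nontrivial
  have h0 : ∀ v, D.form v D.e = 0 → D.form v v = 0 := fun v hv => by
    by_contra hne
    exact h v hv ((D.isUnit_form_self_iff κ v).2 hne)
  have hre : ∀ v w, D.form v D.e = 0 → D.form w D.e = 0 → κ.re (D.form v w) = 0 := by
    intro v w hv hw
    have h1 := congrArg κ.re (h0 (v + w) (by rw [map_add, LinearMap.add_apply, hv, hw, add_zero]))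
    simp only [map_add, LinearMap.add_apply, h0 v hv, h0 w hw, D.reForm_comm κ w v, zero_add,
      add_zero, map_zero] at h1
    exact add_self_eq_zero.1 h1
  refine D.eq_zero_of_re_form κ fun w => ?_
  rw [← D.perpProj_perpProj, D.form_perpProj]
  exact hre _ _ (D.form_perpProj_e v) (D.form_perpProj_e w)

end

end

/-! ### Elements of the unitary group -/

section

variable {F E V : Type*} [RCLike F] [CommRing E] [Algebra F E]
  [NormedAddCommGroup V] [NormedSpace F V] [FiniteDimensional F V] [Module E V]
  [IsScalarTower F E V]

/-- An `E`-linear endomorphism as a continuous `F`-linear one. -/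
noncomputable def toCLM (A : V →ₗ[E] V) : V →L[F] V :=
  LinearMap.toContinuousLinearMap (A.restrictScalars F)

@[simp] theorem toCLM_apply (A : V →ₗ[E] V) (v : V) : (toCLM A : V →L[F] V) v = A v := rfl

variable (D : UnitaryGGP F E V)

/-- The element of `G` given by an isometry `A` with inverse `B`. -/
noncomputable def mkG (A B : V →ₗ[E] V) (hAB : ∀ v, A (B v) = v) (hBA : ∀ v, B (A v) = v)
    (hA : ∀ v w, D.form (A v) (A w) = D.form v w) : D.G :=
  ⟨⟨toCLM A, toCLM B, ContinuousLinearMap.ext hAB, ContinuousLinearMap.ext hBA⟩,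
    fun a v => map_smul A a v, hA⟩

/-- The isometry `1 + (t - 1) q`, for a self-adjoint idempotent `q` and `t` of norm one. -/
noncomputable def scaleG (q : V →ₗ[E] V) (hq : ∀ v, q (q v) = q v)
    (hsa : ∀ v w, D.form (q v) w = D.form v (q w)) (t : E) (ht : t * D.ι t = 1) : D.G :=
  D.mkG (scaleOn q t) (scaleOn q (D.ι t))
    (fun v => by rw [scaleOn_scaleOn hq, ht, scaleOn_apply, sub_self, zero_smul, add_zero])
    (fun v => by rw [scaleOn_scaleOn hq, mul_comm, ht, scaleOn_apply, sub_self, zero_smul,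
      add_zero])
    (D.form_scaleOn hq hsa ht)

theorem scaleG_apply (q : V →ₗ[E] V) (hq : ∀ v, q (q v) = q v)
    (hsa : ∀ v w, D.form (q v) w = D.form v (q w)) (t : E) (ht : t * D.ι t = 1) (v : V) :
    (D.scaleG q hq hsa t ht).val.val v = scaleOn q t v := rfl

theorem G_ext {g g' : D.G} (h : ∀ v, g.val.val v = g'.val.val v) : g = g' :=
  Subtype.ext (Units.ext (ContinuousLinearMap.ext h))

/-! ### The center of `H` -/

theorem lineProj_comm_of_reflection {g : V →L[F] V} (hlin : ∀ (a : E) v, g (a • v) = a • g v)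
    {w : V} (h : ∀ v, scaleOn (D.lineProj w) (-1) (g v) = g (scaleOn (D.lineProj w) (-1) v))
    (v : V) : D.lineProj w (g v) = g (D.lineProj w v) := by
  have h1 := h v
  rw [scaleOn_apply, scaleOn_apply, map_add, add_right_inj, hlin] at h1
  have h2 : (-1 - 1 : E) = algebraMap F E (-2) := by
    rw [map_neg, map_ofNat]; norm_num
  rw [h2, algebraMap_smul, algebraMap_smul] at h1
  exact smul_right_injective V (neg_ne_zero.2 (two_ne_zero (α := F))) h1

section

variable [FiniteDimensional F E]

/-- A central element of `H` has every anisotropic vector of `V_H` as an eigenvector, because it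
commutes with the reflection in it. -/
theorem exists_smul_of_mem_center_H {z : D.H} (hz : z ∈ Subgroup.center D.H) {w : V}
    (hw : IsUnit (D.form w w)) (hwe : D.form w D.e = 0) :
    ∃ c : E, z.val.val.val w = c • w := by
  have hew : D.form D.e w = 0 := by rw [← D.form_conj, hwe, map_zero]
  let s : D.H := ⟨D.scaleG (D.lineProj w) (D.lineProj_lineProj hw) (D.form_lineProj hw) (-1)
    (by simp), scaleOn_of_eq_zero (D.lineProj_of_form_eq_zero hew)⟩
  have hcomm := Subgroup.mem_center_iff.1 hz s
  have h1 := D.lineProj_comm_of_reflection (g := z.val.val.val) z.val.2.1 (w := w)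
    (fun v => congrArg (fun k : D.H => k.val.val.val v) hcomm) w
  rw [D.lineProj_self hw] at h1
  exact ⟨_, h1.symm⟩

/-- A central element of `H` acts on `V_H` by a scalar of norm one. -/
theorem exists_scalar_of_mem_center_H (κ : ConjCoords D.ι) {v₀ : V} (hv₀ : IsUnit (D.form v₀ v₀))
    (hv₀e : D.form v₀ D.e = 0) {z : D.H} (hz : z ∈ Subgroup.center D.H) :
    ∃ t : E, t * D.ι t = 1 ∧ ∀ v, z.val.val.val v = scaleOn D.perpProj t v := by
  obtain ⟨t, ht⟩ := D.exists_smul_of_mem_center_H hz hv₀ hv₀e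
  have hlin := z.val.2.1
  have hpres := z.val.2.2
  have hnorm : t * D.ι t = 1 := by
    have h := hpres v₀ v₀
    rw [ht, form_smul_left, form_smul_right, ← mul_assoc] at h
    exact hv₀.mul_right_cancel (by rw [h, one_mul])
  refine ⟨t, hnorm, ?_⟩
  have hιt : IsUnit (D.ι t) := IsUnit.of_mul_eq_one t (by rw [mul_comm, hnorm])
  -- the orthogonal complement of `v₀` in `V_H`
  have hperp : ∀ v, D.form v D.e = 0 → D.form v v₀ = 0 → z.val.val.val v = t • v := by
    intro v hve hv
    have hv' : D.form v₀ v = 0 := by rw [← D.form_conj, hv, map_zero]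
    have hzv : D.form (z.val.val.val v) v₀ = 0 := by
      have h := hpres v v₀
      rw [ht, form_smul_right, hv] at h
      exact (IsUnit.mul_right_eq_zero hιt).1 h
    -- `v + a v₀` is anisotropic for `a = 1` or `a = 2`
    obtain ⟨a, ha0, ha⟩ : ∃ a : E, IsUnit a ∧ IsUnit (D.form (v + a • v₀) (v + a • v₀)) := by
      have hexp : ∀ n : ℕ, D.form (v + (n : E) • v₀) (v + (n : E) • v₀)
          = D.form v v + (n : E) ^ 2 * D.form v₀ v₀ := by
        intro n
        simp only [map_add, LinearMap.add_apply, form_smul_left, form_smul_right, hv, hv',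
          map_natCast]
        ring
      have hunit : ∀ n : ℕ, n ≠ 0 → IsUnit (n : E) := fun n hn => by
        have h := (isUnit_iff_ne_zero.2 (Nat.cast_ne_zero (R := F).2 hn)).map (algebraMap F E)
        rwa [map_natCast] at h
      by_cases h1 : IsUnit (D.form v v + D.form v₀ v₀)
      · exact ⟨((1 : ℕ) : E), hunit 1 one_ne_zero, by rw [hexp]; simpa using h1⟩
      · refine ⟨((2 : ℕ) : E), hunit 2 two_ne_zero, ?_⟩
        by_contra h2
        rw [hexp] at h2
        have := κ.nontrivial
        have h3 := hexp 1
        rw [Nat.cast_one, one_pow, one_mul] at h3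
        rw [← h3, D.isUnit_form_self_iff κ, not_not, h3] at h1
        rw [← hexp, D.isUnit_form_self_iff κ, not_not, hexp] at h2
        have h4 : (3 : E) * D.form v₀ v₀ = 0 := by
          push_cast at h2
          linear_combination h2 - h1
        have h5 := (hunit 3 three_ne_zero).mul hv₀
        push_cast at h5
        exact h5.ne_zero h4
    obtain ⟨d, hd⟩ := D.exists_smul_of_mem_center_H hz ha
      (by rw [map_add, LinearMap.add_apply, form_smul_left, hve, hv₀e, mul_zero, add_zero])
    rw [map_add, hlin, ht] at hd
    have hdt : d = t := by
      have h := congrArg (fun x => D.form x v₀) hd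
      simp only [map_add, LinearMap.add_apply, form_smul_left, hv, hzv, smul_add,
        mul_zero, zero_add] at h
      refine (ha0.mul hv₀).mul_right_cancel ?_
      rw [← h]; ring
    rw [hdt, smul_add, smul_smul, smul_smul, mul_comm a t, add_left_inj] at hd
    exact hd
  have hVH : ∀ v, D.form v D.e = 0 → z.val.val.val v = t • v := by
    intro v hve
    have h1 : D.form (D.lineProj v₀ v) D.e = 0 := by
      rw [lineProj_apply, form_smul_left, hv₀e, mul_zero]
    have h2 := hperp (v - D.lineProj v₀ v)
      (by rw [map_sub, LinearMap.sub_apply, h1, hve, sub_zero])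
      (by rw [map_sub, LinearMap.sub_apply, D.form_lineProj hv₀, D.lineProj_self hv₀, sub_self])
    have h3 : z.val.val.val (D.lineProj v₀ v) = t • D.lineProj v₀ v := by
      rw [lineProj_apply, hlin, ht, smul_comm]
    rw [map_sub, h3, smul_sub, sub_left_inj] at h2
    exact h2
  intro v
  have h1 : v = D.perpProj v + D.lineProj D.e v := by rw [perpProj_apply, sub_add_cancel]
  have h2 : z.val.val.val (D.lineProj D.e v) = D.lineProj D.e v := by
    have he : z.val.val.val D.e = D.e := z.2
    rw [lineProj_apply, hlin, he]
  rw [h1, map_add, h2, hVH _ (D.form_perpProj_e v), ← h1, scaleOn_apply, perpProj_apply]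
  module

/-- The central element of `H` that acts on `V_H` by the norm one scalar `t`. -/
noncomputable def centerH (t : E) (ht : t * D.ι t = 1) : D.ZH :=
  ⟨⟨D.scaleG D.perpProj D.perpProj_perpProj D.form_perpProj t ht,
    scaleOn_of_eq_zero D.perpProj_e⟩, by
    rw [Subgroup.mem_center_iff]
    intro h
    refine Subtype.ext (D.G_ext fun v => ?_)
    change h.val.val.val (scaleOn D.perpProj t v) = scaleOn D.perpProj t (h.val.val.val v)
    have he : h.val.val.val D.e = D.e := h.2
    have hp : h.val.val.val (D.perpProj v) = D.perpProj (h.val.val.val v) := by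
      have h1 : D.form (h.val.val.val v) D.e = D.form v D.e := by
        conv_lhs => rw [← he]
        exact h.val.2.2 _ _
      simp only [perpProj_apply, lineProj_apply, map_sub, h.val.2.1, he, h1]
    simp only [scaleOn_apply, map_add, h.val.2.1, hp]⟩

theorem ZH_ext {z z' : D.ZH} (h : ∀ v, z.val.val.val.val v = z'.val.val.val.val v) : z = z' :=
  Subtype.ext (Subtype.ext (D.G_ext h))

end

end

end UnitaryGGP

namespace UnitaryGGP

/-! ### The trace form -/

section

variable {F E V : Type*} [RCLike F] [CommRing E] [Algebra F E]
  [NormedAddCommGroup V] [NormedSpace F V] [FiniteDimensional F V]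
  [NormedSpace ℝ V] [IsScalarTower ℝ F V] [Module E V] [IsScalarTower F E V]
  (D : UnitaryGGP F E V) (κ : ConjCoords D.ι)

include D in
theorem finiteDimensional_real_clm : FiniteDimensional ℝ (V →L[F] V) :=
  Module.Finite.trans F (V →L[F] V)

instance finiteDimensional_lie : FiniteDimensional ℝ D.lie := by
  have := D.finiteDimensional_real_clm
  exact FiniteDimensional.finiteDimensional_submodule _

/-- The trace of an endomorphism of `V` over `F`. -/
noncomputable def trF (A : V →L[F] V) : F := LinearMap.trace F V (A : V →ₗ[F] V)

omit [FiniteDimensional F V] [NormedSpace ℝ V] [IsScalarTower ℝ F V] in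
theorem trF_mul_comm (A B : V →L[F] V) : trF (A * B) = trF (B * A) :=
  LinearMap.trace_mul_comm F (A : V →ₗ[F] V) (B : V →ₗ[F] V)

/-- The identification of the purely imaginary complex numbers with `ℝ`. -/
noncomputable def imaginary : ℝ →ₗ[ℝ] LinearMap.ker Complex.reLm :=
  LinearMap.codRestrict _ (LinearMap.toSpanSingleton ℝ ℂ Complex.I) (fun x => by
    simp [LinearMap.mem_ker])

theorem imaginary_injective : Function.Injective imaginary := by
  intro x y h
  have h1 := congrArg (fun z : LinearMap.ker Complex.reLm => (z : ℂ).im) h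
  simpa [imaginary] using h1

/-- The pairing `i Re tr_F (T x)` on the Lie algebra. -/
noncomputable def traceForm : D.lie →ₗ[ℝ] D.lie →ₗ[ℝ] LinearMap.ker Complex.reLm :=
  LinearMap.mk₂ ℝ (fun T x => imaginary (RCLike.re (trF (T.val * x.val))))
    (fun T T' x => by
      rw [← map_add]
      congr 1
      change RCLike.re (trF ((T.val + T'.val) * x.val)) = _
      rw [add_mul, trF, trF, trF, ← map_add, ← map_add]
      rfl)
    (fun c T x => by
      rw [← map_smul]
      congr 1
      change RCLike.re (trF ((c • T.val) * x.val)) = _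
      have : (c • T.val) * x.val = (c : F) • (T.val * x.val) := by
        ext v
        change c • (T.val (x.val v)) = (c : F) • (T.val (x.val v))
        rw [RCLike.real_smul_eq_coe_smul (K := F)]
      rw [this, trF, trF, ContinuousLinearMap.toLinearMap_smul, map_smul, smul_eq_mul,
        RCLike.re_ofReal_mul, smul_eq_mul])
    (fun T x x' => by
      rw [← map_add]
      congr 1
      change RCLike.re (trF (T.val * (x.val + x'.val))) = _
      rw [mul_add, trF, trF, trF, ← map_add, ← map_add]
      rfl)
    (fun c T x => by
      rw [← map_smul]
      congr 1
      change RCLike.re (trF (T.val * (c • x.val))) = _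
      have : T.val * (c • x.val) = (c : F) • (T.val * x.val) := by
        ext v
        change T.val (c • (x.val v)) = (c : F) • (T.val (x.val v))
        rw [RCLike.real_smul_eq_coe_smul (K := F), map_smul]
      rw [this, trF, trF, ContinuousLinearMap.toLinearMap_smul, map_smul, smul_eq_mul,
        RCLike.re_ofReal_mul, smul_eq_mul])

/-- The linear map from the Lie algebra to its imaginary dual given by the trace form. -/
noncomputable def traceMap : D.lie →ₗ[ℝ] D.dual :=
  (LinearMap.toContinuousLinearMap : (D.lie →ₗ[ℝ] LinearMap.ker Complex.reLm) ≃ₗ[ℝ] _).toLinearMap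
    ∘ₗ D.traceForm

theorem traceMap_apply (T x : D.lie) :
    D.traceMap T x = imaginary (RCLike.re (trF (T.val * x.val))) := rfl

theorem smul_dual_apply (g : D.G) (ξ : D.dual) (x : D.lie) : (g • ξ) x = ξ (D.Ad g⁻¹ x) := rfl

theorem smul_traceMap (g : D.G) (T : D.lie) : g • D.traceMap T = D.traceMap (D.Ad g T) := by
  refine ContinuousLinearMap.ext fun x => ?_
  rw [smul_dual_apply, traceMap_apply, traceMap_apply]
  congr 2
  change trF (T.val * ((g⁻¹).val.val * x.val * ((g⁻¹)⁻¹).val.val))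
    = trF (g.val.val * T.val * (g⁻¹).val.val * x.val)
  rw [inv_inv, ← mul_assoc, trF_mul_comm]
  simp only [mul_assoc]

/-- The skew-adjoint operator `v ↦ ⟨v, b⟩ a - ⟨v, a⟩ b` of rank at most two. -/
noncomputable def skewPair (a b : V) : D.lie :=
  ⟨toCLM ((D.form.flip b).smulRight a - (D.form.flip a).smulRight b), fun c v => by
    simp only [toCLM_apply, map_smul], fun v w => by
    simp only [toCLM_apply, LinearMap.sub_apply, LinearMap.smulRight_apply, LinearMap.flip_apply,
      map_sub, form_smul_left, form_smul_right, form_conj]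
    ring⟩

include κ in
/-- The trace over `F` of the operator `v ↦ ⟨v, b⟩ a` is the trace of `⟨a, b⟩` over `F`. -/
theorem trF_rankOne (a b : V) :
    trF (toCLM ((D.form.flip b).smulRight a)) = 2 * κ.re (D.form a b) := by
  have h : ((toCLM ((D.form.flip b).smulRight a) : V →L[F] V) : V →ₗ[F] V)
      = ((D.reForm κ).flip b).smulRight a + ((D.imForm κ).flip b).smulRight (κ.δ • a) := by
    ext v
    change D.form v b • a = κ.re (D.form v b) • a + κ.im (D.form v b) • (κ.δ • a)
    exact κ.smul_eq _ _
  rw [trF, h, map_add, LinearMap.trace_smulRight, LinearMap.trace_smulRight]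
  change κ.re (D.form a b) + κ.im (D.form (κ.δ • a) b) = _
  rw [form_smul_left, κ.im_mul]
  simp
  ring

include κ in
theorem traceMap_injective : Function.Injective D.traceMap := by
  refine (injective_iff_map_eq_zero _).2 fun T hT => ?_
  have hskew := T.2.2
  -- `tr_F (T x) = 4 re ⟨T a, b⟩` for `x = skewPair a b`
  have htr : ∀ a b, RCLike.re (κ.re (D.form (T.val a) b)) = 0 := by
    intro a b
    have h1 := congrArg (fun ξ : D.dual => ξ (D.skewPair a b)) hT
    have h2 : RCLike.re (trF (T.val * (D.skewPair a b).val)) = 0 := by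
      apply imaginary_injective
      rw [← traceMap_apply]
      simpa using h1
    have h3 : T.val * (D.skewPair a b).val
        = toCLM ((D.form.flip b).smulRight (T.val a))
          - toCLM ((D.form.flip a).smulRight (T.val b)) := by
      ext v
      change T.val (D.form v b • a - D.form v a • b) = D.form v b • T.val a - D.form v a • T.val b
      rw [map_sub, T.2.1, T.2.1]
    have h4 : D.form (T.val b) a = -D.form b (T.val a) := by
      linear_combination hskew b a
    rw [h3, trF, ContinuousLinearMap.toLinearMap_sub, map_sub] at h2
    change RCLike.re (trF _ - trF _) = 0 at h2
    rw [D.trF_rankOne κ, D.trF_rankOne κ, h4, map_neg, D.reForm_comm κ b, mul_neg, sub_neg_eq_add,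
      ← two_mul, ← mul_assoc] at h2
    have h5 : (2 * 2 : F) = ((4 : ℝ) : F) := by
      rw [RCLike.ofReal_ofNat]; norm_num
    rw [h5, RCLike.re_ofReal_mul] at h2
    linarith
  apply Subtype.ext
  ext a
  refine D.eq_zero_of_re_form κ fun b => ?_
  -- replacing `b` by its multiple by the conjugate of `re ⟨T a, b⟩` removes the real part
  have h := htr a ((starRingEnd F (κ.re (D.form (T.val a) b))) • b)
  rw [form_smul_right', ← Algebra.smul_def, map_smul, smul_eq_mul, RCLike.conj_mul,
    ← RCLike.ofReal_pow, RCLike.ofReal_re] at h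
  exact norm_eq_zero.1 (pow_eq_zero_iff two_ne_zero |>.1 h)

theorem finrank_imaginary : Module.finrank ℝ (LinearMap.ker Complex.reLm) = 1 := by
  have h := LinearMap.finrank_range_add_finrank_ker Complex.reLm
  rw [LinearMap.range_eq_top.2 Complex.re_surjective, finrank_top, Module.finrank_self,
    Complex.finrank_real_complex] at h
  omega

instance finiteDimensional_dual : FiniteDimensional ℝ D.dual :=
  LinearEquiv.finiteDimensional (LinearMap.toContinuousLinearMap :
    (D.lie →ₗ[ℝ] LinearMap.ker Complex.reLm) ≃ₗ[ℝ] D.dual)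

include κ in
theorem traceMap_bijective : Function.Bijective D.traceMap := by
  have h1 : Module.finrank ℝ D.lie = Module.finrank ℝ D.dual := by
    rw [← LinearEquiv.finrank_eq (LinearMap.toContinuousLinearMap :
      (D.lie →ₗ[ℝ] LinearMap.ker Complex.reLm) ≃ₗ[ℝ] D.dual), Module.finrank_linearMap,
      finrank_imaginary, mul_one]
  exact ⟨D.traceMap_injective κ, (LinearMap.injective_iff_surjective_of_finrank_eq_finrank
    (K := ℝ) (V := D.lie) (V₂ := D.dual) h1 (f := D.traceMap)).1 (D.traceMap_injective κ)⟩

/-- The `G`-equivariant identification of the Lie algebra with its imaginary dual. -/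
noncomputable def traceEquiv : D.lie ≃L[ℝ] D.dual :=
  LinearEquiv.toContinuousLinearEquiv (𝕜 := ℝ) (E := D.lie) (F := D.dual)
    (LinearEquiv.ofBijective D.traceMap (D.traceMap_bijective κ))

theorem smul_traceEquiv (g : D.G) (T : D.lie) :
    g • D.traceEquiv κ T = D.traceEquiv κ (D.Ad g T) := D.smul_traceMap g T

end

end UnitaryGGP

/-! ### Zariski closed sets -/

theorem IsZariskiClosed.isClosed {W : Type*} [AddCommGroup W] [Module ℝ W]
    [TopologicalSpace W] [IsTopologicalAddGroup W] [ContinuousSMul ℝ W] [T2Space W]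
    [FiniteDimensional ℝ W] {S : Set W} (hS : IsZariskiClosed S) : IsClosed S := by
  obtain ⟨P, rfl⟩ := hS
  simp only [Set.ofPred_forall]
  refine isClosed_iInter fun p => isClosed_iInter fun _ => isClosed_eq ?_ continuous_const
  refine (MvPolynomial.continuous_eval p).comp (continuous_pi fun ℓ => ?_)
  exact LinearMap.continuous_of_finiteDimensional ℓ

/-! ### Degeneration along a grading -/

section Grading

variable {F A : Type*} [Field F] [Ring A] [Algebra F A]

/-- Conjugation by `s p + p₀ + s⁻¹ p'`, where `p`, `p₀`, `p'` are thought of as the projections of a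
grading such that `T` preserves the corresponding flag: the conjugates of `T` have a limit when
`s → 0`, namely the block diagonal part of `T`. -/
theorem conj_grading {p p₀ p' T : A} (h10 : p₀ * (T * p) = 0)
    (h12 : p' * (T * p) = 0) (h20 : p' * (T * p₀) = 0) {s : F} (hs : s ≠ 0) :
    (s • p + p₀ + s⁻¹ • p') * T * (s⁻¹ • p + p₀ + s • p')
      = (p * (T * p) + p₀ * (T * p₀) + p' * (T * p'))
        + s • (p * (T * p₀) + p₀ * (T * p')) + (s ^ 2) • (p * (T * p')) := by
  simp only [mul_assoc, add_mul, mul_add, smul_mul_assoc, mul_smul_comm, h10, h12, h20, smul_zero,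
    smul_smul, inv_mul_cancel₀ hs, one_smul, add_zero]
  match_scalars <;> field_simp

end Grading

namespace UnitaryGGP

section

variable {F E V : Type*} [RCLike F] [CommRing E] [Algebra F E]
  [NormedAddCommGroup V] [NormedSpace F V] [FiniteDimensional F V]
  [NormedSpace ℝ V] [IsScalarTower ℝ F V] [Module E V] [IsScalarTower F E V]
  {D : UnitaryGGP F E V} (κ : ConjCoords D.ι)

/-! ### Stable elements are cyclic -/

theorem Ad_apply (g : D.G) (T : D.lie) (v : V) :
    (D.Ad g T).val v = g.val.val (T.val ((g⁻¹).val.val v)) := rfl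

theorem Ad_of_comm {g : D.G} {T : D.lie}
    (h : ∀ v, g.val.val (T.val v) = T.val (g.val.val v)) : D.Ad g T = T := by
  refine Subtype.ext (ContinuousLinearMap.ext fun v => ?_)
  rw [Ad_apply, h, D.apply_inv_self]

theorem skew (T : D.lie) (v w : V) : D.form (T.val v) w = -D.form v (T.val w) :=
  eq_neg_of_add_eq_zero_left (T.2.2 v w)

theorem not_stable_of_injective {ξ : D.dual} {S : Type*} [Infinite S] (f : S → D.H)
    (hf : Function.Injective f) (hfix : ∀ s, f s • ξ = ξ) : ξ ∉ D.stable := fun h =>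
  ((Set.infinite_range_of_injective hf).mono (Set.range_subset_iff.2 hfix)) h.1

instance infinite_cayley_domain : Infinite {s : F // 1 - κ.disc * s ^ 2 ≠ 0} := by
  refine (infinite_of_mem_nhds (0 : F) (IsOpen.mem_nhds ?_ ?_)).to_subtype
  · exact isOpen_ne_fun (by fun_prop) continuous_const
  · change 1 - κ.disc * 0 ^ 2 ≠ 0
    simp

/-- If `T` commutes with a nonzero orthogonal projection onto a subspace of `V_H`, then its
stabilizer contains the norm one scalars on this subspace. -/
theorem not_stable_of_projection {T : D.lie} {q : V →ₗ[E] V} (hq : ∀ v, q (q v) = q v)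
    (hsa : ∀ v w, D.form (q v) w = D.form v (q w)) (hqe : q D.e = 0)
    (hqT : ∀ v, q (T.val v) = T.val (q v)) (hq0 : q ≠ 0) : D.traceEquiv κ T ∉ D.stable := by
  obtain ⟨v, hv⟩ : ∃ v, q v ≠ 0 := by
    by_contra! h
    exact hq0 (LinearMap.ext h)
  refine not_stable_of_injective (S := {s : F // 1 - κ.disc * s ^ 2 ≠ 0})
    (fun s => ⟨D.scaleG q hq hsa (κ.cayley s.val) (κ.cayley_mul_conj s.2),
      scaleOn_of_eq_zero hqe⟩) (fun s s' h => ?_) fun s => ?_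
  · have h1 : scaleOn q (κ.cayley s.val) (q v) = scaleOn q (κ.cayley s'.val) (q v) :=
      congrArg (fun g : D.H => g.val.val.val (q v)) h
    rw [scaleOn_of_eq (hq v), scaleOn_of_eq (hq v)] at h1
    exact Subtype.ext (κ.cayley_smul_injective hv s.2 s'.2 h1)
  · change (D.scaleG q hq hsa (κ.cayley s.val) (κ.cayley_mul_conj s.2)) • D.traceEquiv κ T = _
    rw [smul_traceEquiv, Ad_of_comm fun v => ?_]
    simp only [scaleG_apply, scaleOn_apply, hqT, map_add, T.2.1]

/-- The operator `s q + (1 - q - q') + s⁻¹ q'`. -/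
noncomputable def gradingMap (q q' : V →ₗ[E] V) (s : F) : V →ₗ[E] V :=
  algebraMap F E s • q + (LinearMap.id - q - q') + algebraMap F E s⁻¹ • q'

theorem gradingMap_apply (q q' : V →ₗ[E] V) (s : F) (v : V) :
    gradingMap q q' s v = s • q v + (v - q v - q' v) + s⁻¹ • q' v := by
  simp [gradingMap]

section

variable {q q' : V →ₗ[E] V} (hq : ∀ v, q (q v) = q v) (hq' : ∀ v, q' (q' v) = q' v)
  (hqq' : ∀ v, q (q' v) = 0) (hq'q : ∀ v, q' (q v) = 0)
  (hadj : ∀ v w, D.form (q v) w = D.form v (q' w))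

include hq hq' hqq' hq'q in
theorem gradingMap_gradingMap {s : F} (hs : s ≠ 0) (v : V) :
    gradingMap q q' s (gradingMap q q' s⁻¹ v) = v := by
  have hF : ∀ (f : V →ₗ[E] V) (a : F) (x : V), f (a • x) = a • f x := fun f a x =>
    (f.restrictScalars F).map_smul a x
  simp only [gradingMap_apply, map_add, map_sub, hF, hq, hq', hqq', hq'q, inv_inv,
    smul_zero, add_zero, zero_add, sub_self, sub_zero, smul_smul,
    mul_inv_cancel₀ hs, inv_mul_cancel₀ hs, one_smul]
  abel

include hq hq' hqq' hq'q hadj in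
theorem form_gradingMap {s : F} (hs : s ≠ 0) (v w : V) :
    D.form (gradingMap q q' s v) (gradingMap q q' s w) = D.form v w := by
  have hadj' : ∀ v w, D.form (q' v) w = D.form v (q w) := fun v w => by
    rw [← D.form_conj, ← hadj, D.form_conj]
  have h : algebraMap F E s * algebraMap F E s⁻¹ = 1 := by
    rw [← map_mul, mul_inv_cancel₀ hs, map_one]
  have hF : ∀ (f : V →ₗ[E] V) (a : F) (x : V), f (a • x) = a • f x := fun f a x =>
    (f.restrictScalars F).map_smul a x
  have key : D.form (gradingMap q q' s v) (gradingMap q q' s w)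
      = D.form v (gradingMap q q' s⁻¹ (gradingMap q q' s w)) := by
    simp only [gradingMap_apply q q' s v, gradingMap_apply q q' s⁻¹ (gradingMap q q' s w),
      map_add, map_sub, LinearMap.add_apply, LinearMap.sub_apply, form_smul_left',
      form_smul_right', hadj, hadj', inv_inv]
    ring
  have hinv := gradingMap_gradingMap hq hq' hqq' hq'q (inv_ne_zero hs) w
  rw [inv_inv] at hinv
  rw [key, hinv]

/-- The one parameter subgroup of `H` attached to a pair of mutually adjoint orthogonal
idempotents that kill `e`. -/
noncomputable def gradingH (hqe : q D.e = 0) (hq'e : q' D.e = 0) (s : Fˣ) : D.H :=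
  ⟨D.mkG (gradingMap q q' (s : F)) (gradingMap q q' (s : F)⁻¹)
    (gradingMap_gradingMap hq hq' hqq' hq'q s.ne_zero)
    (fun v => by
      have := gradingMap_gradingMap hq hq' hqq' hq'q (inv_ne_zero s.ne_zero) v
      rwa [inv_inv] at this)
    (form_gradingMap hq hq' hqq' hq'q hadj s.ne_zero), by
    change gradingMap q q' (s : F) D.e = D.e
    rw [gradingMap_apply, hqe, hq'e]
    simp⟩

include hq hq' hqq' hq'q hadj in
/-- If `T` preserves the isotropic image of `q`, then `T` degenerates under the one parameter
subgroup to an element with infinite stabilizer. Were the orbit closed, this element would be in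
it. -/
theorem not_stable_of_isotropic {T : D.lie} (hqe : q D.e = 0) (hq'e : q' D.e = 0)
    (hTq : ∀ v, q (T.val (q v)) = T.val (q v)) (hq0 : q ≠ 0) :
    D.traceEquiv κ T ∉ D.stable := by
  intro hst
  obtain ⟨v, hv⟩ : ∃ v, q v ≠ 0 := by
    by_contra! h
    exact hq0 (LinearMap.ext h)
  let L : Fˣ → D.H := gradingH hq hq' hqq' hq'q hadj hqe hq'e
  have hLinj : Function.Injective L := by
    intro s s' h
    have h1 : gradingMap q q' (s : F) (q v) = gradingMap q q' (s' : F) (q v) :=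
      congrArg (fun g : D.H => g.val.val.val (q v)) h
    simp only [gradingMap_apply, hq, hq'q, sub_self, smul_zero, add_zero] at h1
    exact Units.ext (smul_left_injective F hv h1)
  have hLadd : ∀ s : F, (toCLM (gradingMap q q' s) : V →L[F] V)
      = s • toCLM q + toCLM (LinearMap.id - q - q') + s⁻¹ • toCLM q' := by
    intro s
    ext x
    exact gradingMap_apply q q' s x
  -- adjointness turns the invariance of the image of `q` into that of the kernel of `q'`
  have hq'T : ∀ x, q' (T.val (q' x)) = q' (T.val x) := by
    intro x
    refine D.eq_of_form_right fun y => ?_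
    have hadj' : ∀ v w, D.form (q' v) w = D.form v (q w) := fun v w => by
      rw [← D.form_conj, ← hadj, D.form_conj]
    rw [hadj', skew, hadj', hTq, ← skew, hadj']
  set P : V →L[F] V := toCLM q with hP
  set P₀ : V →L[F] V := toCLM (LinearMap.id - q - q') with hP₀
  set P' : V →L[F] V := toCLM q' with hP'
  have h12 : P' * (T.val * P) = 0 := by
    ext x
    change q' (T.val (q x)) = 0
    rw [← hTq, hq'q]
  have h10 : P₀ * (T.val * P) = 0 := by
    ext x
    change T.val (q x) - q (T.val (q x)) - q' (T.val (q x)) = 0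
    rw [hTq, ← hTq, hq'q]
    simp
  have h20 : P' * (T.val * P₀) = 0 := by
    ext x
    change q' (T.val (x - q x - q' x)) = 0
    have h := congrArg (fun f : V →L[F] V => f x) h12
    have h' : q' (T.val (q x)) = 0 := h
    rw [map_sub, map_sub, map_sub, map_sub, hq'T, h']
    simp
  set X₀ : V →L[F] V := P * (T.val * P) + P₀ * (T.val * P₀) + P' * (T.val * P') with hX₀
  have hAd : ∀ s : Fˣ, (D.Ad (L s).val T).val
      = X₀ + (s : F) • (P * (T.val * P₀) + P₀ * (T.val * P'))
        + ((s : F) ^ 2) • (P * (T.val * P')) := by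
    intro s
    rw [← conj_grading h10 h12 h20 s.ne_zero]
    have h1 : (s : F) • P + P₀ + (s : F)⁻¹ • P' = toCLM (gradingMap q q' (s : F)) := (hLadd _).symm
    have h2 : (s : F)⁻¹ • P + P₀ + (s : F) • P' = toCLM (gradingMap q q' (s : F)⁻¹) := by
      rw [hLadd, inv_inv]
    rw [h1, h2]
    rfl
  have : (𝓝[{x : F | IsUnit x}] (0 : F)).NeBot := by
    have : {x : F | IsUnit x} = {0}ᶜ := by ext x; simp
    rw [this]
    infer_instance
  -- the limit of the conjugates as `s → 0`
  let l : Filter Fˣ := Filter.comap (Units.val : Fˣ → F) (𝓝 0)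
  have hl : l.NeBot := by
    refine Filter.comap_neBot fun t ht => ?_
    obtain ⟨x, hx, hx0⟩ : ∃ x ∈ t, IsUnit x := by
      obtain ⟨x, hx⟩ := Filter.nonempty_of_mem (inter_mem_nhdsWithin {x : F | IsUnit x} ht)
      exact ⟨x, hx.2, hx.1⟩
    exact ⟨hx0.unit, hx⟩
  have hval : Filter.Tendsto (Units.val : Fˣ → F) l (𝓝 0) := Filter.tendsto_comap
  have hlim : Filter.Tendsto (fun s : Fˣ => (D.Ad (L s).val T).val) l (𝓝 X₀) := by
    simp only [hAd]
    have hcont : Continuous fun s : F => X₀ + s • (P * (T.val * P₀) + P₀ * (T.val * P'))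
        + (s ^ 2) • (P * (T.val * P')) := by fun_prop
    have := (hcont.tendsto 0).comp hval
    simpa [Function.comp_def] using this
  have := D.finiteDimensional_real_clm
  have hmem : X₀ ∈ D.lie := by
    have hcl : IsClosed (D.lie : Set (V →L[F] V)) := Submodule.closed_of_finiteDimensional _
    exact hcl.mem_of_tendsto hlim (Filter.Eventually.of_forall fun s => (D.Ad (L s).val T).2)
  let T₀ : D.lie := ⟨X₀, hmem⟩
  have hlim' : Filter.Tendsto (fun s : Fˣ => D.Ad (L s).val T) l (𝓝 T₀) :=
    tendsto_subtype_rng.2 hlim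
  have horb : D.traceEquiv κ T₀ ∈ MulAction.orbit D.H (D.traceEquiv κ T) := by
    refine hst.2.isClosed.mem_of_tendsto
      (((D.traceEquiv κ).continuous.tendsto T₀).comp hlim')
      (Filter.Eventually.of_forall fun s => ⟨L s, ?_⟩)
    exact D.smul_traceEquiv κ _ _
  obtain ⟨h, hh⟩ := horb
  have hh' : h • D.traceEquiv κ T = D.traceEquiv κ T₀ := hh
  have hfix : ∀ s, L s • D.traceEquiv κ T₀ = D.traceEquiv κ T₀ := by
    intro s
    change (L s).val • D.traceEquiv κ T₀ = _
    rw [smul_traceEquiv, Ad_of_comm fun x => ?_]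
    change gradingMap q q' (s : F) (X₀ x) = X₀ (gradingMap q q' (s : F) x)
    have hX : ∀ x, X₀ x = q (T.val (q x)) + (LinearMap.id - q - q' : V →ₗ[E] V)
        (T.val ((LinearMap.id - q - q' : V →ₗ[E] V) x)) + q' (T.val (q' x)) := fun x => rfl
    have hF : ∀ (f : V →ₗ[E] V) (a : F) (x : V), f (a • x) = a • f x := fun f a x =>
      (f.restrictScalars F).map_smul a x
    simp only [gradingMap_apply, hX, LinearMap.sub_apply, LinearMap.id_apply, map_add, map_sub,
      hF, map_smul, hq, hq', hqq', hq'q, sub_self, sub_zero, add_zero, zero_add,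
      smul_zero]
    module
  have : Infinite Fˣ := unitsEquivNeZero.infinite_iff.2
    (Set.finite_singleton (0 : F)).infinite_compl.to_subtype
  refine not_stable_of_injective (fun s => h⁻¹ * L s * h) (fun s s' hss => ?_) (fun s => ?_) hst
  · exact hLinj (mul_left_cancel (mul_right_cancel hss))
  · rw [mul_smul, mul_smul, hh', hfix, ← hh', inv_smul_smul]

end

variable [Algebra.IsQuadraticExtension F E] [Algebra.Etale F E]

/-- The orthogonal complement of an `E`-submodule. -/
def perp (D : UnitaryGGP F E V) (W : Submodule E V) : Submodule E V where
  carrier := {v | ∀ w ∈ W, D.form w v = 0}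
  zero_mem' := fun w _ => map_zero _
  add_mem' := fun hv hv' w hw => by rw [map_add, hv w hw, hv' w hw, add_zero]
  smul_mem' := fun a v hv w hw => by rw [form_smul_right, hv w hw, mul_zero]

include κ in
theorem isCompl_perp {W : Submodule E V} (hW : Disjoint W (D.perp W)) : IsCompl W (D.perp W) := by
  have horth : (D.reForm κ).orthogonal (W.restrictScalars F)
      = (D.perp W).restrictScalars F := by
    ext v
    refine ⟨fun h w hw => ?_, fun h w hw => ?_⟩
    · have h1 := D.form_eq_of_re κ (v := v) (w := w) (v' := 0) (w' := 0)
        (by rw [D.reForm_comm]; simpa using h w hw)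
        (by rw [D.reForm_comm]; simpa using h _ (W.smul_mem κ.δ hw))
      rw [← D.form_conj, h1]
      simp
    · change κ.re (D.form w v) = 0
      rw [h w hw, map_zero]
  have hrefl : (D.reForm κ).IsRefl := fun v w h => by
    change κ.re _ = 0
    rw [D.reForm_comm]
    exact h
  have hdisj : Disjoint (W.restrictScalars F) ((D.reForm κ).orthogonal (W.restrictScalars F)) := by
    rw [horth, Submodule.disjoint_def]
    exact fun v hv hv' => Submodule.disjoint_def.1 hW v hv hv'
  have hcompl := (LinearMap.BilinForm.isCompl_orthogonal_iff_disjoint hrefl).2 hdisj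
  rw [horth] at hcompl
  refine ⟨hW, codisjoint_iff.2 (eq_top_iff.2 fun v _ => ?_)⟩
  have hv : v ∈ W.restrictScalars F ⊔ (D.perp W).restrictScalars F := by
    rw [hcompl.sup_eq_top]; trivial
  obtain ⟨a, ha, b, hb, rfl⟩ := Submodule.mem_sup.1 hv
  exact Submodule.add_mem_sup ha hb

theorem perp_invariant {T : D.lie} {W : Submodule E V} (hT : ∀ w ∈ W, T.val w ∈ W) :
    ∀ v ∈ D.perp W, T.val v ∈ D.perp W := fun v hv w hw => by
  have h := skew T w v
  rw [hv _ (hT w hw)] at h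
  exact neg_eq_zero.1 h.symm

/-- An element of the dual is not stable if the corresponding operator preserves a nonzero subspace
of `V_H`. -/
theorem not_stable_of_invariant {T : D.lie} {W : Submodule E V} (hT : ∀ w ∈ W, T.val w ∈ W)
    (hWe : ∀ w ∈ W, D.form w D.e = 0) (hW : W ≠ ⊥) : D.traceEquiv κ T ∉ D.stable := by
  have heW : D.e ∈ D.perp W := hWe
  by_cases hdisj : Disjoint W (D.perp W)
  · have hcompl := isCompl_perp κ hdisj
    set q := W.projection (D.perp W) hcompl with hqdef
    have hqW : ∀ v, q v ∈ W := fun v => Submodule.projection_apply_mem _ v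
    have hq1 : ∀ v ∈ W, q v = v := fun v hv => Submodule.projection_apply_of_mem_left _ hv
    have hq2 : ∀ v ∈ D.perp W, q v = 0 := fun v hv =>
      (Submodule.projection_apply_eq_zero_iff hcompl).2 hv
    have hsub : ∀ v, v - q v ∈ D.perp W := fun v => Submodule.sub_projection_mem hcompl v
    have horth : ∀ v w, D.form (q v) (w - q w) = 0 := fun v w => hsub w _ (hqW v)
    have hleft : ∀ v w, D.form (q v) w = D.form (q v) (q w) := fun v w =>
      sub_eq_zero.1 (by rw [← map_sub]; exact horth v w)
    refine not_stable_of_projection κ (q := q) (fun v => hq1 _ (hqW v)) (fun v w => ?_)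
      (hq2 _ heW) (fun v => ?_) fun h0 => hW ?_
    · rw [hleft, ← D.form_conj, ← hleft, D.form_conj]
    · have h1 : T.val v = T.val (q v) + T.val (v - q v) := by rw [← map_add, add_sub_cancel]
      rw [h1, map_add, hq1 _ (hT _ (hqW v)), hq2 _ (perp_invariant hT _ (hsub v)), add_zero]
    · refine (Submodule.eq_bot_iff _).2 fun w hw => ?_
      rw [← hq1 w hw, h0, LinearMap.zero_apply]
  · have : IsReduced E := Algebra.FormallyUnramified.isReduced_of_field F E
    have : IsArtinianRing E := IsArtinianRing.of_finite F E
    have : IsSemisimpleRing E := IsArtinianRing.isSemisimpleRing_of_isReduced E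
    -- the radical of `W` is isotropic and invariant
    set R := W ⊓ D.perp W with hR
    have hR0 : R ≠ ⊥ := fun h => hdisj (disjoint_iff.2 h)
    have hRT : ∀ v ∈ R, T.val v ∈ R := fun v hv => ⟨hT v hv.1, perp_invariant hT v hv.2⟩
    have hRR : ∀ v ∈ R, ∀ w ∈ R, D.form v w = 0 := fun v hv w hw => hw.2 v hv.1
    have hRe : ∀ v ∈ R, D.form v D.e = 0 := fun v hv => hWe v hv.1
    obtain ⟨C, hC⟩ := exists_isCompl R
    set p : V →ₗ[E] V := R.projection C hC ∘ₗ D.perpProj with hp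
    have hpR : ∀ v, p v ∈ R := fun v => Submodule.projection_apply_mem _ _
    have hp1 : ∀ v ∈ R, p v = v := fun v hv => by
      rw [hp, LinearMap.comp_apply, D.perpProj_of_form_eq_zero (hRe v hv)]
      exact Submodule.projection_apply_of_mem_left _ hv
    have hpe : p D.e = 0 := by rw [hp, LinearMap.comp_apply, D.perpProj_e, map_zero]
    obtain ⟨p', hp'⟩ := D.exists_adjoint κ p
    have hp'' : ∀ v w, D.form (p' v) w = D.form v (p w) := fun v w => by
      rw [← D.form_conj, ← hp', D.form_conj]
    have hpp : ∀ v, p (p v) = p v := fun v => hp1 _ (hpR v)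
    have hp'p' : ∀ v, p' (p' v) = p' v := fun v => D.eq_of_form_right fun w => by
      rw [hp'', hp'', hpp, hp'']
    have hp'R : ∀ v ∈ R, p' v = 0 := fun v hv => D.eq_zero_of_form_right fun w => by
      rw [hp'', hRR v hv _ (hpR w)]
    have hp'p : ∀ v, p' (p v) = 0 := fun v => hp'R _ (hpR v)
    have hp'e : p' D.e = 0 := D.eq_zero_of_form_right fun w => by
      rw [hp'', ← D.form_conj, hRe _ (hpR w), map_zero]
    have hh : (1 / 2 : F) + 1 / 2 = 1 := by norm_num
    have hι : D.ι (algebraMap F E (1 / 2)) = algebraMap F E (1 / 2) := D.ι.commutes _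
    -- correct `p` so that it becomes orthogonal to its adjoint
    set q : V →ₗ[E] V := p - algebraMap F E (1 / 2) • (p ∘ₗ p') with hq
    set q' : V →ₗ[E] V := p' - algebraMap F E (1 / 2) • (p ∘ₗ p') with hq'
    have hqv : ∀ v, q v = p v - algebraMap F E (1 / 2) • p (p' v) := fun v => rfl
    have hq'v : ∀ v, q' v = p' v - algebraMap F E (1 / 2) • p (p' v) := fun v => rfl
    have hqR : ∀ v, q v ∈ R := fun v => R.sub_mem (hpR _) (R.smul_mem _ (hpR _))
    have hq1 : ∀ v ∈ R, q v = v := fun v hv => by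
      rw [hqv, hp1 v hv, hp'R v hv, map_zero, smul_zero, sub_zero]
    have h2 : ∀ v : V, algebraMap F E (1 / 2) • v + algebraMap F E (1 / 2) • v = v := fun v => by
      rw [← add_smul, ← map_add, hh, map_one, one_smul]
    refine not_stable_of_isotropic κ (q := q) (q' := q') (fun v => hq1 _ (hqR v)) (fun v => ?_)
      (fun v => ?_) (fun v => ?_) (fun v w => ?_) ?_ ?_ (fun v => hq1 _ (hRT _ (hqR v)))
      fun h0 => hR0 ?_
    · simp only [hq'v, map_sub, map_smul, hp'p', hp'p, smul_zero, sub_zero]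
    · simp only [hqv, hq'v, map_sub, map_smul, hp'p', hp'p, hpp, smul_zero, sub_zero]
      rw [sub_sub, h2, sub_self]
    · simp only [hqv, hq'v, map_sub, map_smul, hp'p, smul_zero, sub_zero, map_zero]
    · simp only [hqv, hq'v, map_sub, LinearMap.sub_apply, form_smul_left, form_smul_right, hι,
        hp', hp'']
    · rw [hqv, hpe, hp'e, map_zero, smul_zero, sub_zero]
    · rw [hq'v, hp'e, map_zero, smul_zero, sub_zero]
    · refine (Submodule.eq_bot_iff _).2 fun w hw => ?_
      rw [← hq1 w hw, h0, LinearMap.zero_apply]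

/-- For stable `T` the vectors `T ^ k e` generate `V`: nothing nonzero is orthogonal to all of
them. -/
theorem cyclic_of_stable {T : D.lie} (hT : D.traceEquiv κ T ∈ D.stable) {w : V}
    (hw : ∀ k : ℕ, D.form ((T.val ^ k) D.e) w = 0) : w = 0 := by
  let W : Submodule E V :=
    { carrier := {w | ∀ k : ℕ, D.form ((T.val ^ k) D.e) w = 0}
      zero_mem' := fun k => map_zero _
      add_mem' := fun hv hv' k => by rw [map_add, hv k, hv' k, add_zero]
      smul_mem' := fun a v hv k => by rw [form_smul_right, hv k, mul_zero] }
  by_contra hw0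
  refine not_stable_of_invariant κ (T := T) (W := W) (fun v hv k => ?_) (fun v hv => ?_)
    (fun h => hw0 ?_) hT
  · have h1 := skew T ((T.val ^ k) D.e) v
    have h2 : T.val ((T.val ^ k) D.e) = (T.val ^ (k + 1)) D.e := by rw [pow_succ']; rfl
    rw [h2, hv (k + 1)] at h1
    exact neg_eq_zero.1 h1.symm
  · rw [← D.form_conj]
    have := hv 0
    rw [pow_zero] at this
    change D.form D.e v = 0 at this
    rw [this, map_zero]
  · have : w ∈ W := hw
    rw [h] at this
    exact (Submodule.mem_bot E).1 this

end

end UnitaryGGP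

/-! ### Separated sets in a real vector space -/

/-- A ball in a real vector space of dimension `d` contains at least `c R ^ (-d)` points with
distances larger than `R`. -/
theorem exists_separated_finset (W : Type*) [NormedAddCommGroup W] [NormedSpace ℝ W]
    [FiniteDimensional ℝ W] {ρ : ℝ} (hρ : 0 < ρ) :
    ∃ c : ℝ, 0 < c ∧ ∀ R : ℝ, 0 < R → ∃ P : Finset W, (∀ x ∈ P, ‖x‖ ≤ ρ) ∧
      (∀ x ∈ P, ∀ y ∈ P, x ≠ y → R < ‖x - y‖) ∧ c ≤ P.card * R ^ Module.finrank ℝ W := by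
  classical
  set d := Module.finrank ℝ W
  let f : W ≃L[ℝ] (Fin d → ℝ) := (Module.finBasis ℝ W).equivFunL
  obtain ⟨A, hA, hfA⟩ := (f : W →L[ℝ] (Fin d → ℝ)).bound
  obtain ⟨B, hB, hfB⟩ := (f.symm : (Fin d → ℝ) →L[ℝ] W).bound
  -- the points with coordinates `2 A R j`, for integers `0 ≤ j < n`
  refine ⟨(ρ / (2 * A * B)) ^ d, by positivity, fun R hR => ?_⟩
  set n := ⌊ρ / (2 * A * B) / R⌋₊ + 1
  let pt : (Fin d → Fin n) → W := fun j => f.symm fun i => 2 * A * R * ((j i : ℕ) : ℝ)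
  have hsep : ∀ j j', j ≠ j' → R < ‖pt j - pt j'‖ := by
    intro j j' hj
    obtain ⟨i, hi⟩ := Function.ne_iff.1 hj
    have h1 : f (pt j - pt j') i = 2 * A * R * (((j i : ℕ) : ℝ) - ((j' i : ℕ) : ℝ)) := by
      rw [map_sub, Pi.sub_apply, f.apply_symm_apply, f.apply_symm_apply, mul_sub]
    have h2 : (1 : ℝ) ≤ |((j i : ℕ) : ℝ) - ((j' i : ℕ) : ℝ)| := by
      have h3 : ((j i : ℕ) : ℤ) - ((j' i : ℕ) : ℤ) ≠ 0 := by
        intro h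
        exact hi (Fin.ext (by omega))
      exact_mod_cast Int.one_le_abs h3
    have h3 : 2 * A * R ≤ ‖f (pt j - pt j') i‖ := by
      rw [h1, norm_mul, Real.norm_eq_abs, Real.norm_eq_abs, abs_of_pos (by positivity)]
      exact le_mul_of_one_le_right (by positivity) h2
    have h4 := (h3.trans (norm_le_pi_norm _ i)).trans (hfA _)
    have h5 : 2 * R ≤ ‖pt j - pt j'‖ := by
      refine le_of_mul_le_mul_left ?_ hA
      linarith
    linarith
  have hinj : Function.Injective pt := by
    intro j j' h
    by_contra hne
    have := hsep j j' hne
    rw [h, sub_self, norm_zero] at this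
    linarith
  refine ⟨Finset.univ.image pt, ?_, ?_, ?_⟩
  · intro x hx
    obtain ⟨j, -, rfl⟩ := Finset.mem_image.1 hx
    refine (hfB _).trans ?_
    have h1 : ‖fun i => 2 * A * R * ((j i : ℕ) : ℝ)‖ ≤ 2 * A * R * (ρ / (2 * A * B) / R) := by
      refine (pi_norm_le_iff_of_nonneg (by positivity)).2 fun i => ?_
      rw [Real.norm_of_nonneg (by positivity)]
      refine mul_le_mul_of_nonneg_left ?_ (by positivity)
      have h2 : (j i : ℕ) ≤ ⌊ρ / (2 * A * B) / R⌋₊ := Nat.lt_succ_iff.1 (j i).2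
      exact (Nat.cast_le.2 h2).trans (Nat.floor_le (by positivity))
    calc _ ≤ B * (2 * A * R * (ρ / (2 * A * B) / R)) := mul_le_mul_of_nonneg_left h1 hB.le
      _ = ρ := by field_simp
  · intro x hx y hy hxy
    obtain ⟨j, -, rfl⟩ := Finset.mem_image.1 hx
    obtain ⟨j', -, rfl⟩ := Finset.mem_image.1 hy
    exact hsep j j' fun h => hxy (by rw [h])
  · rw [Finset.card_image_of_injective _ hinj, Finset.card_univ, Fintype.card_fun,
      Fintype.card_fin, Fintype.card_fin, Nat.cast_pow, ← mul_pow]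
    refine pow_le_pow_left₀ (by positivity) ?_ d
    rw [← div_le_iff₀ hR]
    exact (Nat.lt_floor_add_one _).le.trans (by simp [n])

/-- Packing bound for a left invariant measure: if a compact set `K` contains the disjoint
translates of `B` by `P`, then `P.card * μ B ≤ μ K`. -/
theorem card_mul_measure_le {G : Type*} [Group G] [MeasurableSpace G] [TopologicalSpace G]
    [IsTopologicalGroup G] [BorelSpace G] (μ : Measure G) [μ.IsMulLeftInvariant] {B K : Set G}
    (hB : MeasurableSet B) {ι : Type*} (P : Finset ι) (g : ι → G)
    (hdisj : ∀ i ∈ P, ∀ j ∈ P, i ≠ j → ∀ a ∈ B, ∀ b ∈ B, g i * a ≠ g j * b)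
    (hK : ∀ i ∈ P, ∀ a ∈ B, g i * a ∈ K) : P.card * μ B ≤ μ K := by
  have hmeas : ∀ i, MeasurableSet ((fun x => (g i)⁻¹ * x) ⁻¹' B) := fun i =>
    (measurable_const_mul (g i)⁻¹) hB
  have h := measure_biUnion_finset (μ := μ) (s := P) (f := fun i => (fun x => (g i)⁻¹ * x) ⁻¹' B)
    (fun i hi j hj hij => Set.disjoint_left.2 fun x hxi hxj =>
      hdisj i hi j hj hij _ hxi _ hxj (by simp)) (fun i _ => hmeas i)
  simp only [measure_preimage_mul, Finset.sum_const, nsmul_eq_mul] at h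
  rw [← h]
  refine measure_mono (Set.iUnion₂_subset fun i hi x hx => ?_)
  have := hK i hi _ hx
  rwa [mul_inv_cancel_left] at this

/-! ### A bound for two zeros -/

section TwoPoint

variable {F : Type*} [RCLike F]

/-- A function `x P + y Q + σ` on a curve tangent to the line `x = 1`, with `σ` small compared with
`P` and `Q`: two points at which it is at most `ρ` in absolute value are close to each other. Either
`Q` dominates, and then so does the variation of `y`, or `P` dominates, and then the function is
bounded below. -/
theorem two_point_estimate {P Q σ x y x' y' : F} {ρ l : ℝ} (hl : l ≤ max ‖P‖ ‖Q‖)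
    (hx : ‖x - 1‖ ≤ 1 / 4) (hy : ‖y‖ ≤ 1 / 2) (hy' : ‖y'‖ ≤ 1 / 2)
    (hxy : ‖x - x'‖ ≤ ‖y - y'‖ / 8) (hσ : ‖σ‖ ≤ l / 4)
    (hf : ‖x * P + y * Q + σ‖ ≤ ρ) (hf' : ‖x' * P + y' * Q + σ‖ ≤ ρ) :
    l * ‖y - y'‖ ≤ 16 * ρ := by
  have hP := norm_nonneg P
  have hQ := norm_nonneg Q
  have hyy := norm_nonneg (y - y')
  rcases le_or_gt ‖P‖ (4 * ‖Q‖) with h | h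
  · have h1 : (y - y') * Q = (x * P + y * Q + σ) - (x' * P + y' * Q + σ) - (x - x') * P := by ring
    have h2 : ‖y - y'‖ * ‖Q‖ ≤ ρ + ρ + ‖x - x'‖ * ‖P‖ := by
      rw [← norm_mul, h1, ← norm_mul]
      exact (norm_sub_le _ _).trans
        (add_le_add_left ((norm_sub_le _ _).trans (add_le_add hf hf')) _)
    have h3 : ‖x - x'‖ * ‖P‖ ≤ ‖y - y'‖ / 8 * (4 * ‖Q‖) := by gcongr
    have h4 : l ≤ 4 * ‖Q‖ := hl.trans (max_le h (by linarith))
    have h5 : l * ‖y - y'‖ ≤ 4 * ‖Q‖ * ‖y - y'‖ := by gcongr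
    linarith
  · have h4 : l ≤ ‖P‖ := hl.trans (max_le le_rfl (by linarith))
    have h1 : P = (x * P + y * Q + σ) - ((x - 1) * P + y * Q + σ) := by ring
    have h2 : ‖P‖ ≤ ρ + (1 / 4 * ‖P‖ + 1 / 2 * ‖Q‖ + l / 4) := by
      conv_lhs => rw [h1]
      refine (norm_sub_le _ _).trans (add_le_add hf ((norm_add₃_le).trans ?_))
      rw [norm_mul, norm_mul]
      gcongr
    have h3 : ‖y - y'‖ ≤ 1 := (norm_sub_le _ _).trans (by linarith)
    have h5 : l * ‖y - y'‖ ≤ ‖P‖ * 1 := by gcongr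
    linarith

end TwoPoint

/-! ### The Cayley parametrization near the identity -/

namespace ConjCoords

variable {F E : Type*} [RCLike F] [CommRing E] [Algebra F E] {ι : E ≃ₐ[F] E} (κ : ConjCoords ι)

/-- The domain of the Cayley parametrization. -/
abbrev Dom : Type _ := {s : F // 1 - κ.disc * s ^ 2 ≠ 0}

/-- A radius on which the Cayley parametrization is close to `s ↦ 1 + 2 s δ`. -/
structure IsSmall (R : ℝ) : Prop where
  pos : 0 < R
  le : R ≤ 1 / 64
  disc_le : ‖κ.disc‖ * R ≤ 1 / 64

theorem exists_isSmall : ∃ R, κ.IsSmall R := by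
  have h := norm_nonneg κ.disc
  refine ⟨1 / (64 * (‖κ.disc‖ + 1)), by positivity, ?_, ?_⟩
  · exact one_div_le_one_div_of_le (by norm_num) (by linarith)
  · rw [mul_one_div, div_le_div_iff₀ (by positivity) (by norm_num)]
    linarith

variable {κ} {R : ℝ} (hR : κ.IsSmall R)

include hR

theorem IsSmall.disc_mul_le {s : F} (hs : ‖s‖ ≤ R) : ‖κ.disc * s‖ ≤ 1 / 64 := by
  rw [norm_mul]
  exact (mul_le_mul_of_nonneg_left hs (norm_nonneg _)).trans hR.disc_le

theorem IsSmall.disc_mul_mul_le {s s' : F} (hs : ‖s‖ ≤ R) (hs' : ‖s'‖ ≤ R) :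
    ‖κ.disc * (s * s')‖ ≤ 1 / 64 := by
  rw [← mul_assoc, norm_mul]
  have h1 := hR.disc_mul_le hs
  have h2 : ‖s'‖ ≤ 1 := (hs'.trans hR.le).trans (by norm_num)
  nlinarith [norm_nonneg (κ.disc * s), norm_nonneg s']

theorem IsSmall.le_norm_one_sub {s s' : F} (hs : ‖s‖ ≤ R) (hs' : ‖s'‖ ≤ R) :
    63 / 64 ≤ ‖1 - κ.disc * (s * s')‖ := by
  have h1 := hR.disc_mul_mul_le hs hs'
  have h2 := norm_sub_norm_le (1 : F) (κ.disc * (s * s'))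
  rw [norm_one] at h2
  linarith

theorem IsSmall.norm_one_sub_le {s s' : F} (hs : ‖s‖ ≤ R) (hs' : ‖s'‖ ≤ R) :
    ‖1 - κ.disc * (s * s')‖ ≤ 65 / 64 := by
  have h1 := hR.disc_mul_mul_le hs hs'
  have h2 := norm_sub_le (1 : F) (κ.disc * (s * s'))
  rw [norm_one] at h2
  linarith

theorem IsSmall.le_norm_one_add {s s' : F} (hs : ‖s‖ ≤ R) (hs' : ‖s'‖ ≤ R) :
    63 / 64 ≤ ‖1 + κ.disc * (s * s')‖ := by
  have h := hR.le_norm_one_sub hs (s' := -s') (by rwa [norm_neg])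
  rwa [mul_neg, mul_neg, sub_neg_eq_add] at h

theorem IsSmall.one_sub_ne_zero' {s s' : F} (hs : ‖s‖ ≤ R) (hs' : ‖s'‖ ≤ R) :
    1 - κ.disc * (s * s') ≠ 0 := by
  intro h
  have := hR.le_norm_one_sub hs hs'
  rw [h, norm_zero] at this
  norm_num at this

theorem IsSmall.one_sub_ne_zero {s : F} (hs : ‖s‖ ≤ R) : 1 - κ.disc * s ^ 2 ≠ 0 := by
  rw [sq]
  exact hR.one_sub_ne_zero' hs hs

theorem IsSmall.norm_re_cayley_sub_one_le {s : F} (hs : ‖s‖ ≤ R) :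
    ‖κ.re (κ.cayley s) - 1‖ ≤ 1 / 4 := by
  have h0 := hR.one_sub_ne_zero hs
  have h1 : κ.re (κ.cayley s) - 1 = 2 * (κ.disc * (s * s)) / (1 - κ.disc * (s * s)) := by
    rw [re_cayley, ← sq]
    field_simp
    ring
  have h2 := hR.disc_mul_mul_le hs hs
  have h3 := hR.le_norm_one_sub hs hs
  rw [h1, norm_div, norm_mul, RCLike.norm_ofNat, div_le_iff₀ (by linarith)]
  linarith

theorem IsSmall.norm_im_cayley_le {s : F} (hs : ‖s‖ ≤ R) : ‖κ.im (κ.cayley s)‖ ≤ 1 / 2 := by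
  have h2 := hs.trans hR.le
  have h3 := hR.le_norm_one_sub hs hs
  rw [im_cayley, sq, norm_div, norm_mul, RCLike.norm_ofNat, div_le_iff₀ (by linarith)]
  linarith

theorem IsSmall.norm_re_cayley_sub_le {s s' : F} (hs : ‖s‖ ≤ R) (hs' : ‖s'‖ ≤ R) :
    ‖κ.re (κ.cayley s) - κ.re (κ.cayley s')‖
      ≤ ‖κ.im (κ.cayley s) - κ.im (κ.cayley s')‖ / 8 := by
  have h0 := hR.one_sub_ne_zero hs
  have h0' := hR.one_sub_ne_zero hs'
  have h1 : (κ.re (κ.cayley s) - κ.re (κ.cayley s')) * (1 + κ.disc * (s * s'))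
      = (κ.im (κ.cayley s) - κ.im (κ.cayley s')) * (κ.disc * s + κ.disc * s') := by
    rw [re_cayley, re_cayley, im_cayley, im_cayley]
    field_simp
    ring
  have h2 := congrArg norm h1
  rw [norm_mul, norm_mul] at h2
  have h3 := hR.le_norm_one_add hs hs'
  have h4 : ‖κ.disc * s + κ.disc * s'‖ ≤ 1 / 64 + 1 / 64 :=
    (norm_add_le _ _).trans (add_le_add (hR.disc_mul_le hs) (hR.disc_mul_le hs'))
  nlinarith [norm_nonneg (κ.re (κ.cayley s) - κ.re (κ.cayley s')),
    norm_nonneg (κ.im (κ.cayley s) - κ.im (κ.cayley s'))]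

theorem IsSmall.norm_sub_le {s s' : F} (hs : ‖s‖ ≤ R) (hs' : ‖s'‖ ≤ R) :
    ‖s - s'‖ ≤ ‖κ.im (κ.cayley s) - κ.im (κ.cayley s')‖ := by
  have h0 := hR.one_sub_ne_zero hs
  have h0' := hR.one_sub_ne_zero hs'
  have h1 : (κ.im (κ.cayley s) - κ.im (κ.cayley s'))
      * ((1 - κ.disc * (s * s)) * (1 - κ.disc * (s' * s')))
      = 2 * ((s - s') * (1 + κ.disc * (s * s'))) := by
    rw [im_cayley, im_cayley, ← sq, ← sq, div_sub_div _ _ h0 h0',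
      div_mul_cancel₀ _ (mul_ne_zero h0 h0')]
    ring
  have h2 := congrArg norm h1
  rw [norm_mul, norm_mul, norm_mul, norm_mul, RCLike.norm_ofNat] at h2
  have h3 := hR.le_norm_one_add hs hs'
  have h4 : ‖1 - κ.disc * (s * s)‖ * ‖1 - κ.disc * (s' * s')‖ ≤ 65 / 64 * (65 / 64) :=
    mul_le_mul (hR.norm_one_sub_le hs hs) (hR.norm_one_sub_le hs' hs') (norm_nonneg _)
      (by norm_num)
  nlinarith [norm_nonneg (s - s'), norm_nonneg (κ.im (κ.cayley s) - κ.im (κ.cayley s'))]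

/-- The parameter of a quotient of two values of the Cayley parametrization. -/
theorem IsSmall.norm_div_le {s s' : F} (hs : ‖s‖ ≤ R) (hs' : ‖s'‖ ≤ R) :
    ‖(s - s') / (1 - κ.disc * (s * s'))‖ ≤ 2 * ‖s - s'‖ := by
  have h3 := hR.le_norm_one_sub hs hs'
  rw [norm_div, div_le_iff₀ (by linarith)]
  nlinarith [norm_nonneg (s - s')]

theorem IsSmall.div_mem {s s' : F} (hs : ‖s‖ ≤ R) (hs' : ‖s'‖ ≤ R) :
    1 - κ.disc * ((s - s') / (1 - κ.disc * (s * s'))) ^ 2 ≠ 0 := by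
  have h0 := hR.one_sub_ne_zero hs
  have h0' := hR.one_sub_ne_zero hs'
  have h := hR.one_sub_ne_zero' hs hs'
  obtain ⟨w, hw⟩ : ∃ w, w = 1 - κ.disc * (s * s') := ⟨_, rfl⟩
  rw [← hw] at h ⊢
  have h1 : 1 - κ.disc * ((s - s') / w) ^ 2
      = (1 - κ.disc * s ^ 2) * (1 - κ.disc * s' ^ 2) / w ^ 2 := by
    field_simp
    rw [hw]
    ring
  rw [h1]
  exact div_ne_zero (mul_ne_zero h0 h0') (pow_ne_zero 2 h)

end ConjCoords

namespace UnitaryGGP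

section

variable {F E V : Type*} [RCLike F] [CommRing E] [Algebra F E]
  [NormedAddCommGroup V] [NormedSpace F V] [FiniteDimensional F V]
  [Module E V] [IsScalarTower F E V]
  {D : UnitaryGGP F E V} (κ : ConjCoords D.ι) [FiniteDimensional F E]

/-- The Cayley parametrization of the center of `H`. -/
noncomputable def cayH (s : κ.Dom) : D.ZH := D.centerH (κ.cayley s.val) (κ.cayley_mul_conj s.2)

theorem continuous_cayH : Continuous (cayH κ) := by
  have hE : ∀ a : E, (toCLM (scaleOn D.perpProj a) : V →L[F] V)
      = 1 + (κ.re a - 1) • toCLM D.perpProj + κ.im a • toCLM (κ.δ • D.perpProj) := by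
    intro a
    ext v
    change v + (a - 1) • D.perpProj v
      = v + (κ.re a - 1) • D.perpProj v + κ.im a • (κ.δ • D.perpProj v)
    rw [κ.smul_eq (a - 1), map_sub, map_sub, κ.re_one, κ.im_one, sub_zero, add_assoc]
  have hden : ∀ s : κ.Dom, 1 - κ.disc * s.val ^ 2 ≠ 0 := fun s => s.2
  have hre : Continuous fun s : κ.Dom => κ.re (κ.cayley s.val) := by
    simp only [κ.re_cayley]
    exact Continuous.div (by fun_prop) (by fun_prop) hden
  have him : Continuous fun s : κ.Dom => κ.im (κ.cayley s.val) := by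
    simp only [κ.im_cayley]
    exact Continuous.div (by fun_prop) (by fun_prop) hden
  refine Continuous.subtype_mk (Continuous.subtype_mk (Continuous.subtype_mk
    (Units.continuous_iff.2 ⟨?_, ?_⟩) _) _) _
  · change Continuous fun s : κ.Dom => (toCLM (scaleOn D.perpProj (κ.cayley s.val)) : V →L[F] V)
    simp only [hE]
    fun_prop
  · change Continuous fun s : κ.Dom =>
      (toCLM (scaleOn D.perpProj (D.ι (κ.cayley s.val))) : V →L[F] V)
    simp only [hE, κ.re_conj, κ.im_conj]
    fun_prop

/-- The image of the ball of radius `R` under the Cayley parametrization. -/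
def cayBall (R : ℝ) : Set D.ZH := cayH κ '' {s | ‖s.val‖ ≤ R}

variable {κ} {R : ℝ} (hR : κ.IsSmall R)

include hR

theorem isCompact_cayBall {r : ℝ} (hr : r ≤ R) : IsCompact (cayBall κ r) := by
  refine IsCompact.image ?_ (continuous_cayH κ)
  rw [Subtype.isCompact_iff]
  have h : (Subtype.val '' {s : κ.Dom | ‖s.val‖ ≤ r}) = Metric.closedBall (0 : F) r := by
    ext s
    simp only [Set.mem_image, mem_closedBall_zero_iff]
    exact ⟨fun ⟨s', hs', h⟩ => h ▸ hs', fun h => ⟨⟨s, hR.one_sub_ne_zero (h.trans hr)⟩, h, rfl⟩⟩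
  rw [h]
  exact isCompact_closedBall 0 r

theorem cayH_mul_inv {s s' : κ.Dom} (hs : ‖s.val‖ ≤ R) (hs' : ‖s'.val‖ ≤ R) :
    cayH κ s * (cayH κ s')⁻¹
      = cayH κ ⟨(s.val - s'.val) / (1 - κ.disc * (s.val * s'.val)), hR.div_mem hs hs'⟩ := by
  refine D.ZH_ext fun v => ?_
  change scaleOn D.perpProj (κ.cayley s.val) (scaleOn D.perpProj (D.ι (κ.cayley s'.val)) v)
    = scaleOn D.perpProj (κ.cayley _) v
  rw [scaleOn_scaleOn D.perpProj_perpProj, κ.conj_cayley,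
    κ.cayley_mul_cayley_neg_eq s.2 s'.2 (hR.one_sub_ne_zero' hs hs')]

omit hR in
theorem cayH_injective {v₀ : V} (hv₀ : IsUnit (D.form v₀ v₀)) (hv₀e : D.form v₀ D.e = 0) :
    Function.Injective (cayH κ) := by
  have := κ.nontrivial
  intro s s' h
  have hne : v₀ ≠ 0 := by
    rintro rfl
    rw [map_zero] at hv₀
    exact hv₀.ne_zero rfl
  have h1 : scaleOn D.perpProj (κ.cayley s.val) v₀ = scaleOn D.perpProj (κ.cayley s'.val) v₀ :=
    congrArg (fun z : D.ZH => z.val.val.val.val v₀) h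
  rw [scaleOn_of_eq (D.perpProj_of_form_eq_zero hv₀e),
    scaleOn_of_eq (D.perpProj_of_form_eq_zero hv₀e)] at h1
  exact Subtype.ext (κ.cayley_smul_injective hne s.2 s'.2 h1)

theorem cayBall_mem_nhds {v₀ : V} (hv₀ : IsUnit (D.form v₀ v₀)) (hv₀e : D.form v₀ D.e = 0) :
    cayBall κ R ∈ 𝓝 (1 : D.ZH) := by
  have := κ.nontrivial
  set r : F := κ.re (D.form v₀ v₀) with hr
  have hform : D.form v₀ v₀ = algebraMap F E r := D.form_self κ v₀
  have hr0 : r ≠ 0 := by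
    intro h
    rw [hform, h, map_zero] at hv₀
    exact hv₀.ne_zero rfl
  have hval : Continuous fun z : D.ZH => z.val.val.val.val v₀ := by
    have h1 : Continuous fun z : D.ZH => z.val.val.val.val :=
      Units.continuous_val.comp (continuous_subtype_val.comp
        (continuous_subtype_val.comp continuous_subtype_val))
    exact h1.clm_apply continuous_const
  have hX : Continuous fun z : D.ZH => κ.re (D.form (z.val.val.val.val v₀) v₀) / r :=
    ((LinearMap.continuous_of_finiteDimensional ((D.reForm κ).flip v₀)).comp hval).div_const r
  have hY : Continuous fun z : D.ZH => κ.im (D.form (z.val.val.val.val v₀) v₀) / r :=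
    ((LinearMap.continuous_of_finiteDimensional ((D.imForm κ).flip v₀)).comp hval).div_const r
  set X : D.ZH → F := fun z => κ.re (D.form (z.val.val.val.val v₀) v₀) / r with hXdef
  set Y : D.ZH → F := fun z => κ.im (D.form (z.val.val.val.val v₀) v₀) / r with hYdef
  have hX1 : X 1 = 1 := by
    change κ.re (D.form v₀ v₀) / r = 1
    rw [← hr, div_self hr0]
  have hY1 : Y 1 = 0 := by
    change κ.im (D.form v₀ v₀) / r = 0
    rw [hform, κ.im_algebraMap, zero_div]
  have hne : (1 : F) + X 1 ≠ 0 := by rw [hX1]; norm_num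
  have h1 : ∀ᶠ z in 𝓝 (1 : D.ZH), 1 + X z ≠ 0 :=
    (continuous_const.add hX).continuousAt.eventually_ne hne
  have hq : ContinuousAt (fun z => ‖Y z / (1 + X z)‖) (1 : D.ZH) :=
    (hY.continuousAt.div (continuous_const.add hX).continuousAt hne).norm
  have h2 : ∀ᶠ z in 𝓝 (1 : D.ZH), ‖Y z / (1 + X z)‖ < R := by
    refine hq.eventually_lt continuousAt_const ?_
    rw [hY1, zero_div, norm_zero]
    exact hR.pos
  filter_upwards [h1, h2] with z hz1 hz2
  obtain ⟨t, ht, htz⟩ := D.exists_scalar_of_mem_center_H κ hv₀ hv₀e z.2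
  have hzv : z.val.val.val.val v₀ = t • v₀ := by
    rw [htz, scaleOn_of_eq (D.perpProj_of_form_eq_zero hv₀e)]
  have hXz : X z = κ.re t := by
    simp only [hXdef]
    rw [hzv, form_smul_left, hform, κ.re_mul, κ.re_algebraMap, κ.im_algebraMap]
    field_simp
    ring
  have hYz : Y z = κ.im t := by
    simp only [hYdef]
    rw [hzv, form_smul_left, hform, κ.im_mul, κ.re_algebraMap, κ.im_algebraMap]
    field_simp
    ring
  rw [hXz] at hz1
  rw [hXz, hYz] at hz2
  obtain ⟨h3, -⟩ := κ.eq_cayley ht hz1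
  refine ⟨⟨_, hR.one_sub_ne_zero hz2.le⟩, hz2.le, D.ZH_ext fun v => ?_⟩
  rw [htz v]
  change scaleOn D.perpProj (κ.cayley _) v = _
  rw [← h3]

open scoped Pointwise in
/-- The Haar measure of the ball of radius `r` in the center of `H` is `O (r ^ [F : ℝ])`: its
translates by the values of the parametrization at `6 r`-separated points are disjoint, and they lie
in a fixed compact set. -/
theorem measure_cayBall_le [MeasurableSpace D.ZH] [BorelSpace D.ZH] (μ : Measure D.ZH)
    [μ.IsHaarMeasure] {v₀ : V} (hv₀ : IsUnit (D.form v₀ v₀)) (hv₀e : D.form v₀ D.e = 0) :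
    ∃ C : ℝ, 0 ≤ C ∧ ∀ r, 0 < r → r ≤ R →
      μ (cayBall κ r) ≤ ENNReal.ofReal (C * r ^ Module.finrank ℝ F) := by
  obtain ⟨c, hc, hP⟩ := exists_separated_finset F hR.pos
  have hK : IsCompact (cayBall κ R * cayBall κ R) :=
    (isCompact_cayBall hR le_rfl).mul (isCompact_cayBall hR le_rfl)
  set m := (μ (cayBall κ R * cayBall κ R)).toReal with hm
  have hμ : μ (cayBall κ R * cayBall κ R) = ENNReal.ofReal m :=
    (ENNReal.ofReal_toReal hK.measure_lt_top.ne).symm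
  have hm0 : 0 ≤ m := ENNReal.toReal_nonneg
  refine ⟨m * 6 ^ Module.finrank ℝ F / c, by positivity, fun r hr hrR => ?_⟩
  obtain ⟨P, hPR, hPsep, hPcard⟩ := hP (6 * r) (by positivity)
  have hB : MeasurableSet (cayBall κ r) := (isCompact_cayBall hR hrR).measurableSet
  have hle : (P.card : ℝ≥0∞) * μ (cayBall κ r) ≤ μ (cayBall κ R * cayBall κ R) := by
    have h := card_mul_measure_le μ hB (K := cayBall κ R * cayBall κ R) P.attach
      (fun s => cayH κ ⟨s.val, hR.one_sub_ne_zero (hPR s.val s.2)⟩) ?_ ?_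
    · rwa [Finset.card_attach] at h
    · rintro ⟨s, hs⟩ - ⟨s', hs'⟩ - hne a ⟨α, hα, rfl⟩ b ⟨β, hβ, rfl⟩ heq
      have hsR := hPR s hs
      have hsR' := hPR s' hs'
      have hαR : ‖α.val‖ ≤ R := le_trans hα hrR
      have hβR : ‖β.val‖ ≤ R := le_trans hβ hrR
      have h1 : cayH κ ⟨s, hR.one_sub_ne_zero hsR⟩ * (cayH κ ⟨s', hR.one_sub_ne_zero hsR'⟩)⁻¹
          = cayH κ β * (cayH κ α)⁻¹ := by
        have hcomm : ∀ a b : D.ZH, a * b = b * a := fun a b =>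
          Subtype.ext (Subgroup.mem_center_iff.1 b.2 a.val)
        rw [mul_inv_eq_iff_eq_mul, hcomm (cayH κ β * (cayH κ α)⁻¹), ← mul_assoc,
          eq_mul_inv_iff_mul_eq, heq]
      rw [cayH_mul_inv hR (s := ⟨s, _⟩) (s' := ⟨s', _⟩) hsR hsR', cayH_mul_inv hR hβR hαR] at h1
      have h2 : (s - s') / (1 - κ.disc * (s * s'))
          = (β.val - α.val) / (1 - κ.disc * (β.val * α.val)) :=
        congrArg Subtype.val (cayH_injective hv₀ hv₀e h1)
      have h3 : s - s' = (β.val - α.val) / (1 - κ.disc * (β.val * α.val))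
          * (1 - κ.disc * (s * s')) := by
        rw [← h2, div_mul_cancel₀ _ (hR.one_sub_ne_zero' hsR hsR')]
      have h4 : ‖s - s'‖ ≤ 2 * (r + r) * (65 / 64) := by
        rw [h3, norm_mul]
        refine mul_le_mul ((hR.norm_div_le hβR hαR).trans ?_) (hR.norm_one_sub_le hsR hsR')
          (norm_nonneg _) (by positivity)
        gcongr
        exact (_root_.norm_sub_le _ _).trans (add_le_add hβ hα)
      have h5 := hPsep s hs s' hs' (fun h => hne (Subtype.ext h))
      linarith
    · rintro ⟨s, hs⟩ - a ⟨α, hα, rfl⟩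
      exact Set.mul_mem_mul ⟨_, hPR s hs, rfl⟩ ⟨α, le_trans hα hrR, rfl⟩
  have hcard : 0 < (P.card : ℝ) := by
    by_contra h
    have h0 : (P.card : ℝ) = 0 := le_antisymm (not_lt.1 h) (Nat.cast_nonneg _)
    rw [h0, zero_mul] at hPcard
    linarith
  rw [hμ] at hle
  have h1 : μ (cayBall κ r) ≤ ENNReal.ofReal (m / P.card) := by
    rw [ENNReal.ofReal_div_of_pos hcard, ENNReal.ofReal_natCast,
      ENNReal.le_div_iff_mul_le (Or.inl (by exact_mod_cast hcard.ne'))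
        (Or.inl (ENNReal.natCast_ne_top _)), mul_comm]
    exact hle
  refine h1.trans (ENNReal.ofReal_le_ofReal ?_)
  rw [div_le_iff₀ hcard, mul_assoc, div_mul_eq_mul_div, le_div_iff₀ hc]
  calc m * c ≤ m * (P.card * (6 * r) ^ Module.finrank ℝ F) := by gcongr
    _ = _ := by rw [mul_pow]; ring

end

end UnitaryGGP

/-! ### Comparison of norms -/

theorem inv_norm_smul_mem_sphere {F W : Type*} [RCLike F] [NormedAddCommGroup W] [NormedSpace F W]
    {w : W} (hw : w ≠ 0) :
    (((‖w‖⁻¹ : ℝ) : F)) • w ∈ Metric.sphere (0 : W) 1 := by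
  rw [mem_sphere_zero_iff_norm, norm_smul, RCLike.norm_ofReal, abs_of_nonneg (by positivity),
    inv_mul_cancel₀ (norm_ne_zero_iff.2 hw)]

namespace IsFNorm

variable {F W : Type*} [RCLike F] [NormedAddCommGroup W] [NormedSpace F W] [FiniteDimensional F W]
  {N : W → ℝ}

theorem map_zero (hN : IsFNorm F N) : N 0 = 0 := by
  have h := hN.smul 0 0
  rwa [smul_zero, norm_zero, zero_pow (Module.finrank_pos (R := ℝ) (M := F)).ne', zero_mul] at h

theorem eq_norm_pow_mul (hN : IsFNorm F N) (w : W) :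
    N w = ‖w‖ ^ Module.finrank ℝ F * N ((((‖w‖⁻¹ : ℝ) : F)) • w) := by
  rcases eq_or_ne w 0 with rfl | hw
  · rw [smul_zero, hN.map_zero, mul_zero]
  · have hw' := norm_ne_zero_iff.2 hw
    rw [hN.smul, RCLike.norm_ofReal, abs_of_nonneg (by positivity), ← mul_assoc, ← mul_pow,
      mul_inv_cancel₀ hw', one_pow, one_mul]

theorem exists_le (hN : IsFNorm F N) :
    ∃ C : ℝ, 0 < C ∧ ∀ w, N w ≤ C * ‖w‖ ^ Module.finrank ℝ F := by
  have := FiniteDimensional.proper_rclike F W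
  obtain ⟨C, hC⟩ := (isCompact_sphere (0 : W) 1).exists_bound_of_continuousOn
    hN.continuous.continuousOn
  refine ⟨max C 1, by positivity, fun w => ?_⟩
  rcases eq_or_ne w 0 with rfl | hw
  · rw [hN.map_zero]; positivity
  · rw [hN.eq_norm_pow_mul w, mul_comm]
    have h1 := (le_abs_self _).trans (hC _ (inv_norm_smul_mem_sphere (F := F) hw))
    gcongr
    exact h1.trans (le_max_left _ _)

theorem exists_ge (hN : IsFNorm F N) :
    ∃ c : ℝ, 0 < c ∧ ∀ w, c * ‖w‖ ^ Module.finrank ℝ F ≤ N w := by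
  have := FiniteDimensional.proper_rclike F W
  obtain ⟨c, hc, hmin⟩ := (isCompact_sphere (0 : W) 1).exists_forall_le' (a := 0)
    hN.continuous.continuousOn (fun w hw => (hN.nonneg w).lt_of_ne' fun h => by
      rw [hN.eq_zero w h, mem_sphere_zero_iff_norm, norm_zero] at hw
      exact zero_ne_one hw)
  refine ⟨c, hc, fun w => ?_⟩
  rcases eq_or_ne w 0 with rfl | hw
  · rw [hN.map_zero, norm_zero, zero_pow (Module.finrank_pos (R := ℝ) (M := F)).ne', mul_zero]
  · rw [hN.eq_norm_pow_mul w, mul_comm]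
    exact mul_le_mul_of_nonneg_left (hmin _ (inv_norm_smul_mem_sphere (F := F) hw)) (by positivity)

end IsFNorm

/-! ### Powers of operators -/

section Powers

variable {F V : Type*} [RCLike F] [NormedAddCommGroup V] [NormedSpace F V]

theorem norm_pow_apply_le {A : V →L[F] V} {B : ℝ} (hA : ‖A‖ ≤ B) (k : ℕ) (v : V) :
    ‖(A ^ k) v‖ ≤ B ^ k * ‖v‖ := by
  have hB : 0 ≤ B := (norm_nonneg A).trans hA
  induction k with
  | zero => simp
  | succ k ih =>
    rw [pow_succ']
    change ‖A ((A ^ k) v)‖ ≤ _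
    calc _ ≤ ‖A‖ * ‖(A ^ k) v‖ := A.le_opNorm _
      _ ≤ B * (B ^ k * ‖v‖) := by gcongr
      _ = _ := by ring

theorem norm_pow_apply_sub_le {A A' : V →L[F] V} {B : ℝ} (hA : ‖A‖ ≤ B) (hA' : ‖A'‖ ≤ B)
    (hB : 1 ≤ B) (k : ℕ) (v : V) :
    ‖(A ^ k) v - (A' ^ k) v‖ ≤ k * B ^ k * ‖A - A'‖ * ‖v‖ := by
  induction k with
  | zero => simp
  | succ k ih =>
    have h1 : (A ^ (k + 1)) v - (A' ^ (k + 1)) v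
        = A ((A ^ k) v - (A' ^ k) v) + (A - A') ((A' ^ k) v) := by
      rw [pow_succ', pow_succ', map_sub]
      change A ((A ^ k) v) - A' ((A' ^ k) v)
        = A ((A ^ k) v) - A ((A' ^ k) v) + (A ((A' ^ k) v) - A' ((A' ^ k) v))
      abel
    have h2 := norm_pow_apply_le hA' k v
    have h0 : (0 : ℝ) ≤ B := zero_le_one.trans hB
    rw [h1]
    calc _ ≤ ‖A‖ * ‖(A ^ k) v - (A' ^ k) v‖ + ‖A - A'‖ * ‖(A' ^ k) v‖ :=
          (norm_add_le _ _).trans (add_le_add (A.le_opNorm _) ((A - A').le_opNorm _))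
      _ ≤ B * (k * B ^ k * ‖A - A'‖ * ‖v‖) + ‖A - A'‖ * (B ^ k * ‖v‖) := by gcongr
      _ ≤ B * (k * B ^ k * ‖A - A'‖ * ‖v‖) + B * (‖A - A'‖ * (B ^ k * ‖v‖)) := by
          exact add_le_add le_rfl (le_mul_of_one_le_left (by positivity) hB)
      _ = _ := by push_cast; ring

end Powers

/-! ### The moments on the center -/

namespace ConjCoords

variable {F E : Type*} [RCLike F] [CommRing E] [Algebra F E] {ι : E ≃ₐ[F] E} {κ : ConjCoords ι}

/-- The dependence of the moments on the center: two elements of the center at which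
`σ + t a ± ι (t a)` is small are close, if `σ` is small compared with `a`. -/
theorem IsSmall.two_cayley_estimate {R : ℝ} (hR : κ.IsSmall R) {s s' : F} (hs : ‖s‖ ≤ R)
    (hs' : ‖s'‖ ≤ R) {a σ : E} {l ρ : ℝ} (hl0 : 0 ≤ l) (hl : l ≤ max ‖κ.re a‖ ‖κ.im a‖)
    (hσre : ‖κ.re σ‖ ≤ min 1 ‖κ.disc‖ * l / 4) (hσim : ‖κ.im σ‖ ≤ min 1 ‖κ.disc‖ * l / 4) (k : ℕ)
    (hρ : ∀ r ∈ ({s, s'} : Set F),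
      ‖κ.re (σ + κ.cayley r * a + (-1) ^ k * ι (κ.cayley r * a))‖ ≤ ρ ∧
      ‖κ.im (σ + κ.cayley r * a + (-1) ^ k * ι (κ.cayley r * a))‖ ≤ ρ) :
    min 1 ‖κ.disc‖ * l * ‖s - s'‖ ≤ 16 * ρ := by
  set η := min 1 ‖κ.disc‖ with hη
  have hη0 : 0 ≤ η := le_min zero_le_one (norm_nonneg _)
  have hη1 : η ≤ 1 := min_le_left _ _
  have hη2 : η ≤ ‖κ.disc‖ := min_le_right _ _
  have hss := hR.norm_sub_le hs hs'
  refine (mul_le_mul_of_nonneg_left hss (by positivity)).trans ?_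
  have hpq : ∀ {P Q : ℝ}, η * ‖κ.re a‖ ≤ P → η * ‖κ.im a‖ ≤ Q → η * l ≤ max P Q := by
    intro P Q hP hQ
    refine (mul_le_mul_of_nonneg_left hl hη0).trans ?_
    rw [mul_max_of_nonneg _ _ hη0]
    exact max_le_max hP hQ
  have h1 := hρ s (by simp)
  have h2 := hρ s' (by simp)
  have hn := norm_nonneg (κ.re a)
  have hn' := norm_nonneg (κ.im a)
  -- for even `k` the real part depends on the center, for odd `k` the imaginary part
  rcases Nat.even_or_odd k with hk | hk
  · have key : ∀ r, κ.re (σ + κ.cayley r * a + (-1) ^ k * ι (κ.cayley r * a))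
        = κ.re (κ.cayley r) * (2 * κ.re a) + κ.im (κ.cayley r) * (2 * (κ.disc * κ.im a))
          + κ.re σ := by
      intro r
      rw [hk.neg_one_pow, one_mul, map_add, map_add, κ.re_conj, κ.re_mul]
      ring
    rw [key] at h1 h2
    refine two_point_estimate (hpq ?_ ?_) (hR.norm_re_cayley_sub_one_le hs)
      (hR.norm_im_cayley_le hs) (hR.norm_im_cayley_le hs') (hR.norm_re_cayley_sub_le hs hs') hσre
      h1.1 h2.1
    · rw [norm_mul, RCLike.norm_ofNat]
      nlinarith
    · rw [norm_mul, norm_mul, RCLike.norm_ofNat]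
      nlinarith [mul_le_mul_of_nonneg_right hη2 hn']
  · have key : ∀ r, κ.im (σ + κ.cayley r * a + (-1) ^ k * ι (κ.cayley r * a))
        = κ.re (κ.cayley r) * (2 * κ.im a) + κ.im (κ.cayley r) * (2 * κ.re a) + κ.im σ := by
      intro r
      rw [hk.neg_one_pow, neg_one_mul, map_add, map_add, map_neg, κ.im_conj, κ.im_mul]
      ring
    rw [key] at h1 h2
    refine two_point_estimate ((hpq ?_ ?_).trans_eq (max_comm _ _))
      (hR.norm_re_cayley_sub_one_le hs) (hR.norm_im_cayley_le hs) (hR.norm_im_cayley_le hs')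
      (hR.norm_re_cayley_sub_le hs hs') hσim h1.2 h2.2
    · rw [norm_mul, RCLike.norm_ofNat]
      nlinarith
    · rw [norm_mul, RCLike.norm_ofNat]
      nlinarith

end ConjCoords

namespace UnitaryGGP

section

variable {F E V : Type*} [RCLike F] [CommRing E] [Algebra F E]
  [NormedAddCommGroup V] [NormedSpace F V] [FiniteDimensional F V]
  [NormedSpace ℝ V] [IsScalarTower ℝ F V] [Module E V] [IsScalarTower F E V]
  {D : UnitaryGGP F E V} (κ : ConjCoords D.ι)

theorem exists_form_bound : ∃ C : ℝ, 0 < C ∧ ∀ v w : V,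
    ‖κ.re (D.form v w)‖ ≤ C * ‖v‖ * ‖w‖ ∧ ‖κ.im (D.form v w)‖ ≤ C * ‖v‖ * ‖w‖ := by
  set f := (D.reForm κ).toContinuousBilinearMap
  set g := (D.imForm κ).toContinuousBilinearMap
  refine ⟨max ‖f‖ ‖g‖ + 1, by positivity, fun v w => ⟨?_, ?_⟩⟩
  · refine (f.le_opNorm₂ v w).trans ?_
    gcongr
    linarith [le_max_left ‖f‖ ‖g‖]
  · refine (g.le_opNorm₂ v w).trans ?_
    gcongr
    linarith [le_max_right ‖f‖ ‖g‖]

theorem form_pow_apply (T : D.lie) (k : ℕ) (v w : V) :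
    D.form ((T.val ^ k) v) w = (-1) ^ k * D.form v ((T.val ^ k) w) := by
  induction k generalizing v with
  | zero => simp
  | succ k ih =>
    have h1 : (T.val ^ (k + 1)) v = (T.val ^ k) (T.val v) := by rw [pow_succ]; rfl
    have h2 : (T.val ^ (k + 1)) w = T.val ((T.val ^ k) w) := by rw [pow_succ']; rfl
    rw [h1, h2, ih, skew]
    ring

theorem Ad_pow_apply (g : D.G) (T : D.lie) (k : ℕ) (v : V) :
    ((D.Ad g T).val ^ k) v = g.val.val ((T.val ^ k) ((g⁻¹).val.val v)) := by
  induction k with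
  | zero => exact (D.apply_inv_self g v).symm
  | succ k ih =>
    have h1 : ((D.Ad g T).val ^ (k + 1)) v = (D.Ad g T).val (((D.Ad g T).val ^ k) v) := by
      rw [pow_succ']; rfl
    have h2 : (T.val ^ (k + 1)) ((g⁻¹).val.val v) = T.val ((T.val ^ k) ((g⁻¹).val.val v)) := by
      rw [pow_succ']; rfl
    rw [h1, h2, ih, Ad_apply, D.inv_apply_self]

/-- The moments of a conjugate. -/
theorem form_Ad_pow (g : D.G) (T : D.lie) (k : ℕ) (v w : V) :
    D.form (((D.Ad g T).val ^ k) v) w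
      = D.form ((T.val ^ k) ((g⁻¹).val.val v)) ((g⁻¹).val.val w) := by
  rw [Ad_pow_apply]
  conv_lhs => rw [← D.apply_inv_self g w]
  exact g.2.2 _ _

theorem linear_pow (T : D.lie) (k : ℕ) (a : E) (v : V) :
    (T.val ^ k) (a • v) = a • (T.val ^ k) v := by
  induction k with
  | zero => rfl
  | succ k ih =>
    rw [pow_succ']
    change T.val ((T.val ^ k) (a • v)) = a • T.val ((T.val ^ k) v)
    rw [ih, T.2.1]

/-- Uniform cyclicity: over a compact set of stable elements, every vector pairs nontrivially with
one of finitely many `T ^ k e`. -/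
theorem exists_moment_bound [Algebra.IsQuadraticExtension F E] [Algebra.Etale F E]
    {Ω : Set D.lie} (hΩ : IsCompact Ω) (hst : ∀ T ∈ Ω, D.traceEquiv κ T ∈ D.stable) :
    ∃ K : ℕ, ∃ c : ℝ, 0 < c ∧ ∀ T ∈ Ω, ∀ w : V, ∃ k < K,
      c * ‖w‖ ≤ max ‖κ.re (D.form ((T.val ^ k) D.e) w)‖ ‖κ.im (D.form ((T.val ^ k) D.e) w)‖ := by
  have := FiniteDimensional.proper_rclike F V
  let f : ℕ → D.lie × V → ℝ := fun k x =>
    max ‖κ.re (D.form ((x.1.val ^ k) D.e) x.2)‖ ‖κ.im (D.form ((x.1.val ^ k) D.e) x.2)‖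
  have hf : ∀ k, Continuous (f k) := by
    intro k
    have h1 : Continuous fun x : D.lie × V => (x.1.val ^ k) D.e :=
      ((continuous_subtype_val.comp continuous_fst).pow k).clm_apply continuous_const
    have h2 : ∀ B : LinearMap.BilinForm F V,
        Continuous fun x : D.lie × V => B ((x.1.val ^ k) D.e) x.2 := fun B =>
      (B.toContinuousBilinearMap.continuous.comp h1).clm_apply continuous_snd
    exact (h2 (D.reForm κ)).norm.max (h2 (D.imForm κ)).norm
  have hcomp : ∃ K : ℕ, ∃ c : ℝ, 0 < c ∧ ∀ x ∈ Ω ×ˢ Metric.sphere (0 : V) 1, ∃ k < K,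
      c ≤ f k x := by
    refine (hΩ.prod (isCompact_sphere (0 : V) 1)).induction_on
      (p := fun S => ∃ K : ℕ, ∃ c : ℝ, 0 < c ∧ ∀ x ∈ S, ∃ k < K, c ≤ f k x)
      ⟨0, 1, one_pos, by simp⟩ ?_ ?_ ?_
    · rintro S S' hS ⟨K, c, hc, h⟩
      exact ⟨K, c, hc, fun x hx => h x (hS hx)⟩
    · rintro S S' ⟨K, c, hc, h⟩ ⟨K', c', hc', h'⟩
      refine ⟨max K K', min c c', lt_min hc hc', fun x hx => ?_⟩
      rcases hx with hx | hx
      · obtain ⟨k, hk, hkx⟩ := h x hx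
        exact ⟨k, hk.trans_le (le_max_left _ _), (min_le_left _ _).trans hkx⟩
      · obtain ⟨k, hk, hkx⟩ := h' x hx
        exact ⟨k, hk.trans_le (le_max_right _ _), (min_le_right _ _).trans hkx⟩
    · rintro ⟨T, w⟩ ⟨hT, hw⟩
      have hw0 : w ≠ 0 := by
        rintro rfl
        rw [mem_sphere_zero_iff_norm, norm_zero] at hw
        exact zero_ne_one hw
      obtain ⟨k, hk⟩ : ∃ k : ℕ, D.form ((T.val ^ k) D.e) w ≠ 0 := by
        by_contra! h
        exact hw0 (cyclic_of_stable κ (hst T hT) h)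
      have hpos : 0 < f k (T, w) := by
        rw [lt_max_iff, norm_pos_iff, norm_pos_iff]
        by_contra! h
        exact hk (κ.ext (by rw [h.1, map_zero]) (by rw [h.2, map_zero]))
      refine ⟨{x | f k (T, w) / 2 < f k x}, mem_nhdsWithin_of_mem_nhds
        ((isOpen_lt continuous_const (hf k)).mem_nhds (half_lt_self hpos)),
        k + 1, f k (T, w) / 2, half_pos hpos, fun x hx => ⟨k, k.lt_succ_self, le_of_lt hx⟩⟩
  obtain ⟨K, c, hc, h⟩ := hcomp
  refine ⟨K + 1, c, hc, fun T hT w => ?_⟩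
  rcases eq_or_ne w 0 with rfl | hw
  · exact ⟨0, K.succ_pos, by simp⟩
  · obtain ⟨k, hk, hle⟩ := h (T, _) ⟨hT, inv_norm_smul_mem_sphere (F := F) hw⟩
    refine ⟨k, hk.trans K.lt_succ_self, ?_⟩
    have hn := norm_pos_iff.2 hw
    have hle : c ≤ max ‖κ.re (D.form ((T.val ^ k) D.e) (((‖w‖⁻¹ : ℝ) : F) • w))‖
      ‖κ.im (D.form ((T.val ^ k) D.e) (((‖w‖⁻¹ : ℝ) : F) • w))‖ := hle
    rw [form_smul_right', ← Algebra.smul_def, map_smul, map_smul, norm_smul, norm_smul,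
      RCLike.norm_ofReal, abs_of_pos (inv_pos.2 hn), ← mul_max_of_nonneg _ _ (inv_pos.2 hn).le,
      inv_mul_eq_div, le_div_iff₀ hn] at hle
    exact hle

/-- The `k`-th moment of `T` at the vector `t⁻¹ w₀ + c e`, for `t` of norm one. -/
theorem moment_expansion [FiniteDimensional F E] (T : D.lie) (k : ℕ) (w₀ : V) (t c : E)
    (ht : t * D.ι t = 1) :
    D.form ((T.val ^ k) (D.ι t • w₀ + c • D.e)) (D.ι t • w₀ + c • D.e)
      = D.form ((T.val ^ k) w₀) w₀ + c * D.ι c * D.form ((T.val ^ k) D.e) D.e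
        + t * D.form ((T.val ^ k) D.e) (D.ι c • w₀)
        + (-1) ^ k * D.ι (t * D.form ((T.val ^ k) D.e) (D.ι c • w₀)) := by
  have h1 : D.form ((T.val ^ k) w₀) D.e = (-1) ^ k * D.ι (D.form ((T.val ^ k) D.e) w₀) := by
    rw [form_conj, form_pow_apply]
  simp only [map_add, linear_pow, LinearMap.add_apply, form_smul_left, form_smul_right,
    D.conj_conj, h1, map_mul]
  linear_combination D.form ((T.val ^ k) w₀) w₀ * ht

end

section

variable {F E V : Type*} [RCLike F] [CommRing E] [Algebra F E]
  [NormedAddCommGroup V] [NormedSpace F V] [FiniteDimensional F V]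
  [NormedSpace ℝ V] [IsScalarTower ℝ F V] [Module E V] [IsScalarTower F E V]
  {D : UnitaryGGP F E V}

/-! ### Elements of `G` near the identity -/

/-- The coordinate along `e` for the decomposition of `V` into `V_H` and the line of `e`. -/
noncomputable def eCoeff (D : UnitaryGGP F E V) : V →ₗ[E] E where
  toFun v := D.form v D.e * Ring.inverse (D.form D.e D.e)
  map_add' v v' := by rw [map_add, LinearMap.add_apply, add_mul]
  map_smul' a v := by rw [form_smul_left, mul_assoc, RingHom.id_apply, smul_eq_mul]

theorem eCoeff_apply (v : V) :
    D.eCoeff v = D.form v D.e * Ring.inverse (D.form D.e D.e) := rfl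

theorem perpProj_add_eCoeff (v : V) : D.perpProj v + D.eCoeff v • D.e = v :=
  sub_add_cancel _ _

variable [FiniteDimensional F E]

theorem eCoeff_e : D.eCoeff D.e = 1 := Ring.mul_inverse_cancel _ D.isUnit_form_e

theorem form_e_eq (v : V) : D.form v D.e = D.eCoeff v * D.form D.e D.e := by
  rw [eCoeff_apply, mul_assoc, Ring.inverse_mul_cancel _ D.isUnit_form_e, mul_one]

variable (κ : ConjCoords D.ι)

include κ in
theorem re_form_e_ne_zero : κ.re (D.form D.e D.e) ≠ 0 := by
  have := κ.nontrivial
  intro h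
  have h1 := D.isUnit_form_e
  rw [D.form_self κ, h, map_zero] at h1
  exact h1.ne_zero rfl

/-- The coefficients of `g e` and `g⁻¹ e` along `e` are conjugate. -/
theorem eCoeff_apply_e (g : D.G) :
    D.eCoeff (g.val.val D.e) = D.ι (D.eCoeff ((g⁻¹).val.val D.e)) := by
  refine D.isUnit_form_e.mul_right_cancel ?_
  rw [← form_e_eq]
  conv_rhs => rw [← D.form_conj D.e D.e]
  rw [← map_mul, ← form_e_eq, form_conj]
  conv_lhs => rw [← D.apply_inv_self g D.e]
  rw [D.apply_inv_self, ← g.2.2 D.e ((g⁻¹).val.val D.e), D.apply_inv_self]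

include κ in
/-- The isometry property of `g⁻¹`, evaluated at `e = g (w₀ + c e)`. -/
theorem eCoeff_mul_conj (g : D.G) :
    D.eCoeff (g.val.val D.e) * D.ι (D.eCoeff (g.val.val D.e)) - 1
      = algebraMap F E (-(κ.re (D.form (D.perpProj (g.val.val D.e)) (D.perpProj (g.val.val D.e)))
          / κ.re (D.form D.e D.e))) := by
  set w := D.perpProj (g.val.val D.e) with hw
  set c := D.eCoeff (g.val.val D.e) with hc
  have hwe : D.form w D.e = 0 := D.form_perpProj_e _
  have hew : D.form D.e w = 0 := by rw [← D.form_conj, hwe, map_zero]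
  have h1 : D.form (w + c • D.e) (w + c • D.e) = D.form D.e D.e := by
    rw [hw, hc, perpProj_add_eCoeff]
    exact g.2.2 _ _
  simp only [map_add, LinearMap.add_apply, form_smul_left, form_smul_right, hwe, hew] at h1
  refine D.isUnit_form_e.mul_right_cancel ?_
  have h2 : algebraMap F E (-(κ.re (D.form w w) / κ.re (D.form D.e D.e))) * D.form D.e D.e
      = -D.form w w := by
    conv_lhs => rw [D.form_self κ D.e]
    rw [D.form_self κ w, ← map_mul, ← map_neg]
    congr 1
    simp only [κ.re_algebraMap]
    have := re_form_e_ne_zero (D := D) κ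
    field_simp
  rw [h2]
  linear_combination h1

/-- A scalar acts on `V` as an operator close to the identity. -/
def NearOne (V : Type*) [NormedAddCommGroup V] [Module E V] (c : E) : Prop :=
  ∀ v : V, ‖c • v - v‖ ≤ 1 / 2 * ‖v‖

omit [FiniteDimensional F E] in
theorem NearOne.le_norm_smul {c : E} (hc : NearOne V c) (v : V) : ‖v‖ ≤ 2 * ‖c • v‖ := by
  have h1 := hc v
  have h2 := norm_sub_norm_le v (v - c • v)
  rw [sub_sub_cancel, norm_sub_rev] at h2
  linarith

theorem NearOne.isUnit (D : UnitaryGGP F E V) {c : E} (hc : NearOne V c) : IsUnit c := by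
  have : IsArtinianRing E := IsArtinianRing.of_finite F E
  apply IsArtinianRing.isUnit_of_mem_nonZeroDivisors
  rw [mem_nonZeroDivisors_iff_right]
  intro a ha
  refine D.e_free a (norm_le_zero_iff.1 ?_)
  have := hc.le_norm_smul (a • D.e)
  rwa [smul_smul, mul_comm c a, ha, zero_smul, norm_zero, mul_zero] at this

include κ in
theorem eventually_near_one {ε : ℝ} (hε : 0 < ε) : ∀ᶠ g in 𝓝 (1 : D.G),
    ‖g.val.val‖ ≤ ‖(1 : V →L[F] V)‖ + 1 ∧ ‖(g⁻¹).val.val‖ ≤ ‖(1 : V →L[F] V)‖ + 1 ∧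
    ‖D.perpProj ((g⁻¹).val.val D.e)‖ ≤ ε ∧ NearOne V (D.eCoeff ((g⁻¹).val.val D.e)) ∧
    NearOne V (D.ι (D.eCoeff ((g⁻¹).val.val D.e))) := by
  have hval : Continuous fun g : D.G => g.val.val :=
    Units.continuous_val.comp continuous_subtype_val
  have hinv : Continuous fun g : D.G => (g⁻¹).val.val :=
    Units.continuous_coe_inv.comp continuous_subtype_val
  have hinve : Continuous fun g : D.G => (g⁻¹).val.val D.e := hinv.clm_apply continuous_const
  have h1e : (1 : D.G)⁻¹.val.val D.e = D.e := by rw [inv_one]; rfl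
  have hre : Continuous fun g : D.G => κ.re (D.eCoeff ((g⁻¹).val.val D.e)) :=
    (LinearMap.continuous_of_finiteDimensional
      (κ.re ∘ₗ (D.eCoeff.restrictScalars F))).comp hinve
  have him : Continuous fun g : D.G => κ.im (D.eCoeff ((g⁻¹).val.val D.e)) :=
    (LinearMap.continuous_of_finiteDimensional
      (κ.im ∘ₗ (D.eCoeff.restrictScalars F))).comp hinve
  have hperp : Continuous fun g : D.G => D.perpProj ((g⁻¹).val.val D.e) :=
    (LinearMap.continuous_of_finiteDimensional (D.perpProj.restrictScalars F)).comp hinve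
  obtain ⟨J, -, hJ⟩ := (toCLM (κ.δ • LinearMap.id : V →ₗ[E] V) : V →L[F] V).bound
  have hJ : ∀ v : V, ‖κ.δ • v‖ ≤ J * ‖v‖ := hJ
  have hc0 : Continuous fun g : D.G => ‖κ.re (D.eCoeff ((g⁻¹).val.val D.e)) - 1‖
      + ‖κ.im (D.eCoeff ((g⁻¹).val.val D.e))‖ * J :=
    (hre.sub continuous_const).norm.add (him.norm.mul continuous_const)
  have e1 : ∀ᶠ g in 𝓝 (1 : D.G), ‖g.val.val‖ < ‖(1 : V →L[F] V)‖ + 1 :=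
    hval.norm.continuousAt.eventually_lt continuousAt_const (lt_add_one _)
  have e2 : ∀ᶠ g in 𝓝 (1 : D.G), ‖(g⁻¹).val.val‖ < ‖(1 : V →L[F] V)‖ + 1 := by
    refine hinv.norm.continuousAt.eventually_lt continuousAt_const ?_
    rw [inv_one]
    exact lt_add_one _
  have e3 : ∀ᶠ g in 𝓝 (1 : D.G), ‖D.perpProj ((g⁻¹).val.val D.e)‖ < ε := by
    refine hperp.norm.continuousAt.eventually_lt continuousAt_const ?_
    rw [h1e, D.perpProj_e, norm_zero]
    exact hε
  have e4 : ∀ᶠ g in 𝓝 (1 : D.G), ‖κ.re (D.eCoeff ((g⁻¹).val.val D.e)) - 1‖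
      + ‖κ.im (D.eCoeff ((g⁻¹).val.val D.e))‖ * J < 1 / 2 := by
    refine hc0.continuousAt.eventually_lt continuousAt_const ?_
    rw [h1e, eCoeff_e]
    simp
  filter_upwards [e1, e2, e3, e4] with g h1 h2 h3 h4
  have hnear : ∀ c : E, ‖κ.re c - 1‖ + ‖κ.im c‖ * J < 1 / 2 → NearOne V c := by
    intro c hc v
    have h5 : c • v - v = (κ.re c - 1) • v + κ.im c • (κ.δ • v) := by
      rw [κ.smul_eq c v, sub_smul, one_smul]; abel
    rw [h5]
    calc _ ≤ ‖κ.re c - 1‖ * ‖v‖ + ‖κ.im c‖ * (J * ‖v‖) := by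
          refine (norm_add_le _ _).trans ?_
          rw [norm_smul, norm_smul]
          exact add_le_add le_rfl (mul_le_mul_of_nonneg_left (hJ v) (norm_nonneg _))
      _ = (‖κ.re c - 1‖ + ‖κ.im c‖ * J) * ‖v‖ := by ring
      _ ≤ _ := mul_le_mul_of_nonneg_right hc.le (norm_nonneg _)
  refine ⟨h1.le, h2.le, h3.le, hnear _ h4, hnear _ ?_⟩
  rwa [κ.re_conj, κ.im_conj, norm_neg]

/-! ### The size of `d_H` -/

include κ in
theorem exists_dTilde_le {N : V → ℝ} (hN : IsFNorm F N) : ∃ C : ℝ, 0 < C ∧ ∀ g : D.G,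
    NearOne V (D.eCoeff (g.val.val D.e)) →
    D.dTilde N g ≤ ENNReal.ofReal (C * ‖D.perpProj (g.val.val D.e)‖ ^ Module.finrank ℝ F) := by
  obtain ⟨C, hC, hNC⟩ := hN.exists_le
  set u := κ.re (D.form D.e D.e) with hu
  have hu0 : 0 < ‖u‖ := norm_pos_iff.2 (re_form_e_ne_zero κ)
  refine ⟨C * (2 / ‖u‖) ^ Module.finrank ℝ F, by positivity, fun g hg => ?_⟩
  have hunit : IsUnit (D.form (g.val.val D.e) D.e) := by
    rw [form_e_eq]
    exact (hg.isUnit D).mul D.isUnit_form_e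
  rw [dTilde, if_pos hunit]
  refine ENNReal.ofReal_le_ofReal ((hNC _).trans ?_)
  set X := Ring.inverse (D.form (g.val.val D.e) D.e) • g.val.val D.e
    - Ring.inverse (D.form D.e D.e) • D.e with hX
  have h1 : D.eCoeff (g.val.val D.e) • (u • X) = D.perpProj (g.val.val D.e) := by
    have h2 : D.form (g.val.val D.e) D.e • X = D.perpProj (g.val.val D.e) := by
      rw [hX, smul_sub, smul_smul, smul_smul, Ring.mul_inverse_cancel _ hunit, one_smul]
      rfl
    rw [← h2, ← algebraMap_smul E u X, smul_smul, hu, ← D.form_self κ, ← form_e_eq]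
  have h2 := hg.le_norm_smul (u • X)
  rw [h1, norm_smul] at h2
  have h3 : ‖X‖ ≤ 2 / ‖u‖ * ‖D.perpProj (g.val.val D.e)‖ := by
    rw [div_mul_eq_mul_div, le_div_iff₀ hu0]
    linarith
  rw [mul_assoc, ← mul_pow]
  gcongr

include κ in
/-- Near the identity, `d_H (g)` is bounded by the size of the component of `g⁻¹ e` in `V_H`. -/
theorem exists_dH_le {N : V → ℝ} (hN : IsFNorm F N) :
    ∃ C : ℝ, 0 < C ∧ ∀ g : D.G,
    ‖g.val.val‖ ≤ ‖(1 : V →L[F] V)‖ + 1 → NearOne V (D.eCoeff ((g⁻¹).val.val D.e)) →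
    NearOne V (D.ι (D.eCoeff ((g⁻¹).val.val D.e))) →
    D.dH N g ≤ ENNReal.ofReal
      (C * ‖D.perpProj ((g⁻¹).val.val D.e)‖ ^ Module.finrank ℝ F) := by
  obtain ⟨C, hC, hCle⟩ := exists_dTilde_le κ hN
  obtain ⟨P, hP, hPle⟩ := (toCLM D.perpProj : V →L[F] V).bound
  have hPle : ∀ v : V, ‖D.perpProj v‖ ≤ P * ‖v‖ := hPle
  set B := ‖(1 : V →L[F] V)‖ + 1 with hB
  have hB0 : 0 < B := by positivity
  set d := Module.finrank ℝ F
  refine ⟨C * (2 * P * B) ^ d + C, by positivity, fun g hg hc hc' => ?_⟩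
  set w := D.perpProj ((g⁻¹).val.val D.e) with hw
  set c := D.eCoeff ((g⁻¹).val.val D.e) with hcdef
  rw [← eCoeff_apply_e] at hc'
  have h1 := hCle g hc'
  have h2 := hCle g⁻¹ hc
  -- the components of `g e` and `g⁻¹ e` in `V_H` are comparable
  have h3 : D.perpProj (g.val.val w) + c • D.perpProj (g.val.val D.e) = 0 := by
    have h4 : g.val.val w + c • g.val.val D.e = D.e := by
      rw [← g.2.1, ← map_add, hw, hcdef, perpProj_add_eCoeff, D.apply_inv_self]
    rw [← map_smul, ← map_add, h4, D.perpProj_e]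
  have h4 : ‖D.perpProj (g.val.val D.e)‖ ≤ 2 * P * B * ‖w‖ := by
    have h5 := hc.le_norm_smul (D.perpProj (g.val.val D.e))
    rw [eq_neg_of_add_eq_zero_right h3, norm_neg] at h5
    have h6 : ‖D.perpProj (g.val.val w)‖ ≤ P * (B * ‖w‖) :=
      (hPle _).trans (mul_le_mul_of_nonneg_left ((g.val.val.le_opNorm w).trans
        (mul_le_mul_of_nonneg_right hg (norm_nonneg _))) hP.le)
    linarith
  calc D.dH N g = min 1 (D.dTilde N g + D.dTilde N g⁻¹) := rfl
    _ ≤ D.dTilde N g + D.dTilde N g⁻¹ := min_le_right _ _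
    _ ≤ ENNReal.ofReal (C * (2 * P * B * ‖w‖) ^ d) + ENNReal.ofReal (C * ‖w‖ ^ d) := by
        refine add_le_add (h1.trans (ENNReal.ofReal_le_ofReal ?_)) h2
        gcongr
    _ = _ := by
        rw [← ENNReal.ofReal_add (by positivity) (by positivity), mul_pow]
        congr 1
        ring

/-! ### Distance to an orbit -/

theorem exists_conj_of_distF_le {M : D.dual → ℝ} (hM : IsFNorm ℝ M) :
    ∃ C : ℝ, 0 < C ∧ ∀ (A T : D.lie) (ρ : ℝ), 0 < ρ →
      D.distF M (D.traceEquiv κ A) (MulAction.orbit D.H (D.traceEquiv κ T))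
        ≤ ρ ^ Module.finrank ℝ F → ∃ h : D.H, ‖A.val - (D.Ad h.val T).val‖ ≤ C * ρ := by
  have hM' : IsFNorm ℝ fun x : D.lie => M (D.traceEquiv κ x) :=
    { continuous := hM.continuous.comp (D.traceEquiv κ).continuous
      nonneg := fun x => hM.nonneg _
      eq_zero := fun x hx => (D.traceEquiv κ).map_eq_zero_iff.1 (hM.eq_zero _ hx)
      smul := fun t x => by rw [map_smul, hM.smul] }
  obtain ⟨c, hc, hle⟩ := IsFNorm.exists_ge (F := ℝ) (W := D.lie) hM'
  refine ⟨2 / c, by positivity, fun A T ρ hρ hdist => ?_⟩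
  have hd : Module.finrank ℝ F ≠ 0 := (Module.finrank_pos (R := ℝ) (M := F)).ne'
  have hlt : D.distF M (D.traceEquiv κ A) (MulAction.orbit D.H (D.traceEquiv κ T))
      < (2 * ρ) ^ Module.finrank ℝ F :=
    hdist.trans_lt (pow_lt_pow_left₀ (by linarith) hρ.le hd)
  have : Nonempty (MulAction.orbit D.H (D.traceEquiv κ T)) := ⟨⟨_, MulAction.mem_orbit_self _⟩⟩
  obtain ⟨⟨ξ, h, hξ⟩, hlt⟩ := exists_lt_of_ciInf_lt hlt
  have hξ : D.traceEquiv κ (D.Ad h.val T) = ξ := by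
    rw [← hξ, ← D.smul_traceEquiv]; rfl
  refine ⟨h, ?_⟩
  have h1 : M (D.traceEquiv κ A - ξ) < 2 * ρ := lt_of_pow_lt_pow_left₀ _ (by positivity) hlt
  have h2 := hle (A - D.Ad h.val T)
  rw [map_sub, hξ, Module.finrank_self, pow_one] at h2
  rw [div_mul_eq_mul_div, le_div_iff₀ hc, mul_comm]
  exact h2.trans h1.le

end

section

variable {F E V : Type*} [RCLike F] [CommRing E] [Algebra F E]
  [Algebra.IsQuadraticExtension F E] [Algebra.Etale F E]
  [NormedAddCommGroup V] [NormedSpace F V] [FiniteDimensional F V]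
  [NormedSpace ℝ V] [IsScalarTower ℝ F V] [Module E V] [IsScalarTower F E V]
  {D : UnitaryGGP F E V} {κ : ConjCoords D.ι}

/-! ### The distance between two elements of the center -/

theorem exists_norm_center_le {R : ℝ} (hR : κ.IsSmall R) : ∃ B : ℝ, ∀ z ∈ cayBall κ R,
    ‖z.val.val.val.val‖ ≤ B ∧ ‖(z⁻¹).val.val.val.val‖ ≤ B := by
  have hval : Continuous fun z : D.ZH => z.val.val.val.val :=
    Units.continuous_val.comp (continuous_subtype_val.comp
      (continuous_subtype_val.comp continuous_subtype_val))
  have hinv : Continuous fun z : D.ZH => (z⁻¹).val.val.val.val :=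
    Units.continuous_coe_inv.comp (continuous_subtype_val.comp
      (continuous_subtype_val.comp continuous_subtype_val))
  obtain ⟨B, hB⟩ := (isCompact_cayBall hR le_rfl).exists_bound_of_continuousOn hval.continuousOn
  obtain ⟨B', hB'⟩ := (isCompact_cayBall hR le_rfl).exists_bound_of_continuousOn hinv.continuousOn
  exact ⟨max B B', fun z hz => ⟨(hB z hz).trans (le_max_left _ _),
    (hB' z hz).trans (le_max_right _ _)⟩⟩

/-- The moments of two operators in a bounded set differ by at most a multiple of their distance. -/
theorem exists_moment_sub_le (κ : ConjCoords D.ι) (K : ℕ) (B : ℝ) : ∃ C : ℝ, 0 < C ∧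
    ∀ A A' : V →L[F] V, ‖A‖ ≤ B → ‖A'‖ ≤ B → ∀ k < K,
      ‖κ.re (D.form ((A ^ k) D.e) D.e - D.form ((A' ^ k) D.e) D.e)‖ ≤ C * ‖A - A'‖ ∧
      ‖κ.im (D.form ((A ^ k) D.e) D.e - D.form ((A' ^ k) D.e) D.e)‖ ≤ C * ‖A - A'‖ := by
  obtain ⟨Cb, hCb, hb⟩ := exists_form_bound κ
  set B' := max B 1 with hB'
  have hB1 : 1 ≤ B' := le_max_right _ _
  refine ⟨Cb * (K * B' ^ K * ‖D.e‖) * ‖D.e‖ + 1, by positivity, fun A A' hA hA' k hk => ?_⟩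
  have h1 := norm_pow_apply_sub_le (hA.trans (le_max_left B 1)) (hA'.trans (le_max_left B 1))
    hB1 k D.e
  have h2 : ‖(A ^ k) D.e - (A' ^ k) D.e‖ ≤ K * B' ^ K * ‖A - A'‖ * ‖D.e‖ := by
    refine h1.trans ?_
    gcongr
  have h3 : Cb * ‖(A ^ k) D.e - (A' ^ k) D.e‖ * ‖D.e‖
      ≤ (Cb * (K * B' ^ K * ‖D.e‖) * ‖D.e‖ + 1) * ‖A - A'‖ := by
    calc _ ≤ Cb * (K * B' ^ K * ‖A - A'‖ * ‖D.e‖) * ‖D.e‖ := by gcongr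
      _ = Cb * (K * B' ^ K * ‖D.e‖) * ‖D.e‖ * ‖A - A'‖ := by ring
      _ ≤ _ := by gcongr; linarith
  have h4 := hb ((A ^ k) D.e - (A' ^ k) D.e) D.e
  rw [map_sub, LinearMap.sub_apply] at h4
  exact ⟨h4.1.trans h3, h4.2.trans h3⟩

/-- The part of the moments of `T` at `t⁻¹ w₀ + c e` that does not depend on `t` is quadratic
in `w₀`. -/
theorem exists_const_le (κ : ConjCoords D.ι) (K : ℕ) (B : ℝ) : ∃ C : ℝ, 0 < C ∧
    ∀ T : D.lie, ‖T.val‖ ≤ B → ∀ g : D.G, ∀ k < K,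
      ‖κ.re (D.form ((T.val ^ k) (D.perpProj (g.val.val D.e))) (D.perpProj (g.val.val D.e))
        + (D.eCoeff (g.val.val D.e) * D.ι (D.eCoeff (g.val.val D.e)) - 1)
          * D.form ((T.val ^ k) D.e) D.e)‖ ≤ C * ‖D.perpProj (g.val.val D.e)‖ ^ 2 ∧
      ‖κ.im (D.form ((T.val ^ k) (D.perpProj (g.val.val D.e))) (D.perpProj (g.val.val D.e))
        + (D.eCoeff (g.val.val D.e) * D.ι (D.eCoeff (g.val.val D.e)) - 1)
          * D.form ((T.val ^ k) D.e) D.e)‖ ≤ C * ‖D.perpProj (g.val.val D.e)‖ ^ 2 := by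
  obtain ⟨Cb, hCb, hb⟩ := exists_form_bound κ
  set B' := max B 1 with hB'
  have hB1 : 1 ≤ B' := le_max_right _ _
  set u := κ.re (D.form D.e D.e) with hu
  have hu0 : 0 < ‖u‖ := norm_pos_iff.2 (re_form_e_ne_zero κ)
  refine ⟨Cb * B' ^ K + Cb / ‖u‖ * (Cb * (B' ^ K * ‖D.e‖) * ‖D.e‖), by positivity,
    fun T hT g k hk => ?_⟩
  rw [eCoeff_mul_conj κ]
  set w := D.perpProj (g.val.val D.e)
  have hpow : ∀ v, ‖(T.val ^ k) v‖ ≤ B' ^ K * ‖v‖ := fun v =>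
    (norm_pow_apply_le (hT.trans (le_max_left B 1)) k v).trans (by gcongr)
  have h1 : Cb * ‖(T.val ^ k) w‖ * ‖w‖ ≤ Cb * B' ^ K * ‖w‖ ^ 2 := by
    calc _ ≤ Cb * (B' ^ K * ‖w‖) * ‖w‖ := by gcongr; exact hpow w
      _ = _ := by ring
  have h2 : Cb * ‖(T.val ^ k) D.e‖ * ‖D.e‖ ≤ Cb * (B' ^ K * ‖D.e‖) * ‖D.e‖ := by
    gcongr; exact hpow D.e
  have h3 : ‖-(κ.re (D.form w w) / u)‖ ≤ Cb / ‖u‖ * ‖w‖ ^ 2 := by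
    rw [norm_neg, norm_div, div_mul_eq_mul_div]
    gcongr
    exact (hb w w).1.trans_eq (by ring)
  have key : ∀ f : E →ₗ[F] F, ‖f (D.form ((T.val ^ k) w) w)‖ ≤ Cb * ‖(T.val ^ k) w‖ * ‖w‖ →
      ‖f (D.form ((T.val ^ k) D.e) D.e)‖ ≤ Cb * ‖(T.val ^ k) D.e‖ * ‖D.e‖ →
      ‖f (D.form ((T.val ^ k) w) w + algebraMap F E (-(κ.re (D.form w w) / u))
        * D.form ((T.val ^ k) D.e) D.e)‖
        ≤ (Cb * B' ^ K + Cb / ‖u‖ * (Cb * (B' ^ K * ‖D.e‖) * ‖D.e‖)) * ‖w‖ ^ 2 := by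
    intro f hf hf'
    rw [map_add, ← Algebra.smul_def, map_smul, smul_eq_mul]
    calc _ ≤ Cb * B' ^ K * ‖w‖ ^ 2
          + Cb / ‖u‖ * ‖w‖ ^ 2 * (Cb * (B' ^ K * ‖D.e‖) * ‖D.e‖) := by
          refine (norm_add_le _ _).trans (add_le_add (hf.trans h1) ?_)
          rw [norm_mul]
          exact mul_le_mul h3 (hf'.trans h2) (norm_nonneg _) (by positivity)
      _ = _ := by ring
  exact ⟨key κ.re (hb _ _).1 (hb _ _).1, key κ.im (hb _ _).2 (hb _ _).2⟩

/-- If `g z T` and `g z' T` are both within a multiple of `ρ` from the orbit of `T`, then the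
distance between `z` and `z'` is `O (ρ / ‖w₀‖)`, where `w₀` is the component of `g⁻¹ e` in `V_H`. -/
theorem exists_center_dist_le {R : ℝ} (hR : κ.IsSmall R) {Ω : Set D.lie} (hΩ : IsCompact Ω)
    (hst : ∀ T ∈ Ω, D.traceEquiv κ T ∈ D.stable) {C₀ : ℝ} (hC₀ : 0 < C₀) :
    ∃ ε : ℝ, 0 < ε ∧ ∃ C : ℝ, 0 < C ∧ ∀ g : D.G,
    ‖g.val.val‖ ≤ ‖(1 : V →L[F] V)‖ + 1 → ‖(g⁻¹).val.val‖ ≤ ‖(1 : V →L[F] V)‖ + 1 →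
    ‖D.perpProj ((g⁻¹).val.val D.e)‖ ≤ ε →
    NearOne V (D.ι (D.eCoeff ((g⁻¹).val.val D.e))) →
    ∀ T ∈ Ω, ∀ ρ : ℝ, 0 < ρ → ρ ≤ 1 → ∀ s s' : κ.Dom, ‖s.val‖ ≤ R → ‖s'.val‖ ≤ R →
    (∀ r ∈ ({s, s'} : Set κ.Dom), ∃ h : D.H,
      ‖(D.Ad (g * (cayH κ r).val.val) T).val - (D.Ad h.val T).val‖ ≤ C₀ * ρ) →
    ‖D.perpProj ((g⁻¹).val.val D.e)‖ * ‖s.val - s'.val‖ ≤ C * ρ := by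
  obtain ⟨K, c, hc, hlow⟩ := exists_moment_bound κ hΩ hst
  obtain ⟨Bz, hBz⟩ := exists_norm_center_le (D := D) hR
  obtain ⟨BT, hBT⟩ := hΩ.exists_bound_of_continuousOn
    (f := fun T : D.lie => T.val) continuous_subtype_val.continuousOn
  set Bg := ‖(1 : V →L[F] V)‖ + 1 with hBg
  obtain ⟨C₁, hC₁, hmom⟩ := exists_moment_sub_le κ K (Bg * Bz * BT * (Bz * Bg) + C₀)
  obtain ⟨C₂, hC₂, hconst⟩ := exists_const_le κ K BT
  set η := min 1 ‖κ.disc‖ with hη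
  have hη0 : 0 < η := lt_min one_pos (norm_pos_iff.2 κ.disc_ne_zero)
  -- `ε` is chosen such that `C₂ ‖w₀‖ ^ 2 ≤ η (c ‖w₀‖ / 2) / 4` if `‖w₀‖ ≤ ε`
  refine ⟨η * c / (8 * C₂), by positivity, 32 * (C₁ * C₀) / (η * c), by positivity, ?_⟩
  intro g hg hg' hw hc' T hT ρ hρ0 hρ1 s s' hs hs' hclose
  set w := D.perpProj ((g⁻¹).val.val D.e) with hwdef
  set a := D.eCoeff ((g⁻¹).val.val D.e) with hadef
  have hBg0 : 0 < Bg := by positivity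
  obtain ⟨k, hk, hlk⟩ := hlow T hT (D.ι a • w)
  have hw2 : ‖w‖ ≤ 2 * ‖D.ι a • w‖ := hc'.le_norm_smul w
  have hl : c * (‖w‖ / 2) ≤ max ‖κ.re (D.form ((T.val ^ k) D.e) (D.ι a • w))‖
      ‖κ.im (D.form ((T.val ^ k) D.e) (D.ι a • w))‖ := by
    refine le_trans ?_ hlk
    gcongr
    linarith
  set σ := D.form ((T.val ^ k) w) w + (a * D.ι a - 1) * D.form ((T.val ^ k) D.e) D.e with hσ
  have hσ2 : ‖κ.re σ‖ ≤ C₂ * ‖w‖ ^ 2 ∧ ‖κ.im σ‖ ≤ C₂ * ‖w‖ ^ 2 := hconst T (hBT T hT) g⁻¹ k hk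
  have hsmall : C₂ * ‖w‖ ^ 2 ≤ η * (c * (‖w‖ / 2)) / 4 := by
    have h1 : ‖w‖ * (8 * C₂) ≤ η * c := (le_div_iff₀ (by positivity)).1 hw
    nlinarith [norm_nonneg w]
  have hmoment : ∀ r ∈ ({s.val, s'.val} : Set F),
      ‖κ.re (σ + κ.cayley r * D.form ((T.val ^ k) D.e) (D.ι a • w)
        + (-1) ^ k * D.ι (κ.cayley r * D.form ((T.val ^ k) D.e) (D.ι a • w)))‖ ≤ C₁ * (C₀ * ρ) ∧
      ‖κ.im (σ + κ.cayley r * D.form ((T.val ^ k) D.e) (D.ι a • w)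
        + (-1) ^ k * D.ι (κ.cayley r * D.form ((T.val ^ k) D.e) (D.ι a • w)))‖
        ≤ C₁ * (C₀ * ρ) := by
    have hr : ∀ r ∈ ({s, s'} : Set κ.Dom), ‖r.val‖ ≤ R := by
      rintro r (rfl | rfl)
      exacts [hs, hs']
    have main : ∀ r ∈ ({s, s'} : Set κ.Dom),
        ‖κ.re (σ + κ.cayley r.val * D.form ((T.val ^ k) D.e) (D.ι a • w)
          + (-1) ^ k * D.ι (κ.cayley r.val * D.form ((T.val ^ k) D.e) (D.ι a • w)))‖
          ≤ C₁ * (C₀ * ρ) ∧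
        ‖κ.im (σ + κ.cayley r.val * D.form ((T.val ^ k) D.e) (D.ι a • w)
          + (-1) ^ k * D.ι (κ.cayley r.val * D.form ((T.val ^ k) D.e) (D.ι a • w)))‖
          ≤ C₁ * (C₀ * ρ) := by
      intro r hrs
      obtain ⟨h, hh⟩ := hclose r hrs
      obtain ⟨hz, hz'⟩ := hBz (cayH κ r) ⟨r, hr r hrs, rfl⟩
      have hBz0 : 0 ≤ Bz := (norm_nonneg _).trans hz
      have hBT0 : 0 ≤ BT := (norm_nonneg _).trans (hBT T hT)
      set A := D.Ad (g * (cayH κ r).val.val) T with hA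
      set A' := D.Ad h.val T with hA'
      have hAB : ‖A.val‖ ≤ Bg * Bz * BT * (Bz * Bg) := by
        have h1 : A.val = g.val.val * (cayH κ r).val.val.val.val * T.val
            * (((cayH κ r)⁻¹).val.val.val.val * (g⁻¹).val.val) := by
          rw [hA]
          change (g * (cayH κ r).val.val).val.val * T.val
            * ((g * (cayH κ r).val.val)⁻¹).val.val = _
          rw [mul_inv_rev]
          rfl
        rw [h1]
        refine (norm_mul_le _ _).trans (mul_le_mul ((norm_mul_le _ _).trans (mul_le_mul
          ((norm_mul_le _ _).trans (mul_le_mul hg hz (norm_nonneg _) hBg0.le)) (hBT T hT)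
          (norm_nonneg _) (by positivity))) ((norm_mul_le _ _).trans
          (mul_le_mul hz' hg' (norm_nonneg _) hBz0)) (norm_nonneg _) (by positivity))
      have hC₀ρ : C₀ * ρ ≤ C₀ := mul_le_of_le_one_right hC₀.le hρ1
      have hAB' : ‖A'.val‖ ≤ Bg * Bz * BT * (Bz * Bg) + C₀ := by
        have h1 : A'.val = A.val - (A.val - A'.val) := by abel
        rw [h1]
        exact (norm_sub_le _ _).trans (add_le_add hAB (hh.trans hC₀ρ))
      have hm := hmom A.val A'.val (hAB.trans (by linarith)) hAB' k hk
      -- the moments of a conjugate of `T` by `H` are those of `T`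
      have e1 : D.form ((A'.val ^ k) D.e) D.e = D.form ((T.val ^ k) D.e) D.e := by
        have he : (h.val⁻¹).val.val D.e = D.e := (h⁻¹).2
        rw [hA', form_Ad_pow, he]
      have e2 : D.form ((A.val ^ k) D.e) D.e - D.form ((T.val ^ k) D.e) D.e
          = σ + κ.cayley r.val * D.form ((T.val ^ k) D.e) (D.ι a • w)
            + (-1) ^ k * D.ι (κ.cayley r.val * D.form ((T.val ^ k) D.e) (D.ι a • w)) := by
        have hy : ((g * (cayH κ r).val.val)⁻¹).val.val D.e
            = D.ι (κ.cayley r.val) • w + a • D.e := by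
          rw [mul_inv_rev]
          change scaleOn D.perpProj (D.ι (κ.cayley r.val)) ((g⁻¹).val.val D.e) = _
          rw [scaleOn_apply, ← hwdef]
          conv_lhs => rw [← perpProj_add_eCoeff (D := D) ((g⁻¹).val.val D.e), ← hwdef, ← hadef]
          rw [sub_smul, one_smul]
          abel
        rw [hA, form_Ad_pow, hy, moment_expansion T k w _ a (κ.cayley_mul_conj r.2), hσ]
        ring
      rw [e1, e2] at hm
      exact ⟨hm.1.trans (by gcongr), hm.2.trans (by gcongr)⟩
    rintro r (rfl | rfl)
    · exact main s (by simp)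
    · exact main s' (by simp)
  have hfinal := hR.two_cayley_estimate hs hs' (by positivity) hl (hσ2.1.trans hsmall)
    (hσ2.2.trans hsmall) k hmoment
  rw [div_mul_eq_mul_div, le_div_iff₀ (by positivity)]
  linarith

/-! ### The volume bound -/

/-- If `V_H = 0`, then `d_H = 0`. -/
theorem dH_eq_zero {N : V → ℝ} (hN : IsFNorm F N) (h : ∀ v, D.perpProj v = 0) (g : D.G)
    (hg : ‖g.val.val‖ ≤ ‖(1 : V →L[F] V)‖ + 1) (hc : NearOne V (D.eCoeff ((g⁻¹).val.val D.e)))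
    (hc' : NearOne V (D.ι (D.eCoeff ((g⁻¹).val.val D.e)))) (κ : ConjCoords D.ι) :
    D.dH N g = 0 := by
  obtain ⟨C, -, hC⟩ := exists_dH_le κ hN
  have h1 := hC g hg hc hc'
  rw [h, norm_zero, zero_pow (Module.finrank_pos (R := ℝ) (M := F)).ne', mul_zero,
    ENNReal.ofReal_zero] at h1
  exact le_antisymm h1 bot_le

/-- A set of elements of the center, any two of which have parameters at distance at most `r / 2`,
has measure `O (r ^ [F : ℝ])`. -/
theorem measure_le_of_dist_le [MeasurableSpace D.ZH] [BorelSpace D.ZH] (μ : Measure D.ZH)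
    [μ.IsHaarMeasure] {R : ℝ} (hR : κ.IsSmall R) {C : ℝ} (hC0 : 0 ≤ C)
    (hC : ∀ r, 0 < r → r ≤ R → μ (cayBall κ r) ≤ ENNReal.ofReal (C * r ^ Module.finrank ℝ F))
    {S : Set D.ZH} (hS : S ⊆ cayBall κ R) {r : ℝ} (hr : 0 < r)
    (hdist : ∀ s s' : κ.Dom, ‖s.val‖ ≤ R → ‖s'.val‖ ≤ R → cayH κ s ∈ S → cayH κ s' ∈ S →
      2 * ‖s.val - s'.val‖ ≤ r) :
    μ S ≤ ENNReal.ofReal (C * r ^ Module.finrank ℝ F) := by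
  rcases le_or_gt r R with hrR | hrR
  · rcases S.eq_empty_or_nonempty with rfl | ⟨z', hz'⟩
    · simp
    · obtain ⟨s', hs', rfl⟩ := hS hz'
      refine le_trans ?_ (hC r hr hrR)
      rw [← measure_preimage_mul μ (cayH κ s')⁻¹ (cayBall κ r)]
      refine measure_mono fun z hz => ?_
      obtain ⟨s, hs, rfl⟩ := hS hz
      have hcomm : (cayH κ s')⁻¹ * cayH κ s = cayH κ s * (cayH κ s')⁻¹ :=
        Subtype.ext (Subgroup.mem_center_iff.1 (cayH κ s).2 _)
      rw [Set.mem_preimage, hcomm, cayH_mul_inv hR hs hs']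
      exact ⟨_, (hR.norm_div_le hs hs').trans (hdist s s' hs hs' hz hz'), rfl⟩
  · refine (measure_mono hS).trans ((hC R hR.pos le_rfl).trans (ENNReal.ofReal_le_ofReal ?_))
    have := hR.pos.le
    gcongr

end

end UnitaryGGP

theorem theorem5 {F E V : Type*} [RCLike F]
    [CommRing E] [Algebra F E] [Algebra.IsQuadraticExtension F E] [Algebra.Etale F E]
    [NormedAddCommGroup V] [NormedSpace F V] [FiniteDimensional F V]
    [NormedSpace ℝ V] [IsScalarTower ℝ F V] [Module E V] [IsScalarTower F E V]
    (D : UnitaryGGP F E V)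
    [MeasurableSpace D.ZH] [BorelSpace D.ZH] (μ : Measure D.ZH) [μ.IsHaarMeasure]
    (N : V → ℝ) (hN : IsFNorm F N) (M : D.dual → ℝ) (hM : IsFNorm ℝ M)
    (Ω : Set D.dual) (hΩ : IsCompact Ω) (hΩ_stable : Ω ⊆ D.stable) :
    ∃ 𝒵 ∈ 𝓝 (1 : D.ZH), ∃ 𝒰 ∈ 𝓝 (1 : D.Gbar), ∃ r₀ : ℝ, 0 < r₀ ∧ ∃ C : ℝ, 0 < C ∧
      ∀ τ ∈ Ω, ∀ g ∈ 𝒰, ∀ r : ℝ, 0 < r → r < r₀ →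
        μ {z ∈ 𝒵 | D.distF M ((g * D.zHToGbar z) • τ) (MulAction.orbit D.H τ) ≤ r}
          ≤ ENNReal.ofReal (C * r) / D.dH N g := by
  obtain ⟨κ⟩ := D.exists_conjCoords
  obtain ⟨R, hR⟩ := κ.exists_isSmall
  have hopen : IsOpenMap ((↑) : D.G → D.Gbar) := QuotientGroup.isOpenMap_coe
  have hd : Module.finrank ℝ F ≠ 0 := (Module.finrank_pos (R := ℝ) (M := F)).ne'
  -- the bound is trivial where `d_H` vanishes
  have htop : ∀ (S : Set D.ZH) (r : ℝ) (g : D.Gbar), 0 < r → D.dH N g = 0 →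
      μ S ≤ ENNReal.ofReal r / D.dH N g := by
    intro S r g hr h0
    rw [h0, ENNReal.div_zero (by simpa using hr)]
    exact le_top
  by_cases hV : ∃ v₀ : V, D.form v₀ D.e = 0 ∧ IsUnit (D.form v₀ v₀)
  · obtain ⟨v₀, hv₀e, hv₀⟩ := hV
    set d := Module.finrank ℝ F with hddef
    obtain ⟨Cμ, hCμ0, hCμ⟩ := UnitaryGGP.measure_cayBall_le hR μ hv₀ hv₀e
    obtain ⟨Cd, hCd, hCd_le⟩ := UnitaryGGP.exists_dH_le κ hN
    obtain ⟨C₀, hC₀, hdist⟩ := UnitaryGGP.exists_conj_of_distF_le κ hM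
    have hΩ' : IsCompact ((D.traceEquiv κ).symm '' Ω) :=
      hΩ.image (D.traceEquiv κ).symm.continuous
    obtain ⟨ε, hε, C₁, hC₁, hcenter⟩ := UnitaryGGP.exists_center_dist_le hR hΩ' (by
      rintro _ ⟨τ, hτ, rfl⟩
      rw [ContinuousLinearEquiv.apply_symm_apply]
      exact hΩ_stable hτ) hC₀
    refine ⟨UnitaryGGP.cayBall κ R, UnitaryGGP.cayBall_mem_nhds hR hv₀ hv₀e, _,
      hopen.image_mem_nhds (UnitaryGGP.eventually_near_one κ hε), 1, one_pos,
      Cμ * (2 * C₁) ^ d * Cd + 1, by positivity, ?_⟩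
    rintro τ hτ _ ⟨g, ⟨hg, hg', hw, hc, hc'⟩, rfl⟩ r hr hr1
    rcases eq_or_ne (D.dH N (g : D.Gbar)) 0 with h0 | h0
    · exact htop _ _ _ (by positivity) h0
    have hdH := hCd_le g hg hc hc'
    set w := D.perpProj ((g⁻¹).val.val D.e) with hwdef
    have hw0 : 0 < ‖w‖ := by
      refine (norm_nonneg _).lt_of_ne' fun h => h0 ?_
      rw [h, zero_pow hd, mul_zero, ENNReal.ofReal_zero] at hdH
      exact le_antisymm hdH bot_le
    obtain ⟨ρ, hρ0, hρ⟩ : ∃ ρ : ℝ, 0 < ρ ∧ ρ ^ d = r :=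
      ⟨r ^ ((d : ℝ)⁻¹), Real.rpow_pos_of_pos hr _, Real.rpow_inv_natCast_pow hr.le hd⟩
    have hρ1 : ρ ≤ 1 := by
      by_contra h
      have := one_lt_pow₀ (not_le.1 h) hd
      linarith
    set T := (D.traceEquiv κ).symm τ with hT
    have hτT : τ = D.traceEquiv κ T := ((D.traceEquiv κ).apply_symm_apply τ).symm
    have hS : μ {z ∈ UnitaryGGP.cayBall κ R |
        D.distF M (((g : D.Gbar) * D.zHToGbar z) • τ) (MulAction.orbit D.H τ) ≤ r}
        ≤ ENNReal.ofReal (Cμ * (2 * (C₁ * ρ / ‖w‖)) ^ d) := by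
      refine UnitaryGGP.measure_le_of_dist_le μ hR hCμ0 hCμ (fun z hz => hz.1) (by positivity) ?_
      intro s s' hs hs' hz hz'
      have hconj : ∀ r' ∈ ({s, s'} : Set κ.Dom), ∃ h : D.H,
          ‖(D.Ad (g * (UnitaryGGP.cayH κ r').val.val) T).val - (D.Ad h.val T).val‖ ≤ C₀ * ρ := by
        have hmem : ∀ r' : κ.Dom, D.distF M
            (((g : D.Gbar) * D.zHToGbar (UnitaryGGP.cayH κ r')) • τ)
            (MulAction.orbit D.H τ) ≤ r → ∃ h : D.H,
            ‖(D.Ad (g * (UnitaryGGP.cayH κ r').val.val) T).val - (D.Ad h.val T).val‖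
              ≤ C₀ * ρ := by
          intro r' hr'
          refine hdist _ T ρ hρ0 ?_
          rw [← D.smul_traceEquiv, ← hτT, hρ]
          exact hr'
        rintro r' (rfl | rfl)
        exacts [hmem _ hz.2, hmem _ hz'.2]
      have h1 := hcenter g hg hg' hw hc' T ⟨τ, hτ, rfl⟩ ρ hρ0 hρ1 s s' hs hs' hconj
      have h2 : ‖s.val - s'.val‖ ≤ C₁ * ρ / ‖w‖ := by
        rw [le_div_iff₀ hw0, mul_comm]
        exact h1
      linarith
    have hval : Cμ * (2 * (C₁ * ρ / ‖w‖)) ^ d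
        = Cμ * (2 * C₁) ^ d * Cd * r / (Cd * ‖w‖ ^ d) := by
      rw [← hρ]
      simp only [mul_pow, div_pow]
      field_simp
    calc _ ≤ ENNReal.ofReal (Cμ * (2 * (C₁ * ρ / ‖w‖)) ^ d) := hS
      _ ≤ ENNReal.ofReal ((Cμ * (2 * C₁) ^ d * Cd + 1) * r / (Cd * ‖w‖ ^ d)) := by
          rw [hval]
          refine ENNReal.ofReal_le_ofReal ?_
          gcongr
          linarith
      _ = ENNReal.ofReal ((Cμ * (2 * C₁) ^ d * Cd + 1) * r) / ENNReal.ofReal (Cd * ‖w‖ ^ d) :=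
          ENNReal.ofReal_div_of_pos (by positivity)
      _ ≤ _ := ENNReal.div_le_div_left hdH _
  · have hperp := D.perpProj_eq_zero κ fun v hv hu => hV ⟨v, hv, hu⟩
    refine ⟨Set.univ, Filter.univ_mem, _,
      hopen.image_mem_nhds (UnitaryGGP.eventually_near_one κ one_pos), 1, one_pos, 1, one_pos, ?_⟩
    rintro τ - _ ⟨g, ⟨hg, -, -, hc, hc'⟩, rfl⟩ r hr -
    exact htop _ _ _ (by positivity) (UnitaryGGP.dH_eq_zero hN hperp g hg hc hc' κ)
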